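/- Identify $S^3$ with $SU(2)$ through $p=\begin{pmatrix}s&-\bar t\\ t&\bar s\end{pmatrix}$, $|s|^2+|t|^2=1$. Let $\Gamma\subset SU(2)$ be a finite subgroup acting on $S^3$ by left multiplication, and let $A_\Gamma$ be the algebra of complex polynomial functions (restrictions of polynomials in $s,t,\bar s,\bar t$) on $S^3$ that are $\Gamma$-invariant, i.e. of polynomial functions on $S^3/\Gamma$. For a form $P\in\mathbb C[s,t]$ let its multiplet $M(P)$ be the space of functions on $S^3$ spanned by $P,J_-P,J_-^2P,\dots$, where $J_-=-\bar t\,\partial_s+\bar s\,\partial_t$ is the lowering operator of the right action of $SU(2)$; it has spin $d/2$ if $P\neq0$ is homogeneous of degree $d$. The spin-$\frac d2$ component of a space $W$ of functions is the sum of all multiplets $M(f)\subset W$ with $f$ homogeneous of degree $d$. "Invariant form" means a non-constant homogeneous element of $\mathbb C[s,t]^\Gamma$. Then: 1. Invariant forms, and hence invariant forms of lowest degree, exist. If $P$ is a $\Gamma$-invariant homogeneous polynomial of degree $d=2j\ge2$, with Hessian $Q=P_{ss}P_{tt}-P_{st}^2$ and cross product $R=P_sQ_t-P_tQ_s$, then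 $Q$ and $R$ are $\Gamma$-invariant, the spin-$(2j-2)$ component of the span $M(P)\cdot M(P)$ of the quadratic products is $M(Q)$, and the spin-$(3j-3)$ component of the span $M(P)\cdot M(P)\cdot M(P)$ of the cubic products is $M(R)$. 2. If $\Gamma$ is neither cyclic nor binary dihedral (that is, $\Gamma$ is a binary tetrahedral, octahedral or icosahedral group), and $P$ is any invariant form of lowest degree, then $Q\ne0$, $R\neq0$, and $A_\Gamma$ is generated as an algebra by $M(P)$. 3. Let $n\ge1$ and $\Gamma=kC_nk^{-1}$ with $k\in SU(2)$ and $C_n$ generated by $\mathrm{diag}(e^{2\pi i/n},e^{-2\pi i/n})$. In the coordinates $k^{-1}(s,t)^T$, again denoted $(s,t)$, the forms $st$ and $s^n+t^n$ are invariant, $st$ has the lowest degree among invariant forms if $n\ge2$, $M(st)$ alone does not generate $A_\Gamma$, and $M(st)\cup M(s^n+t^n)$ generates $A_\Gamma$. 4. Let $n\ge1$ and $\Gamma=kD_{4n}k^{-1}$ with $k\in SU(2)$ and $D_{4n}$, of order $4n$, generated by $\mathrm{diag}(e^{\pi i/n},e^{-\pi i/n})$ and $\begin{pmatrix}0&-1\\1&0\end{pmatrix}$.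 In the coordinates $k^{-1}(s,t)^T$, again denoted $(s,t)$, the forms $s^2t^2$ and $s^{2n}+t^{2n}$ are invariant, $s^2t^2$ has the lowest degree among invariant forms if $n\ge2$, $M(s^2t^2)$ alone does not generate $A_\Gamma$, and $M(s^2t^2)\cup M(s^{2n}+t^{2n})$ generates $A_\Gamma$. 5. In all cases there are two (possibly equal) invariant forms $P_1,P_2$ such that $M(P_1)\cup M(P_2)$ generates $A_\Gamma$. -/

import Mathlib

open MvPolynomial

noncomputable section

namespace SphereQuotient

/-- The three-sphere, identified with the group `SU(2)` of the matrices
`p = !![s, -conj t; t, conj s]` with `|s|² + |t|² = 1`. -/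
abbrev SU2 : Type := Matrix.specialUnitaryGroup (Fin 2) ℂ

/-- The element `!![s, -conj t; t, conj s]` of `SU(2)`. -/
def SU2.mk (s t : ℂ) (h : Complex.normSq s + Complex.normSq t = 1) : SU2 :=
  ⟨!![s, -(starRingEnd ℂ t); t, starRingEnd ℂ s], by
    have h' : (starRingEnd ℂ s) * s + (starRingEnd ℂ t) * t = 1 := by
      rw [← Complex.normSq_eq_conj_mul_self, ← Complex.normSq_eq_conj_mul_self]
      exact_mod_cast h
    rw [Matrix.mem_specialUnitaryGroup_iff, Matrix.mem_unitaryGroup_iff']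
    constructor
    · ext i j
      fin_cases i <;> fin_cases j <;>
        simp [Matrix.mul_apply, Fin.sum_univ_two, Matrix.star_apply] <;>
        first | (linear_combination h') | ring
    · rw [Matrix.det_fin_two_of]
      linear_combination h'⟩

/-! ### Functions on the sphere and on its quotients -/

/-- Polynomials in `s, t, conj s, conj t`: the variable `Sum.inl 0` is `s`, `Sum.inl 1` is `t`,
`Sum.inr 0` is `conj s` and `Sum.inr 1` is `conj t`. -/
abbrev SphPoly : Type := MvPolynomial (Fin 2 ⊕ Fin 2) ℂ

/-- Restriction of a polynomial in `s, t, conj s, conj t` to the three-sphere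
(`s` and `t` are the entries of the first column). -/
def restrict : SphPoly →ₐ[ℂ] (SU2 → ℂ) :=
  aeval (Sum.elim (fun i (p : SU2) => (p : Matrix (Fin 2) (Fin 2) ℂ) i 0)
    (fun i (p : SU2) => starRingEnd ℂ ((p : Matrix (Fin 2) (Fin 2) ℂ) i 0)))

/-- The algebra of (complex valued) polynomial functions on the quotient of the sphere by the
left multiplications by elements of `Γ`: the polynomial functions on the sphere that are constant
on the orbits `Γ p`. -/
def quotientFunctions (Γ : Subgroup SU2) : Subalgebra ℂ (SU2 → ℂ) where
  carrier := {f | f ∈ restrict.range ∧ ∀ γ ∈ Γ, ∀ p, f (γ * p) = f p}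
  mul_mem' := fun {f g} hf hg => ⟨mul_mem hf.1 hg.1, fun γ hγ p => by
    simp only [Pi.mul_apply, hf.2 γ hγ p, hg.2 γ hγ p]⟩
  add_mem' := fun {f g} hf hg => ⟨add_mem hf.1 hg.1, fun γ hγ p => by
    simp only [Pi.add_apply, hf.2 γ hγ p, hg.2 γ hγ p]⟩
  algebraMap_mem' := fun c => ⟨Subalgebra.algebraMap_mem _ c, fun _ _ _ => rfl⟩

/-! ### Multiplets of the right `SU(2)` -/

/-- The lowering operator `J₋ = -conj t ∂_s + conj s ∂_t` of the right action of `SU(2)`. -/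
def lowering : Derivation ℂ SphPoly SphPoly :=
  mkDerivation ℂ (Sum.elim ![-X (Sum.inr 1), X (Sum.inr 0)] 0)

/-- The multiplet with highest weight vector `P(s, t)`: the space of functions on the sphere
spanned by the `J₋ ^ k P`. It has spin `d / 2` when `P` is non-zero and homogeneous of
degree `d`. -/
def multiplet (P : MvPolynomial (Fin 2) ℂ) : Submodule ℂ (SU2 → ℂ) :=
  Submodule.span ℂ (Set.range fun k : ℕ => restrict (lowering^[k] (rename Sum.inl P)))

/-- The component of spin `d / 2` of a space `W` of functions on the sphere: the sum of all the
multiplets of spin `d / 2` contained in `W`. -/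
def spinComponent (W : Submodule ℂ (SU2 → ℂ)) (d : ℕ) : Submodule ℂ (SU2 → ℂ) :=
  ⨆ f ∈ {f : MvPolynomial (Fin 2) ℂ | f.IsHomogeneous d ∧ multiplet f ≤ W}, multiplet f

/-! ### Binary forms and their invariants -/

/-- The polynomial `x ↦ P (A x)`, for `x = (s, t)`. -/
def subst (A : Matrix (Fin 2) (Fin 2) ℂ) (P : MvPolynomial (Fin 2) ℂ) : MvPolynomial (Fin 2) ℂ :=
  bind₁ (fun i => ∑ j, C (A i j) * X j) P

/-- `P` is invariant under `Γ`. -/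
def IsInvariant (Γ : Subgroup SU2) (P : MvPolynomial (Fin 2) ℂ) : Prop :=
  ∀ γ ∈ Γ, subst (γ : Matrix (Fin 2) (Fin 2) ℂ) P = P

/-- `P` is a non-constant homogeneous invariant of `Γ`, of degree `d`. -/
def IsInvariantForm (Γ : Subgroup SU2) (P : MvPolynomial (Fin 2) ℂ) (d : ℕ) : Prop :=
  P ≠ 0 ∧ 0 < d ∧ P.IsHomogeneous d ∧ IsInvariant Γ P

/-- `P` is a non-constant homogeneous invariant of `Γ` of the lowest possible degree, `d`. -/
def IsLowestInvariant (Γ : Subgroup SU2) (P : MvPolynomial (Fin 2) ℂ) (d : ℕ) : Prop :=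
  IsInvariantForm Γ P d ∧ ∀ P' d', IsInvariantForm Γ P' d' → d ≤ d'

/-- The Hessian of a binary form. -/
def hessian (P : MvPolynomial (Fin 2) ℂ) : MvPolynomial (Fin 2) ℂ :=
  pderiv 0 (pderiv 0 P) * pderiv 1 (pderiv 1 P) - pderiv 0 (pderiv 1 P) ^ 2

/-- The cross product (Jacobian determinant) of two binary forms. -/
def cross (P Q : MvPolynomial (Fin 2) ℂ) : MvPolynomial (Fin 2) ℂ :=
  pderiv 0 P * pderiv 1 Q - pderiv 1 P * pderiv 0 Q

/-! ### Cyclic and binary dihedral groups -/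

/-- The element `diag(ζ, ζ⁻¹)` of `SU(2)`, with `ζ = exp(2πi/n)`. -/
def rotation (n : ℕ) : SU2 :=
  SU2.mk (Complex.exp (2 * Real.pi * Complex.I / n)) 0 (by
    have : (2 * Real.pi * Complex.I / n : ℂ) = ((2 * Real.pi / n : ℝ) : ℂ) * Complex.I := by
      push_cast; ring
    rw [this, Complex.normSq_eq_norm_sq, Complex.norm_exp_ofReal_mul_I]
    simp)

/-- The cyclic group `C_n` of order `n`, in its diagonal form. -/
def cyclicGroup (n : ℕ) : Subgroup SU2 := Subgroup.zpowers (rotation n)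

/-- The binary dihedral group `D_{4n}` of order `4n`, generated by `diag(ζ, ζ⁻¹)` with
`ζ = exp(2πi/(2n))` and by `!![0, -1; 1, 0]`. -/
def binaryDihedralGroup (n : ℕ) : Subgroup SU2 :=
  Subgroup.closure {rotation (2 * n), SU2.mk 0 1 (by simp)}

/-- The conjugate `k H k⁻¹` of a subgroup `H` of `SU(2)`. -/
def conjugate (k : SU2) (H : Subgroup SU2) : Subgroup SU2 := H.map (MulAut.conj k).toMonoidHom

/-- The form `P` in the coordinates in which `k H k⁻¹` becomes `H`, that is `x ↦ P (k⁻¹ x)`. -/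
def transport (k : SU2) (P : MvPolynomial (Fin 2) ℂ) : MvPolynomial (Fin 2) ℂ :=
  subst ((k⁻¹ : SU2) : Matrix (Fin 2) (Fin 2) ℂ) P

end SphereQuotient

end

open MvPolynomial

noncomputable section

namespace SphereQuotient

/-! ### Linear substitutions in binary forms -/

/-! Forms in s, t are the highest weight vectors for the right action of SU(2), and the second
column (u, v) = (-conj t, conj s) of p is the J₋-image of the first. All multiplet computations rest
on matrix identities: multiplying the gradients and the Hessian matrix by the matrix with rows (s,
t) and (u, v), whose determinant is `radiusSq`, and using Euler's formula, expresses `radiusSq`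
times the cross product, and `radiusSq ^ 2` times the Hessian, through P, J₋P, J₋²P
(`radiusSq_mul_cross`, `radiusSq_sq_mul_hessian`). As `radiusSq` is killed by J₋ and equals 1 on the
sphere, these powers disappear on restriction. Hence for any algebra B of functions, the forms with
multiplet in B form an algebra `formsIn B` that is closed under cross products and Hessians of
homogeneous members.

Spin components. A highest weight vector of weight 2d-4 in M(P)·M(P) is, by weights of the right
torus, a combination of P·J₋²P and (J₋P)². Since J₊ kills it, the two coefficients are proportional
to those in the Hessian formula. The cubic case is similar, with an extra branch where the Hessian
vanishes.

Generation. Polynomial functions on the sphere are spanned by descendants of forms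
(`restrict_mem_multipletSpan`), and averaging over Γ commutes with J₋. So B contains A_Γ as soon as
`formsIn B` contains all invariant forms (`quotientFunctions_le`). What remains is classical
invariant theory of binary forms.

For the polyhedral groups there is an orbit on the projective line with n + 2 points whose
stabilizers have order n, with n = 4, 6, 10. The form with simple zeros there is the lowest
invariant P. An invariant of degree k that is non-zero at such a point has n ∣ k, and k = n does not
occur. Q and R have degrees 2n and 3n and do not vanish at the orbit, because its points are simple
zeros of P. So a suitable multiple of Q^a R^b cancels the value of any invariant there; the
difference is divisible by P, and induction on the degree shows that P, Q, R generate all invariants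
(`mem_of_isInvariant`). That every other finite group is cyclic or binary dihedral follows from
Klein's count of the poles, by Burnside's lemma (`cyclic_or_dihedral_or_threeOrbits`).

For cyclic and binary dihedral groups the invariants are found from monomials: the two given forms
and their cross product generate them. One multiplet is not enough because the first form is
invariant under a whole circle group, and the second is not. -/

/-- The substitution `subst A` as a homomorphism of algebras. -/
def substHom (A : Matrix (Fin 2) (Fin 2) ℂ) :
    MvPolynomial (Fin 2) ℂ →ₐ[ℂ] MvPolynomial (Fin 2) ℂ :=
  bind₁ (fun i => ∑ j, C (A i j) * X j)

theorem substHom_apply (A : Matrix (Fin 2) (Fin 2) ℂ) (P : MvPolynomial (Fin 2) ℂ) :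
    substHom A P = subst A P := rfl

theorem subst_X (A : Matrix (Fin 2) (Fin 2) ℂ) (i : Fin 2) :
    subst A (X i) = C (A i 0) * X 0 + C (A i 1) * X 1 := by
  simp [subst, bind₁_X_right, Fin.sum_univ_two]

theorem subst_C (A : Matrix (Fin 2) (Fin 2) ℂ) (c : ℂ) : subst A (C c) = C c := by
  simp [subst]

theorem subst_mul (A : Matrix (Fin 2) (Fin 2) ℂ) (P Q : MvPolynomial (Fin 2) ℂ) :
    subst A (P * Q) = subst A P * subst A Q := map_mul (substHom A) P Q

theorem subst_add (A : Matrix (Fin 2) (Fin 2) ℂ) (P Q : MvPolynomial (Fin 2) ℂ) :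
    subst A (P + Q) = subst A P + subst A Q := map_add (substHom A) P Q

theorem subst_sub (A : Matrix (Fin 2) (Fin 2) ℂ) (P Q : MvPolynomial (Fin 2) ℂ) :
    subst A (P - Q) = subst A P - subst A Q := map_sub (substHom A) P Q

theorem subst_pow (A : Matrix (Fin 2) (Fin 2) ℂ) (P : MvPolynomial (Fin 2) ℂ) (n : ℕ) :
    subst A (P ^ n) = subst A P ^ n := map_pow (substHom A) P n

theorem subst_subst (A B : Matrix (Fin 2) (Fin 2) ℂ) (P : MvPolynomial (Fin 2) ℂ) :
    subst A (subst B P) = subst (B * A) P := by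
  have : (substHom A).comp (substHom B) = substHom (B * A) := by
    ext i : 1
    simp only [AlgHom.comp_apply, substHom_apply, subst_X]
    simp only [subst_add, subst_mul, subst_C, subst_X,
      Matrix.mul_apply, Fin.sum_univ_two, map_add, map_mul]
    ring
  exact DFunLike.congr_fun this P

theorem subst_one (P : MvPolynomial (Fin 2) ℂ) : subst 1 P = P := by
  have : substHom 1 = AlgHom.id ℂ _ := by
    ext i : 1
    fin_cases i <;> simp [substHom_apply, subst_X]
  exact DFunLike.congr_fun this P

theorem subst_injective (p : SU2) : Function.Injective (subst (p : Matrix (Fin 2) (Fin 2) ℂ)) := by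
  intro P Q h
  have := congrArg (subst ((p⁻¹ : SU2) : Matrix (Fin 2) (Fin 2) ℂ)) h
  simpa only [subst_subst, ← Submonoid.coe_mul, mul_inv_cancel, Submonoid.coe_one,
    subst_one] using this

theorem subst_eq_zero_iff (p : SU2) (P : MvPolynomial (Fin 2) ℂ) :
    subst (p : Matrix (Fin 2) (Fin 2) ℂ) P = 0 ↔ P = 0 :=
  (map_eq_zero_iff (substHom _) (subst_injective p))

theorem isHomogeneous_subst (A : Matrix (Fin 2) (Fin 2) ℂ) {P : MvPolynomial (Fin 2) ℂ} {d : ℕ}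
    (h : P.IsHomogeneous d) : (subst A P).IsHomogeneous d := by
  have := h.aeval (S := ℂ) (n := 1) (fun i => ∑ j, C (A i j) * X j : Fin 2 → MvPolynomial (Fin 2) ℂ)
    (fun i => IsHomogeneous.sum _ _ _ fun j _ => isHomogeneous_C_mul_X _ _)
  rwa [one_mul] at this

theorem eval_subst (A : Matrix (Fin 2) (Fin 2) ℂ) (P : MvPolynomial (Fin 2) ℂ) (x : Fin 2 → ℂ) :
    eval x (subst A P) = eval (A.mulVec x) P := by
  induction P using MvPolynomial.induction_on with
  | C a => simp [subst_C]
  | add p q hp hq => simp only [subst_add, map_add, hp, hq]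
  | mul_X p i h =>
    rw [subst_mul, map_mul, h, map_mul, subst_X]
    fin_cases i <;> simp

theorem pderiv_subst (A : Matrix (Fin 2) (Fin 2) ℂ) (P : MvPolynomial (Fin 2) ℂ) (j : Fin 2) :
    pderiv j (subst A P) =
      C (A 0 j) * subst A (pderiv 0 P) + C (A 1 j) * subst A (pderiv 1 P) := by
  induction P using MvPolynomial.induction_on with
  | C a => simp [subst]
  | add p q hp hq => simp only [subst_add, map_add, hp, hq]; ring
  | mul_X p i h =>
    simp only [subst_mul, subst_X, Derivation.leibniz, h, smul_eq_mul, map_add, subst_add,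
      pderiv_C, mul_zero, add_zero, pderiv_X]
    have hz : subst A 0 = 0 := map_zero (substHom A)
    have ho : subst A 1 = 1 := map_one (substHom A)
    fin_cases i <;> fin_cases j <;> simp [hz, ho] <;> ring

theorem det_SU2 (p : SU2) : (p : Matrix (Fin 2) (Fin 2) ℂ).det = 1 :=
  (Matrix.mem_specialUnitaryGroup_iff.1 p.2).2

theorem det_SU2' (p : SU2) : (p : Matrix (Fin 2) (Fin 2) ℂ) 0 0 * (p : Matrix (Fin 2) (Fin 2) ℂ) 1 1
    - (p : Matrix (Fin 2) (Fin 2) ℂ) 0 1 * (p : Matrix (Fin 2) (Fin 2) ℂ) 1 0 = 1 := by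
  rw [← det_SU2 p, Matrix.det_fin_two]

theorem cross_subst (p : SU2) (P Q : MvPolynomial (Fin 2) ℂ) :
    cross (subst p P) (subst p Q) = subst p (cross P Q) := by
  have h : C ((p : Matrix (Fin 2) (Fin 2) ℂ) 0 0) * C ((p : Matrix (Fin 2) (Fin 2) ℂ) 1 1)
      - C ((p : Matrix (Fin 2) (Fin 2) ℂ) 0 1) * C ((p : Matrix (Fin 2) (Fin 2) ℂ) 1 0)
      = (1 : MvPolynomial (Fin 2) ℂ) := by
    rw [← C_mul, ← C_mul, ← C_sub, det_SU2', C_1]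
  simp only [cross, pderiv_subst, subst_sub, subst_mul]
  linear_combination (subst p (pderiv 0 P) * subst p (pderiv 1 Q) -
    subst p (pderiv 1 P) * subst p (pderiv 0 Q)) * h

theorem pderiv_comm (i j : Fin 2) (P : MvPolynomial (Fin 2) ℂ) :
    pderiv i (pderiv j P) = pderiv j (pderiv i P) := by
  ext m
  simp only [coeff_pderiv]
  rcases eq_or_ne i j with rfl | h
  · rfl
  · rw [add_right_comm m]
    simp [h, h.symm]
    ring

/-- The Hessian picks up the factor (det p)², and (det p)² - 1 = (det p + 1)(det p - 1) is a
multiple of the relation `h`. -/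
theorem hessian_subst (p : SU2) (P : MvPolynomial (Fin 2) ℂ) :
    hessian (subst p P) = subst p (hessian P) := by
  have h : C ((p : Matrix (Fin 2) (Fin 2) ℂ) 0 0) * C ((p : Matrix (Fin 2) (Fin 2) ℂ) 1 1)
      - C ((p : Matrix (Fin 2) (Fin 2) ℂ) 0 1) * C ((p : Matrix (Fin 2) (Fin 2) ℂ) 1 0)
      = (1 : MvPolynomial (Fin 2) ℂ) := by
    rw [← C_mul, ← C_mul, ← C_sub, det_SU2', C_1]
  simp only [hessian, pderiv_subst, subst_sub, subst_mul, subst_pow, map_add, pderiv_C_mul,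
    pderiv_comm 1 0]
  generalize C ((p : Matrix (Fin 2) (Fin 2) ℂ) 0 0) = a at h ⊢
  generalize C ((p : Matrix (Fin 2) (Fin 2) ℂ) 0 1) = b at h ⊢
  generalize C ((p : Matrix (Fin 2) (Fin 2) ℂ) 1 0) = c at h ⊢
  generalize C ((p : Matrix (Fin 2) (Fin 2) ℂ) 1 1) = e at h ⊢
  linear_combination (subst p (pderiv 0 (pderiv 0 P)) * subst p (pderiv 1 (pderiv 1 P)) -
    subst p (pderiv 0 (pderiv 1 P)) ^ 2) * (a * e - b * c + 1) * h

theorem IsInvariant.hessian {Γ : Subgroup SU2} {P : MvPolynomial (Fin 2) ℂ}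
    (h : IsInvariant Γ P) : IsInvariant Γ (hessian P) := fun γ hγ => by
  rw [← hessian_subst, h γ hγ]

theorem IsInvariant.cross {Γ : Subgroup SU2} {P Q : MvPolynomial (Fin 2) ℂ}
    (hP : IsInvariant Γ P) (hQ : IsInvariant Γ Q) : IsInvariant Γ (cross P Q) := fun γ hγ => by
  rw [← cross_subst, hP γ hγ, hQ γ hγ]

theorem isHomogeneous_hessian {P : MvPolynomial (Fin 2) ℂ} {d : ℕ} (h : P.IsHomogeneous d) :
    (hessian P).IsHomogeneous (2 * d - 4) := by
  have e : d - 1 - 1 + (d - 1 - 1) = 2 * d - 4 := by omega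
  have e' : (d - 1 - 1) * 2 = 2 * d - 4 := by omega
  refine IsHomogeneous.sub ?_ ?_
  · rw [← e]; exact h.pderiv.pderiv.mul h.pderiv.pderiv
  · rw [← e']; exact h.pderiv.pderiv.pow 2

theorem isHomogeneous_cross {P Q : MvPolynomial (Fin 2) ℂ} {d e : ℕ} (hP : P.IsHomogeneous d)
    (hQ : Q.IsHomogeneous e) : (cross P Q).IsHomogeneous (d - 1 + (e - 1)) :=
  (hP.pderiv.mul hQ.pderiv).sub (hP.pderiv.mul hQ.pderiv)

theorem euler {P : MvPolynomial (Fin 2) ℂ} {d : ℕ} (h : P.IsHomogeneous d) :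
    X 0 * pderiv 0 P + X 1 * pderiv 1 P = C (d : ℂ) * P := by
  have := h.sum_X_mul_pderiv
  simpa [Fin.sum_univ_two] using this

/-- For d = 2 the general degree count, with truncated subtraction, would give 1 instead of 0; there
the Hessian is constant and the cross product is zero. -/
theorem isHomogeneous_cross_hessian {P : MvPolynomial (Fin 2) ℂ} {d : ℕ} (hd : 2 ≤ d)
    (h : P.IsHomogeneous d) : (cross P (hessian P)).IsHomogeneous (3 * d - 6) := by
  rcases hd.eq_or_lt with rfl | hd
  · have : cross P (hessian P) = 0 := by
      have hq := isHomogeneous_hessian h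
      rw [show 2 * 2 - 4 = 0 by rfl, ← totalDegree_zero_iff_isHomogeneous,
        totalDegree_eq_zero_iff_eq_C] at hq
      rw [hq, cross]
      simp
    rw [this]
    exact isHomogeneous_zero _ _ _
  · have := isHomogeneous_cross h (isHomogeneous_hessian h)
    rwa [show d - 1 + (2 * d - 4 - 1) = 3 * d - 6 by omega] at this

/-! ### Elements of `SU(2)` -/

theorem SU2.star_mul (p : SU2) : star (p : Matrix (Fin 2) (Fin 2) ℂ) * (p : Matrix (Fin 2) (Fin 2) ℂ) = 1 :=
  Matrix.mem_unitaryGroup_iff'.1 (Matrix.mem_specialUnitaryGroup_iff.1 p.2).1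

theorem SU2.star_eq_adjugate (p : SU2) :
    star (p : Matrix (Fin 2) (Fin 2) ℂ) = (p : Matrix (Fin 2) (Fin 2) ℂ).adjugate := by
  have h := Matrix.mul_adjugate (p : Matrix (Fin 2) (Fin 2) ℂ)
  rw [det_SU2, one_smul] at h
  calc star (p : Matrix (Fin 2) (Fin 2) ℂ)
      = star (p : Matrix (Fin 2) (Fin 2) ℂ) * (p * (p : Matrix (Fin 2) (Fin 2) ℂ).adjugate) := by
        rw [h, mul_one]
    _ = _ := by rw [← mul_assoc, SU2.star_mul, one_mul]

theorem SU2.apply_one_one (p : SU2) : (p : Matrix (Fin 2) (Fin 2) ℂ) 1 1 =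
    starRingEnd ℂ ((p : Matrix (Fin 2) (Fin 2) ℂ) 0 0) := by
  have := congrFun (congrFun (SU2.star_eq_adjugate p) 0) 0
  rw [Matrix.adjugate_fin_two] at this
  simpa [Matrix.star_apply] using this.symm

theorem SU2.apply_zero_one (p : SU2) : (p : Matrix (Fin 2) (Fin 2) ℂ) 0 1 =
    -starRingEnd ℂ ((p : Matrix (Fin 2) (Fin 2) ℂ) 1 0) := by
  have := congrFun (congrFun (SU2.star_eq_adjugate p) 0) 1
  rw [Matrix.adjugate_fin_two] at this
  simp [Matrix.star_apply] at this
  rw [this, neg_neg]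

theorem SU2.conj_mul_add (p : SU2) :
    (p : Matrix (Fin 2) (Fin 2) ℂ) 0 0 * starRingEnd ℂ ((p : Matrix (Fin 2) (Fin 2) ℂ) 0 0) +
    (p : Matrix (Fin 2) (Fin 2) ℂ) 1 0 * starRingEnd ℂ ((p : Matrix (Fin 2) (Fin 2) ℂ) 1 0) = 1 := by
  have := det_SU2' p
  rw [SU2.apply_one_one, SU2.apply_zero_one] at this
  linear_combination this

theorem SU2.ext_col {p q : SU2}
    (h0 : (p : Matrix (Fin 2) (Fin 2) ℂ) 0 0 = (q : Matrix (Fin 2) (Fin 2) ℂ) 0 0)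
    (h1 : (p : Matrix (Fin 2) (Fin 2) ℂ) 1 0 = (q : Matrix (Fin 2) (Fin 2) ℂ) 1 0) : p = q := by
  apply Subtype.ext
  ext i j
  fin_cases i <;> fin_cases j
  · exact h0
  · simp [SU2.apply_zero_one, h1]
  · exact h1
  · simp [SU2.apply_one_one, h0]

theorem SU2.mul_col (p q : SU2) (i : Fin 2) : ((p * q : SU2) : Matrix (Fin 2) (Fin 2) ℂ) i 0 =
    (p : Matrix (Fin 2) (Fin 2) ℂ) i 0 * (q : Matrix (Fin 2) (Fin 2) ℂ) 0 0 +
    (p : Matrix (Fin 2) (Fin 2) ℂ) i 1 * (q : Matrix (Fin 2) (Fin 2) ℂ) 1 0 := by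
  rw [Submonoid.coe_mul, Matrix.mul_apply, Fin.sum_univ_two]

@[simp] theorem SU2.mk_zero_zero (s t : ℂ) (h) :
    ((SU2.mk s t h : SU2) : Matrix (Fin 2) (Fin 2) ℂ) 0 0 = s := rfl

@[simp] theorem SU2.mk_one_zero (s t : ℂ) (h) :
    ((SU2.mk s t h : SU2) : Matrix (Fin 2) (Fin 2) ℂ) 1 0 = t := rfl

theorem SU2.inv_zero_zero (p : SU2) : ((p⁻¹ : SU2) : Matrix (Fin 2) (Fin 2) ℂ) 0 0 =
    starRingEnd ℂ ((p : Matrix (Fin 2) (Fin 2) ℂ) 0 0) := rfl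

theorem SU2.inv_one_zero (p : SU2) : ((p⁻¹ : SU2) : Matrix (Fin 2) (Fin 2) ℂ) 1 0 =
    - (p : Matrix (Fin 2) (Fin 2) ℂ) 1 0 := by
  have : ((p⁻¹ : SU2) : Matrix (Fin 2) (Fin 2) ℂ) 1 0 =
    starRingEnd ℂ ((p : Matrix (Fin 2) (Fin 2) ℂ) 0 1) := rfl
  rw [this, SU2.apply_zero_one]
  simp

/-! ### The lowering operator -/

/-- The second column of `p`, whose entries are the images of `s` and `t` under `J₋`. -/
def secondColumn : Fin 2 → SphPoly := ![-X (Sum.inr 1), X (Sum.inr 0)]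

/-- The polynomial `|s|² + |t|²`, that is, the determinant of `p`. -/
def radiusSq : SphPoly := X (Sum.inl 0) * X (Sum.inr 0) + X (Sum.inl 1) * X (Sum.inr 1)

theorem restrict_radiusSq : restrict radiusSq = 1 := by
  ext p
  simp [restrict, radiusSq, SU2.conj_mul_add]

theorem lowering_X_inl (i : Fin 2) : lowering (X (Sum.inl i)) = secondColumn i := by
  rw [lowering, mkDerivation_X]; rfl

theorem lowering_X_inr (i : Fin 2) : lowering (X (Sum.inr i)) = 0 := by
  rw [lowering, mkDerivation_X]; rfl

theorem lowering_secondColumn (i : Fin 2) : lowering (secondColumn i) = 0 := by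
  fin_cases i <;> simp [secondColumn, lowering_X_inr]

theorem radiusSq_eq : radiusSq =
    X (Sum.inl 0) * secondColumn 1 - X (Sum.inl 1) * secondColumn 0 := by
  simp [radiusSq, secondColumn]

theorem radiusSq_ne_zero : radiusSq ≠ 0 := by
  intro h
  have := restrict_radiusSq
  rw [h, map_zero] at this
  exact zero_ne_one (congrFun this 1)

theorem lowering_radiusSq : lowering radiusSq = 0 := by
  simp only [radiusSq_eq, map_sub, Derivation.leibniz, lowering_X_inl, lowering_secondColumn,
    smul_eq_mul]
  ring

theorem lowering_rename (f : MvPolynomial (Fin 2) ℂ) : lowering (rename Sum.inl f) =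
    secondColumn 0 * rename Sum.inl (pderiv 0 f) + secondColumn 1 * rename Sum.inl (pderiv 1 f) := by
  induction f using MvPolynomial.induction_on with
  | C a => simp
  | add p q hp hq => simp only [map_add, hp, hq]; ring
  | mul_X p i h =>
    simp only [map_mul, Derivation.leibniz, h, smul_eq_mul, map_add, rename_X, pderiv_X,
      lowering_X_inl]
    fin_cases i <;> simp <;> ring

theorem iterate_lowering_mul_of_eq_zero {a : SphPoly} (ha : lowering a = 0) (F : SphPoly) (k : ℕ) :
    lowering^[k] (a * F) = a * lowering^[k] F := by
  induction k with
  | zero => rfl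
  | succ k ih =>
    rw [Function.iterate_succ_apply', ih, Function.iterate_succ_apply', Derivation.leibniz, ha]
    simp

/-- Powers of `radiusSq` make the identities below homogeneous; this is why they may be dropped at
the level of functions, even after lowering. -/
theorem restrict_iterate_lowering_radiusSq_mul (F : SphPoly) (k : ℕ) :
    restrict (lowering^[k] (radiusSq * F)) = restrict (lowering^[k] F) := by
  rw [iterate_lowering_mul_of_eq_zero lowering_radiusSq, map_mul, restrict_radiusSq, one_mul]

theorem iterate_lowering_add (F G : SphPoly) (k : ℕ) :
    lowering^[k] (F + G) = lowering^[k] F + lowering^[k] G :=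
  iterate_map_add lowering k F G

theorem iterate_lowering_smul (c : ℂ) (F : SphPoly) (k : ℕ) :
    lowering^[k] (c • F) = c • lowering^[k] F := by
  rw [← C_mul', iterate_lowering_mul_of_eq_zero (by simp [lowering]), C_mul']

/-- The Euler identity for the image of a form. -/
theorem euler_rename {P : MvPolynomial (Fin 2) ℂ} {d : ℕ} (h : P.IsHomogeneous d) :
    X (Sum.inl 0) * rename Sum.inl (pderiv 0 P) + X (Sum.inl 1) * rename Sum.inl (pderiv 1 P) =
      (d : SphPoly) * rename Sum.inl P := by
  have := congrArg (rename (Sum.inl : Fin 2 → Fin 2 ⊕ Fin 2)) (euler h)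
  simpa using this

/-- Multiply the matrix with rows (s, t), (u, v) by the one whose columns are the gradients of P and
Q. By Euler the product has rows (dP, eQ) and (J₋P, J₋Q); take determinants. -/
theorem radiusSq_mul_cross {P Q : MvPolynomial (Fin 2) ℂ} {d e : ℕ} (hP : P.IsHomogeneous d)
    (hQ : Q.IsHomogeneous e) :
    radiusSq * rename Sum.inl (cross P Q) =
      (d : SphPoly) * rename Sum.inl P * lowering (rename Sum.inl Q) -
      (e : SphPoly) * lowering (rename Sum.inl P) * rename Sum.inl Q := by
  rw [lowering_rename, lowering_rename, radiusSq_eq, cross]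
  simp only [map_sub, map_mul]
  linear_combination
    (secondColumn 0 * rename Sum.inl (pderiv 0 Q) +
      secondColumn 1 * rename Sum.inl (pderiv 1 Q)) * euler_rename hP -
    (secondColumn 0 * rename Sum.inl (pderiv 0 P) +
      secondColumn 1 * rename Sum.inl (pderiv 1 P)) * euler_rename hQ

theorem lowering_lowering_rename (f : MvPolynomial (Fin 2) ℂ) :
    lowering (lowering (rename Sum.inl f)) =
    secondColumn 0 ^ 2 * rename Sum.inl (pderiv 0 (pderiv 0 f)) +
    2 * secondColumn 0 * secondColumn 1 * rename Sum.inl (pderiv 0 (pderiv 1 f)) +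
    secondColumn 1 ^ 2 * rename Sum.inl (pderiv 1 (pderiv 1 f)) := by
  rw [lowering_rename]
  simp only [map_add, Derivation.leibniz, lowering_secondColumn, smul_eq_mul, lowering_rename,
    pderiv_comm 1 0]
  ring

/-- Congruence of the Hessian matrix by the matrix with rows (s, t), (u, v) gives the diagonal
entries d(d-1)P and J₋²P and the off-diagonal entry (d-1)J₋P, by Euler for P and its derivatives.
The claim is the determinant of this; `e2` and `e3` are its first and its off-diagonal entry. -/
theorem radiusSq_sq_mul_hessian {P : MvPolynomial (Fin 2) ℂ} {d : ℕ} (hd : 1 ≤ d)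
    (hP : P.IsHomogeneous d) :
    radiusSq ^ 2 * rename Sum.inl (hessian P) =
      ((d : SphPoly) - 1) * ((d : SphPoly) * rename Sum.inl P * lowering (lowering (rename Sum.inl P)) -
      ((d : SphPoly) - 1) * lowering (rename Sum.inl P) ^ 2) := by
  have e0 := euler_rename (hP.pderiv (i := 0))
  have e1 := euler_rename (hP.pderiv (i := 1))
  have e := euler_rename hP
  rw [Nat.cast_sub hd, Nat.cast_one] at e0 e1
  rw [lowering_lowering_rename, lowering_rename, radiusSq_eq, hessian]
  rw [pderiv_comm 1 0] at e0
  simp only [map_sub, map_mul, map_pow]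
  generalize rename Sum.inl (pderiv 0 (pderiv 0 P)) = a at *
  generalize rename Sum.inl (pderiv 0 (pderiv 1 P)) = b at *
  generalize rename Sum.inl (pderiv 1 (pderiv 1 P)) = c at *
  generalize rename Sum.inl (pderiv 0 P) = p0 at *
  generalize rename Sum.inl (pderiv 1 P) = p1 at *
  generalize rename Sum.inl P = p at *
  generalize secondColumn 0 = u at *
  generalize secondColumn 1 = v at *
  generalize (X (Sum.inl 0) : SphPoly) = s at *
  generalize (X (Sum.inl 1) : SphPoly) = t at *
  generalize (d : SphPoly) = n at *
  have e2 : (s ^ 2 * a + 2 * s * t * b + t ^ 2 * c) = n * (n - 1) * p := by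
    linear_combination s * e0 + t * e1 + (n - 1) * e
  have e3 : u * (s * a + t * b) + v * (s * b + t * c) = (n - 1) * (u * p0 + v * p1) := by
    linear_combination u * e0 + v * e1
  linear_combination (u ^ 2 * a + 2 * u * v * b + v ^ 2 * c) * e2 -
    (u * (s * a + t * b) + v * (s * b + t * c) + (n - 1) * (u * p0 + v * p1)) * e3

/-! ### Left translations -/

/-- The left translation by `γ`, on polynomials in `s, t, conj s, conj t`. -/
def leftTranslate (γ : SU2) : SphPoly →ₐ[ℂ] SphPoly :=
  aeval (Sum.elim
    (fun i => ∑ j, C ((γ : Matrix (Fin 2) (Fin 2) ℂ) i j) * X (Sum.inl j))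
    (fun i => ∑ j, C (starRingEnd ℂ ((γ : Matrix (Fin 2) (Fin 2) ℂ) i j)) * X (Sum.inr j)))

theorem restrict_X_inl (i : Fin 2) (p : SU2) :
    restrict (X (Sum.inl i)) p = (p : Matrix (Fin 2) (Fin 2) ℂ) i 0 := by
  simp [restrict]

theorem restrict_X_inr (i : Fin 2) (p : SU2) :
    restrict (X (Sum.inr i)) p = starRingEnd ℂ ((p : Matrix (Fin 2) (Fin 2) ℂ) i 0) := by
  simp [restrict]

theorem restrict_C (c : ℂ) (p : SU2) : restrict (C c) p = c := by
  simp [restrict]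

theorem restrict_leftTranslate (γ : SU2) (F : SphPoly) (p : SU2) :
    restrict (leftTranslate γ F) p = restrict F (γ * p) := by
  induction F using MvPolynomial.induction_on with
  | C a => simp [leftTranslate, restrict]
  | add p q hp hq => simp only [map_add, Pi.add_apply, hp, hq]
  | mul_X F i h =>
    rw [map_mul, map_mul, map_mul, Pi.mul_apply, Pi.mul_apply, h]
    congr 1
    rcases i with i | i
    · rw [restrict_X_inl, SU2.mul_col, leftTranslate, aeval_X]
      simp [Fin.sum_univ_two, restrict_X_inl]
    · rw [restrict_X_inr, SU2.mul_col, leftTranslate, aeval_X]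
      simp [Fin.sum_univ_two, restrict_X_inr]

theorem leftTranslate_rename (γ : SU2) (f : MvPolynomial (Fin 2) ℂ) :
    leftTranslate γ (rename Sum.inl f) = rename Sum.inl (subst γ f) := by
  induction f using MvPolynomial.induction_on with
  | C a => simp [leftTranslate, subst_C]
  | add p q hp hq => simp only [subst_add, map_add, hp, hq]
  | mul_X p i h =>
    rw [map_mul, map_mul, h, subst_mul, map_mul, subst_X]
    simp [leftTranslate, Fin.sum_univ_two]

theorem lowering_leftTranslate (γ : SU2) (F : SphPoly) :
    lowering (leftTranslate γ F) = leftTranslate γ (lowering F) := by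
  have hC (c : ℂ) : lowering (C c) = 0 := by simp [lowering]
  induction F using MvPolynomial.induction_on with
  | C a => simp [leftTranslate, hC]
  | add p q hp hq => simp only [map_add, hp, hq]
  | mul_X F i h =>
    simp only [map_mul, map_add, Derivation.leibniz, h, smul_eq_mul]
    congr 2
    rcases i with i | i
    · rw [leftTranslate, aeval_X, lowering_X_inl]
      fin_cases i <;>
        simp [Fin.sum_univ_two, Derivation.leibniz, hC, lowering_X_inl, secondColumn,
          SU2.apply_one_one, SU2.apply_zero_one] <;> ring
    · rw [lowering_X_inr, leftTranslate, aeval_X]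
      simp [Fin.sum_univ_two, Derivation.leibniz, hC, lowering_X_inr]

theorem iterate_lowering_leftTranslate (γ : SU2) (F : SphPoly) (k : ℕ) :
    lowering^[k] (leftTranslate γ F) = leftTranslate γ (lowering^[k] F) := by
  induction k with
  | zero => rfl
  | succ k ih => simp only [Function.iterate_succ_apply', ih, lowering_leftTranslate]

/-- Left translations commute with J₋, so invariance of a form passes to its whole multiplet. -/
theorem restrict_iterate_lowering_subst (γ p : SU2) (f : MvPolynomial (Fin 2) ℂ) (k : ℕ) :
    restrict (lowering^[k] (rename Sum.inl (subst γ f))) p =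
      restrict (lowering^[k] (rename Sum.inl f)) (γ * p) := by
  rw [← leftTranslate_rename, iterate_lowering_leftTranslate, restrict_leftTranslate]

theorem mem_multiplet (f : MvPolynomial (Fin 2) ℂ) (k : ℕ) :
    restrict (lowering^[k] (rename Sum.inl f)) ∈ multiplet f :=
  Submodule.subset_span ⟨k, rfl⟩

theorem multiplet_le_iff {f : MvPolynomial (Fin 2) ℂ} {W : Submodule ℂ (SU2 → ℂ)} :
    multiplet f ≤ W ↔ ∀ k, restrict (lowering^[k] (rename Sum.inl f)) ∈ W := by
  rw [multiplet, Submodule.span_le, Set.range_subset_iff]; rfl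

theorem multiplet_le_quotientFunctions {Γ : Subgroup SU2} {f : MvPolynomial (Fin 2) ℂ}
    (hf : IsInvariant Γ f) : multiplet f ≤ (quotientFunctions Γ).toSubmodule := by
  rw [multiplet_le_iff]
  exact fun k => ⟨⟨_, rfl⟩, fun γ hγ p => by
    rw [← restrict_iterate_lowering_subst, hf γ hγ]⟩

/-! ### Polynomials whose descendants lie in a given algebra of functions -/

/-- The polynomials all of whose descendants under `J₋` restrict to functions in `B`. -/
def descendantsIn (B : Subalgebra ℂ (SU2 → ℂ)) : Subalgebra ℂ SphPoly where
  carrier := {F | ∀ k, restrict (lowering^[k] F) ∈ B}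
  mul_mem' := fun {F G} hF hG k => by
    induction k generalizing F G with
    | zero => exact (map_mul restrict F G).symm ▸ B.mul_mem (hF 0) (hG 0)
    | succ k ih =>
      -- By Leibniz, level k + 1 of a product reduces to level k of two products whose factors again
      -- have all their descendants in `B`.
      rw [Function.iterate_succ_apply, Derivation.leibniz, smul_eq_mul, smul_eq_mul,
        iterate_lowering_add, map_add]
      exact B.add_mem (ih hF fun k => hG (k + 1)) (ih hG fun k => hF (k + 1))
  add_mem' := fun {F G} hF hG k => by
    rw [iterate_lowering_add, map_add]
    exact B.add_mem (hF k) (hG k)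
  algebraMap_mem' := fun c k => by
    rcases k with _ | k
    · exact (AlgHom.commutes restrict c).symm ▸ B.algebraMap_mem c
    · rw [Function.iterate_succ_apply]
      simp only [Derivation.map_algebraMap]
      rw [iterate_map_zero, map_zero]
      exact B.zero_mem

theorem lowering_mem_descendantsIn {B : Subalgebra ℂ (SU2 → ℂ)} {F : SphPoly}
    (hF : F ∈ descendantsIn B) : lowering F ∈ descendantsIn B := fun k => hF (k + 1)

theorem mem_descendantsIn_of_radiusSq_mul {B : Subalgebra ℂ (SU2 → ℂ)} {F : SphPoly}
    (hF : radiusSq * F ∈ descendantsIn B) : F ∈ descendantsIn B := fun k => by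
  rw [← restrict_iterate_lowering_radiusSq_mul]
  exact hF k

/-- The algebra of the `f ∈ ℂ[s, t]` whose multiplet is contained in `B`. -/
def formsIn (B : Subalgebra ℂ (SU2 → ℂ)) : Subalgebra ℂ (MvPolynomial (Fin 2) ℂ) :=
  (descendantsIn B).comap (rename Sum.inl)

theorem mem_formsIn_iff {B : Subalgebra ℂ (SU2 → ℂ)} {f : MvPolynomial (Fin 2) ℂ} :
    f ∈ formsIn B ↔ multiplet f ≤ B.toSubmodule := by
  rw [multiplet_le_iff]; rfl

/-- This closure property is what makes one or two multiplets suffice: covariants of the generators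
cost no new generators. -/
theorem cross_mem_formsIn {B : Subalgebra ℂ (SU2 → ℂ)} {P Q : MvPolynomial (Fin 2) ℂ} {d e : ℕ}
    (hP : P.IsHomogeneous d) (hQ : Q.IsHomogeneous e) (hPB : P ∈ formsIn B) (hQB : Q ∈ formsIn B) :
    cross P Q ∈ formsIn B := by
  apply mem_descendantsIn_of_radiusSq_mul
  change radiusSq * rename Sum.inl (cross P Q) ∈ _
  rw [radiusSq_mul_cross hP hQ]
  exact sub_mem (mul_mem (mul_mem (natCast_mem _ _) hPB) (lowering_mem_descendantsIn hQB))
    (mul_mem (mul_mem (natCast_mem _ _) (lowering_mem_descendantsIn hPB)) hQB)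

theorem hessian_mem_formsIn {B : Subalgebra ℂ (SU2 → ℂ)} {P : MvPolynomial (Fin 2) ℂ} {d : ℕ}
    (hd : 1 ≤ d) (hP : P.IsHomogeneous d) (hPB : P ∈ formsIn B) : hessian P ∈ formsIn B := by
  apply mem_descendantsIn_of_radiusSq_mul
  apply mem_descendantsIn_of_radiusSq_mul
  change radiusSq * (radiusSq * rename Sum.inl (hessian P)) ∈ _
  rw [← mul_assoc, ← pow_two, radiusSq_sq_mul_hessian hd hP]
  have h1 : rename Sum.inl P ∈ descendantsIn B := hPB
  have h2 := lowering_mem_descendantsIn h1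
  have h3 := lowering_mem_descendantsIn h2
  exact mul_mem (sub_mem (natCast_mem _ _) (one_mem _)) (sub_mem (mul_mem (mul_mem
    (natCast_mem _ _) h1) h3) (mul_mem (sub_mem (natCast_mem _ _) (one_mem _)) (pow_mem h2 2)))

/-! ### The polynomial functions are spanned by multiplets -/

/-- The span of all multiplets. -/
def multipletSpan : Submodule ℂ (SU2 → ℂ) :=
  Submodule.span ℂ {g | ∃ (d k : ℕ) (f : MvPolynomial (Fin 2) ℂ), f.IsHomogeneous d ∧
    g = restrict (lowering^[k] (rename Sum.inl f))}

theorem iterate_lowering_X_mul (i : Fin 2) (F : SphPoly) (k : ℕ) :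
    lowering^[k + 1] (X (Sum.inl i) * F) = X (Sum.inl i) * lowering^[k + 1] F +
      ((k : SphPoly) + 1) * (secondColumn i * lowering^[k] F) := by
  induction k with
  | zero => simp [Derivation.leibniz, lowering_X_inl]; ring
  | succ k ih =>
    rw [Function.iterate_succ_apply', ih, Function.iterate_succ_apply' _ (k + 1)]
    simp only [map_add, Derivation.leibniz, lowering_X_inl, lowering_secondColumn, smul_eq_mul,
      Derivation.map_natCast, Derivation.map_one_eq_zero, ← Function.iterate_succ_apply' lowering]
    push_cast
    ring

theorem cross_X_isHomogeneous (i : Fin 2) {f : MvPolynomial (Fin 2) ℂ} {d : ℕ}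
    (hf : f.IsHomogeneous d) : (cross (X i) f).IsHomogeneous (d - 1) := by
  have := isHomogeneous_cross (isHomogeneous_X ℂ i) hf
  simpa using this

/-- The Clebsch–Gordan decomposition of spin 1/2 times spin d/2: on the sphere, (d + 1) times the
product of the second column entry with f is J₋(X i · f) minus the cross product of X i and f. J₋
kills the second column, so the relation persists at every level k. -/
theorem secondColumn_mul_mem_multipletSpan (i : Fin 2) {f : MvPolynomial (Fin 2) ℂ} {d : ℕ}
    (hf : f.IsHomogeneous d) (k : ℕ) :
    restrict (secondColumn i * lowering^[k] (rename Sum.inl f)) ∈ multipletSpan := by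
  have h1 : restrict (lowering^[k + 1] (rename Sum.inl (X i * f))) ∈ multipletSpan :=
    Submodule.subset_span ⟨1 + d, _, _, (isHomogeneous_X ℂ i).mul hf, rfl⟩
  have h2 : restrict (lowering^[k] (rename Sum.inl (cross (X i) f))) ∈ multipletSpan :=
    Submodule.subset_span ⟨d - 1, _, _, cross_X_isHomogeneous i hf, rfl⟩
  have key : lowering^[k] (radiusSq * rename Sum.inl (cross (X i) f)) =
      lowering^[k + 1] (rename Sum.inl (X i * f)) -
      ((d : SphPoly) + 1) * (secondColumn i * lowering^[k] (rename Sum.inl f)) := by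
    have e : radiusSq * rename Sum.inl (cross (X i) f) =
        lowering (rename Sum.inl (X i * f)) +
        (-((d : SphPoly) + 1) * secondColumn i) * rename Sum.inl f := by
      rw [radiusSq_mul_cross (isHomogeneous_X ℂ i) hf]
      simp only [map_mul, rename_X, Derivation.leibniz, lowering_X_inl, smul_eq_mul]
      push_cast
      ring
    rw [e, iterate_lowering_add, iterate_lowering_mul_of_eq_zero, ← Function.iterate_succ_apply]
    · ring
    · simp [Derivation.leibniz, lowering_secondColumn]
  rw [← restrict_iterate_lowering_radiusSq_mul, key, map_sub] at h2
  have h3 := sub_mem h1 h2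
  rw [sub_sub_cancel, map_mul, map_add, map_natCast, map_one] at h3
  have h4 := multipletSpan.smul_mem ((d + 1 : ℂ)⁻¹) h3
  convert h4 using 1
  ext p
  have : (d + 1 : ℂ) ≠ 0 := by exact_mod_cast d.succ_ne_zero
  simp only [Pi.smul_apply, Pi.mul_apply, Pi.add_apply, Pi.natCast_apply, Pi.one_apply,
    smul_eq_mul]
  field_simp

theorem X_inl_mul_mem_multipletSpan (i : Fin 2) {f : MvPolynomial (Fin 2) ℂ} {d : ℕ}
    (hf : f.IsHomogeneous d) (k : ℕ) :
    restrict (X (Sum.inl i) * lowering^[k] (rename Sum.inl f)) ∈ multipletSpan := by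
  have h1 : restrict (lowering^[k] (rename Sum.inl (X i * f))) ∈ multipletSpan :=
    Submodule.subset_span ⟨1 + d, _, _, (isHomogeneous_X ℂ i).mul hf, rfl⟩
  rcases k with _ | k
  · simpa using h1
  · rw [map_mul (rename Sum.inl), rename_X, iterate_lowering_X_mul, map_add] at h1
    have h2 := multipletSpan.smul_mem (k + 1 : ℂ) (secondColumn_mul_mem_multipletSpan i hf k)
    have h3 := sub_mem h1 h2
    convert h3 using 1
    ext p
    simp

theorem mul_mem_multipletSpan (F : SphPoly)
    (hF : ∀ (d k : ℕ) (f : MvPolynomial (Fin 2) ℂ), f.IsHomogeneous d →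
      restrict (F * lowering^[k] (rename Sum.inl f)) ∈ multipletSpan)
    {g : SU2 → ℂ} (hg : g ∈ multipletSpan) : restrict F * g ∈ multipletSpan := by
  induction hg using Submodule.span_induction with
  | mem g h =>
    obtain ⟨d, k, f, hf, rfl⟩ := h
    rw [← map_mul]
    exact hF d k f hf
  | zero => simp
  | add x y _ _ hx hy => rw [mul_add]; exact add_mem hx hy
  | smul c x _ hx => rw [mul_smul_comm]; exact Submodule.smul_mem _ _ hx

/-- The span contains the constants and is stable under multiplication by the entries of both
columns of p, which are s, t, conj s, conj t up to sign. -/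
theorem restrict_mem_multipletSpan (F : SphPoly) : restrict F ∈ multipletSpan := by
  induction F using MvPolynomial.induction_on with
  | C a => exact Submodule.subset_span ⟨0, 0, C a, isHomogeneous_C _ _, by simp⟩
  | add p q hp hq => rw [map_add]; exact add_mem hp hq
  | mul_X F i h =>
    rw [mul_comm, map_mul]
    refine mul_mem_multipletSpan _ (fun d k f hf => ?_) h
    rcases i with i | i
    · exact X_inl_mul_mem_multipletSpan i hf k
    · fin_cases i
      · exact secondColumn_mul_mem_multipletSpan 1 hf k
      · have := neg_mem (secondColumn_mul_mem_multipletSpan 0 hf k)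
        rw [← map_neg, ← neg_mul] at this
        simpa [secondColumn] using this

/-! ### Averaging over Γ and reduction to invariant forms -/

/-- The average over a finite group. -/
def average (Γ : Subgroup SU2) [Fintype Γ] (f : MvPolynomial (Fin 2) ℂ) :
    MvPolynomial (Fin 2) ℂ :=
  (Fintype.card Γ : ℂ)⁻¹ • ∑ γ : Γ, subst ((γ : SU2) : Matrix (Fin 2) (Fin 2) ℂ) f

theorem subst_sum {ι : Type*} (A : Matrix (Fin 2) (Fin 2) ℂ) (s : Finset ι)
    (f : ι → MvPolynomial (Fin 2) ℂ) : subst A (∑ i ∈ s, f i) = ∑ i ∈ s, subst A (f i) :=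
  map_sum (substHom A) f s

theorem subst_smul (A : Matrix (Fin 2) (Fin 2) ℂ) (c : ℂ)
    (f : MvPolynomial (Fin 2) ℂ) : subst A (c • f) = c • subst A f :=
  map_smul (substHom A) c f

theorem isInvariant_average (Γ : Subgroup SU2) [Fintype Γ] (f : MvPolynomial (Fin 2) ℂ) :
    IsInvariant Γ (average Γ f) := fun γ hγ => by
  have hs : ∑ g : Γ, subst (γ : Matrix (Fin 2) (Fin 2) ℂ)
      (subst ((g : SU2) : Matrix (Fin 2) (Fin 2) ℂ) f) =
      ∑ g : Γ, subst ((g : SU2) : Matrix (Fin 2) (Fin 2) ℂ) f := by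
    refine Fintype.sum_equiv (Equiv.mulRight (⟨γ, hγ⟩ : Γ)) _ _ fun g => ?_
    rw [subst_subst, ← Submonoid.coe_mul, Equiv.coe_mulRight, Subgroup.coe_mul]
  rw [average, subst_smul, subst_sum, hs]

theorem isHomogeneous_smul {f : MvPolynomial (Fin 2) ℂ} {d : ℕ} (hf : f.IsHomogeneous d) (c : ℂ) :
    (c • f).IsHomogeneous d := by
  rw [← C_mul']; exact hf.C_mul c

theorem isHomogeneous_average (Γ : Subgroup SU2) [Fintype Γ] {f : MvPolynomial (Fin 2) ℂ} {d : ℕ}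
    (hf : f.IsHomogeneous d) : (average Γ f).IsHomogeneous d :=
  isHomogeneous_smul (IsHomogeneous.sum _ _ _ fun _ _ => isHomogeneous_subst _ hf) _

theorem iterate_lowering_sum {ι : Type*} (s : Finset ι) (F : ι → SphPoly) (k : ℕ) :
    lowering^[k] (∑ i ∈ s, F i) = ∑ i ∈ s, lowering^[k] (F i) := by
  induction k with
  | zero => rfl
  | succ k ih => simp only [Function.iterate_succ_apply', ih, map_sum]

theorem restrict_iterate_lowering_average (Γ : Subgroup SU2) [Fintype Γ]
    (f : MvPolynomial (Fin 2) ℂ) (k : ℕ) (p : SU2) :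
    restrict (lowering^[k] (rename Sum.inl (average Γ f))) p =
      (Fintype.card Γ : ℂ)⁻¹ * ∑ γ : Γ, restrict (lowering^[k] (rename Sum.inl f)) (γ * p) := by
  simp only [average, map_smul, map_sum, iterate_lowering_smul, iterate_lowering_sum,
    Pi.smul_apply, Finset.sum_apply, restrict_iterate_lowering_subst, smul_eq_mul]

/-- An algebra that contains the multiplets of all invariant forms contains all polynomial
functions on the quotient. -/
theorem quotientFunctions_le (Γ : Subgroup SU2) [Finite Γ] (B : Subalgebra ℂ (SU2 → ℂ))
    (h : ∀ (d : ℕ) (f : MvPolynomial (Fin 2) ℂ), f.IsHomogeneous d → IsInvariant Γ f →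
      f ∈ formsIn B) : quotientFunctions Γ ≤ B := by
  have := Fintype.ofFinite Γ
  -- The average of a descendant of f is the same descendant of the averaged form, which is
  -- invariant.
  have key : ∀ g ∈ multipletSpan,
      (fun p => (Fintype.card Γ : ℂ)⁻¹ * ∑ γ : Γ, g (γ * p)) ∈ B := by
    intro g hg
    induction hg using Submodule.span_induction with
    | mem g hg =>
      obtain ⟨d, k, f, hf, rfl⟩ := hg
      have := h d _ (isHomogeneous_average Γ hf) (isInvariant_average Γ f) k
      convert this using 1
      ext p
      exact (restrict_iterate_lowering_average Γ f k p).symm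
    | zero =>
      convert B.zero_mem using 1
      ext p
      simp
    | add x y _ _ hx hy =>
      convert B.add_mem hx hy using 1
      ext p
      simp [Finset.sum_add_distrib, mul_add]
    | smul c x _ hx =>
      convert B.smul_mem hx c using 1
      ext p
      simp only [Pi.smul_apply, smul_eq_mul, ← Finset.mul_sum]
      ring
  -- An invariant function equals its own average.
  rintro g ⟨⟨F, rfl⟩, hg⟩
  convert key _ (restrict_mem_multipletSpan F) using 1
  ext p
  have hc : (Fintype.card Γ : ℂ) ≠ 0 := by exact_mod_cast Fintype.card_ne_zero
  have hs : ∑ γ : Γ, restrict F (γ * p) = ∑ _γ : Γ, restrict F p :=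
    Finset.sum_congr rfl fun γ _ => hg γ γ.2 p
  rw [hs]
  simp [hc]

theorem adjoin_eq_quotientFunctions (Γ : Subgroup SU2) [Finite Γ] (S : Set (SU2 → ℂ))
    (hS : S ⊆ quotientFunctions Γ)
    (h : ∀ (d : ℕ) (f : MvPolynomial (Fin 2) ℂ), f.IsHomogeneous d → IsInvariant Γ f →
      f ∈ formsIn (Algebra.adjoin ℂ S)) : Algebra.adjoin ℂ S = quotientFunctions Γ :=
  le_antisymm (Algebra.adjoin_le hS) (quotientFunctions_le Γ _ h)

/-! ### The raising operator -/

/-- The raising operator `J₊` of the right action of `SU(2)`. -/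
def raising : Derivation ℂ SphPoly SphPoly :=
  mkDerivation ℂ (Sum.elim 0 ![X (Sum.inl 1), -X (Sum.inl 0)])

/-- The weight operator `2 J₃` of the right action of `SU(2)`. -/
def weight : Derivation ℂ SphPoly SphPoly :=
  mkDerivation ℂ (Sum.elim (fun i => X (Sum.inl i)) fun i => -X (Sum.inr i))

theorem raising_X_inl (i : Fin 2) : raising (X (Sum.inl i)) = 0 := by
  rw [raising, mkDerivation_X]; rfl

theorem raising_X_inr (i : Fin 2) :
    raising (X (Sum.inr i)) = (![X (Sum.inl 1), -X (Sum.inl 0)] : Fin 2 → SphPoly) i := by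
  rw [raising, mkDerivation_X]; rfl

theorem weight_X_inl (i : Fin 2) : weight (X (Sum.inl i)) = X (Sum.inl i) := by
  rw [weight, mkDerivation_X]; rfl

theorem weight_X_inr (i : Fin 2) : weight (X (Sum.inr i)) = -X (Sum.inr i) := by
  rw [weight, mkDerivation_X]; rfl

theorem raising_secondColumn (i : Fin 2) : raising (secondColumn i) = X (Sum.inl i) := by
  fin_cases i <;> simp [secondColumn, raising_X_inr]

theorem raising_lowering (F : SphPoly) :
    raising (lowering F) = lowering (raising F) + weight F := by
  have : ⁅raising, lowering⁆ = weight := by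
    refine derivation_ext fun i => ?_
    rw [Derivation.commutator_apply]
    rcases i with i | i
    · rw [lowering_X_inl, raising_secondColumn, raising_X_inl, weight_X_inl]; simp
    · rw [lowering_X_inr, weight_X_inr, raising_X_inr]
      fin_cases i <;> simp [lowering_X_inl, secondColumn]
  rw [← this, Derivation.commutator_apply]
  ring

theorem weight_lowering (F : SphPoly) :
    weight (lowering F) = lowering (weight F) - 2 * lowering F := by
  have hC : (C 2 : SphPoly) = 2 := map_ofNat C 2
  have : ⁅weight, lowering⁆ = (-2 : ℂ) • lowering := by
    refine derivation_ext fun i => ?_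
    rw [Derivation.commutator_apply]
    rcases i with i | i
    · fin_cases i <;>
        simp [lowering_X_inl, weight_X_inl, secondColumn, weight_X_inr, ← C_mul', hC] <;> ring
    · simp [lowering_X_inr, weight_X_inr]
  have h := DFunLike.congr_fun this F
  rw [Derivation.commutator_apply, Derivation.smul_apply, ← C_mul', C_neg, hC] at h
  linear_combination h

theorem raising_rename (f : MvPolynomial (Fin 2) ℂ) : raising (rename Sum.inl f) = 0 := by
  induction f using MvPolynomial.induction_on with
  | C a => simp
  | add p q hp hq => simp only [map_add, hp, hq, add_zero]
  | mul_X p i h => simp [Derivation.leibniz, h, raising_X_inl]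

theorem weight_rename {f : MvPolynomial (Fin 2) ℂ} {d : ℕ} (hf : f.IsHomogeneous d) :
    weight (rename Sum.inl f) = (d : SphPoly) * rename Sum.inl f := by
  rw [← euler_rename hf]
  clear hf
  induction f using MvPolynomial.induction_on with
  | C a => simp
  | add p q hp hq => simp only [map_add, hp, hq]; ring
  | mul_X p i h =>
    simp only [map_mul, Derivation.leibniz, h, smul_eq_mul, map_add, rename_X, pderiv_X,
      weight_X_inl]
    fin_cases i <;> simp <;> ring

theorem raising_radiusSq : raising radiusSq = 0 := by
  simp only [radiusSq_eq, map_sub, Derivation.leibniz, raising_X_inl, raising_secondColumn,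
    smul_eq_mul]
  ring

/-! ### The raising operator on descendants of a form -/

section descendants

variable {P : MvPolynomial (Fin 2) ℂ} {d : ℕ} (hP : P.IsHomogeneous d)
include hP

theorem raising_lowering_rename :
    raising (lowering (rename Sum.inl P)) = (d : SphPoly) * rename Sum.inl P := by
  rw [raising_lowering, raising_rename, map_zero, zero_add, weight_rename hP]

theorem weight_lowering_rename : weight (lowering (rename Sum.inl P)) =
    ((d : SphPoly) - 2) * lowering (rename Sum.inl P) := by
  rw [weight_lowering, weight_rename hP]
  simp [Derivation.leibniz]
  ring

theorem raising_lowering_lowering_rename : raising (lowering (lowering (rename Sum.inl P))) =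
    2 * ((d : SphPoly) - 1) * lowering (rename Sum.inl P) := by
  rw [raising_lowering, raising_lowering_rename hP, weight_lowering_rename hP]
  simp [Derivation.leibniz]
  ring

theorem raising_lowering_lowering_lowering_rename :
    raising (lowering (lowering (lowering (rename Sum.inl P)))) =
    3 * ((d : SphPoly) - 2) * lowering (lowering (rename Sum.inl P)) := by
  have h2 : lowering (2 : SphPoly) = 0 := Derivation.map_natCast _ 2
  rw [raising_lowering, raising_lowering_lowering_rename hP, weight_lowering,
    weight_lowering_rename hP]
  simp [Derivation.leibniz, h2]
  ring

/-- Insert the Hessian formula, and its image under J₋, into the formula for the cross product of P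
with a form of degree 2d - 4. -/
theorem radiusSq_cube_mul_cross (hd : 2 ≤ d) :
    radiusSq ^ 3 * rename Sum.inl (cross P (hessian P)) = ((d : SphPoly) - 1) *
      ((d : SphPoly) ^ 2 * rename Sum.inl P ^ 2 * lowering (lowering (lowering (rename Sum.inl P))) -
      3 * (d : SphPoly) * ((d : SphPoly) - 2) * rename Sum.inl P * lowering (rename Sum.inl P) *
        lowering (lowering (rename Sum.inl P)) +
      2 * ((d : SphPoly) - 1) * ((d : SphPoly) - 2) * lowering (rename Sum.inl P) ^ 3) := by
  have h1 := radiusSq_sq_mul_hessian (by omega) hP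
  have h2 := radiusSq_mul_cross hP (isHomogeneous_hessian hP)
  rw [Nat.cast_sub (by omega)] at h2
  push_cast at h2
  have h3 := congrArg lowering h1
  simp only [Derivation.leibniz, Derivation.leibniz_pow, lowering_radiusSq, smul_eq_mul, map_sub,
    Derivation.map_natCast, Derivation.map_one_eq_zero] at h3
  simp only [smul_zero, mul_zero, add_zero, sub_zero, nsmul_eq_mul, Nat.cast_ofNat] at h3
  linear_combination radiusSq ^ 2 * h2 + (d : SphPoly) * rename Sum.inl P * h3 -
    (2 * (d : SphPoly) - 4) * lowering (rename Sum.inl P) * h1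

end descendants

/-! ### Homogeneous polynomials are determined by their restrictions -/

theorem eval_mul_of_isHomogeneous {σ : Type*} {F : MvPolynomial σ ℂ} {n : ℕ}
    (hF : F.IsHomogeneous n) (c : ℂ) (x : σ → ℂ) :
    eval (fun i => c * x i) F = c ^ n * eval x F := by
  rw [eval_eq, eval_eq, Finset.mul_sum]
  refine Finset.sum_congr rfl fun m hm => ?_
  have : m.degree = n := by
    by_contra h
    exact (mem_support_iff.1 hm) (hF.coeff_eq_zero h)
  simp only [mul_pow, Finset.prod_mul_distrib, Finset.prod_pow_eq_pow_sum]
  rw [← this, Finsupp.degree_apply]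
  ring

theorem restrict_eq_eval (F : SphPoly) (p : SU2) : restrict F p =
    eval (Sum.elim (fun i => (p : Matrix (Fin 2) (Fin 2) ℂ) i 0)
      fun i => starRingEnd ℂ ((p : Matrix (Fin 2) (Fin 2) ℂ) i 0)) F := by
  induction F using MvPolynomial.induction_on with
  | C a => simp [restrict]
  | add p q hp hq => simp only [map_add, Pi.add_apply, hp, hq]
  | mul_X F i h =>
    rw [map_mul, Pi.mul_apply, h, map_mul]
    rcases i with i | i
    · simp [restrict_X_inl]
    · simp [restrict_X_inr]

theorem restrict_rename (f : MvPolynomial (Fin 2) ℂ) (p : SU2) :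
    restrict (rename Sum.inl f) p = eval (fun i => (p : Matrix (Fin 2) (Fin 2) ℂ) i 0) f := by
  rw [restrict_eq_eval, eval_rename]
  rfl

/-- Pass to real and imaginary parts: `ψ` substitutes a + ib and a - ib for a variable and its
conjugate. The result vanishes at all real points, hence identically, and `χ` inverts `ψ`. -/
theorem eq_zero_of_eval_conj_eq_zero (G : SphPoly)
    (h : ∀ x : Fin 2 → ℂ, eval (Sum.elim x fun i => starRingEnd ℂ (x i)) G = 0) : G = 0 := by
  let ψ : SphPoly →ₐ[ℂ] SphPoly := aeval (Sum.elim
    (fun i => X (Sum.inl i) + C Complex.I * X (Sum.inr i))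
    (fun i => X (Sum.inl i) - C Complex.I * X (Sum.inr i)))
  let χ : SphPoly →ₐ[ℂ] SphPoly := aeval (Sum.elim
    (fun i => C (1 / 2) * (X (Sum.inl i) + X (Sum.inr i)))
    (fun i => C (-Complex.I / 2) * (X (Sum.inl i) - X (Sum.inr i))))
  have hχψ : χ.comp ψ = AlgHom.id ℂ _ := by
    have hI : (C Complex.I * C (-Complex.I / 2) : SphPoly) = C (1 / 2) := by
      rw [← C_mul]; congr 1
      linear_combination (-1 / 2 : ℂ) * Complex.I_mul_I
    have h2 : (C (1 / 2) + C (1 / 2) : SphPoly) = 1 := by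
      rw [← C_add, ← C_1]; congr 1; norm_num
    ext i : 1
    rcases i with i | i
    · simp only [ψ, χ, AlgHom.comp_apply, aeval_X, Sum.elim_inl, Sum.elim_inr, map_add, map_mul,
        AlgHom.id_apply, algHom_C, algebraMap_eq]
      linear_combination (X (Sum.inl i) - X (Sum.inr i)) * hI + X (Sum.inl i) * h2
    · simp only [ψ, χ, AlgHom.comp_apply, aeval_X, Sum.elim_inl, Sum.elim_inr, map_sub, map_mul,
        AlgHom.id_apply, algHom_C, algebraMap_eq]
      linear_combination (-X (Sum.inl i) + X (Sum.inr i)) * hI + X (Sum.inr i) * h2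
  have hψ : ψ G = 0 := by
    refine funext_set (fun _ => Set.range ((↑) : ℝ → ℂ))
      (fun _ => Set.infinite_range_of_injective Complex.ofReal_injective) fun x hx => ?_
    have hx' : ∀ i, starRingEnd ℂ (x i) = x i := fun i => by
      obtain ⟨r, hr⟩ := hx i (Set.mem_univ i)
      rw [← hr, Complex.conj_ofReal]
    rw [map_zero, ← h fun i => x (Sum.inl i) + Complex.I * x (Sum.inr i)]
    simp only [ψ]
    clear h
    induction G using MvPolynomial.induction_on with
    | C a => simp
    | add p q hp hq => rw [map_add, map_add, map_add, hp, hq]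
    | mul_X F i h =>
      rw [map_mul, map_mul, map_mul, h]
      rcases i with i | i
      · simp
      · simp [hx', sub_eq_add_neg]
  have := DFunLike.congr_fun hχψ G
  rw [AlgHom.comp_apply, hψ, map_zero] at this
  exact this.symm

/-- Homogeneity extends the vanishing from the sphere to all non-zero vectors by scaling. The factor
`radiusSq` takes care of the origin. -/
theorem eq_zero_of_restrict_eq_zero {F : SphPoly} {n : ℕ} (hF : F.IsHomogeneous n)
    (h : restrict F = 0) : F = 0 := by
  suffices hz : F * radiusSq = 0 by
    exact (mul_eq_zero.1 hz).resolve_right radiusSq_ne_zero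
  refine eq_zero_of_eval_conj_eq_zero _ fun x => ?_
  rw [map_mul]
  set N := Complex.normSq (x 0) + Complex.normSq (x 1) with hN
  have hrad : eval (Sum.elim x fun i => starRingEnd ℂ (x i)) radiusSq = N := by
    simp [radiusSq, Complex.mul_conj, hN]
  rcases eq_or_ne N 0 with h0 | h0
  · rw [hrad, h0]; simp
  have hNpos : 0 < N := lt_of_le_of_ne
    (add_nonneg (Complex.normSq_nonneg _) (Complex.normSq_nonneg _)) h0.symm
  set r : ℝ := √N with hr
  have hr0 : r ≠ 0 := (Real.sqrt_pos.2 hNpos).ne'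
  have hrr : r * r = N := Real.mul_self_sqrt hNpos.le
  have hp : Complex.normSq (x 0 / r) + Complex.normSq (x 1 / r) = 1 := by
    rw [Complex.normSq_div, Complex.normSq_div, Complex.normSq_ofReal, hrr, ← add_div, ← hN,
      div_self h0]
  have hx : (Sum.elim x fun i => starRingEnd ℂ (x i)) = fun i => (r : ℂ) *
      (Sum.elim (fun i => ((SU2.mk _ _ hp : SU2) : Matrix (Fin 2) (Fin 2) ℂ) i 0)
      fun i => starRingEnd ℂ (((SU2.mk _ _ hp : SU2) : Matrix (Fin 2) (Fin 2) ℂ) i 0)) i := by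
    have hrc : (r : ℂ) ≠ 0 := by exact_mod_cast hr0
    ext i
    rcases i with i | i <;> fin_cases i <;> simp <;> field_simp
  have : eval (Sum.elim x fun i => starRingEnd ℂ (x i)) F = 0 := by
    rw [hx, eval_mul_of_isHomogeneous hF, ← restrict_eq_eval, h]
    simp
  rw [this, zero_mul]

theorem isHomogeneous_secondColumn (i : Fin 2) : (secondColumn i).IsHomogeneous 1 := by
  fin_cases i
  · exact (isHomogeneous_X ℂ _).neg
  · exact isHomogeneous_X ℂ _

theorem isHomogeneous_radiusSq : radiusSq.IsHomogeneous 2 :=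
  ((isHomogeneous_X ℂ _).mul (isHomogeneous_X ℂ _)).add
    ((isHomogeneous_X ℂ _).mul (isHomogeneous_X ℂ _))

theorem lowering_eq (F : SphPoly) : lowering F =
    secondColumn 0 * pderiv (Sum.inl 0) F + secondColumn 1 * pderiv (Sum.inl 1) F := by
  have : lowering =
      secondColumn 0 • pderiv (Sum.inl 0) + secondColumn 1 • pderiv (Sum.inl 1) := by
    refine derivation_ext fun i => ?_
    rcases i with i | i
    · fin_cases i <;> simp [lowering_X_inl, pderiv_X]
    · simp [lowering_X_inr, pderiv_X]
  exact DFunLike.congr_fun this F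

theorem isHomogeneous_lowering {F : SphPoly} {n : ℕ} (hF : F.IsHomogeneous n) :
    (lowering F).IsHomogeneous n := by
  rcases n with _ | n
  · rw [← totalDegree_zero_iff_isHomogeneous, totalDegree_eq_zero_iff_eq_C] at hF
    rw [hF, show lowering (C _) = 0 by simp [lowering]]
    exact isHomogeneous_zero _ _ _
  · rw [lowering_eq, add_comm n 1]
    exact ((isHomogeneous_secondColumn 0).mul hF.pderiv).add
      ((isHomogeneous_secondColumn 1).mul hF.pderiv)

/-! ### Weights of the right torus -/

/-- The element `diag(z, conj z)` of `SU(2)`. -/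
def diagonal (z : ℂ) (hz : Complex.normSq z = 1) : SU2 := SU2.mk z 0 (by simp [hz])

/-- The right translation by `diag(z, conj z)`, on polynomials in `s, t, conj s, conj t`. -/
def rightTorus (z : ℂ) : SphPoly →ₐ[ℂ] SphPoly :=
  aeval (Sum.elim (fun i => C z * X (Sum.inl i))
    fun i => C (starRingEnd ℂ z) * X (Sum.inr i))

theorem restrict_rightTorus (z : ℂ) (hz : Complex.normSq z = 1) (F : SphPoly) (p : SU2) :
    restrict (rightTorus z F) p = restrict F (p * diagonal z hz) := by
  induction F using MvPolynomial.induction_on with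
  | C a => simp [rightTorus, restrict]
  | add p q hp hq => simp only [map_add, Pi.add_apply, hp, hq]
  | mul_X F i h =>
    rw [map_mul, map_mul, map_mul, Pi.mul_apply, Pi.mul_apply, h]
    congr 1
    rcases i with i | i
    · rw [restrict_X_inl, SU2.mul_col, rightTorus, aeval_X]
      simp [restrict_X_inl, diagonal, mul_comm]
    · rw [restrict_X_inr, SU2.mul_col, rightTorus, aeval_X]
      simp [restrict_X_inr, diagonal, mul_comm]

theorem rightTorus_lowering (z : ℂ) (hz : Complex.normSq z = 1) (F : SphPoly) :
    rightTorus z (lowering F) = C (starRingEnd ℂ z) ^ 2 * lowering (rightTorus z F) := by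
  have hC (c : ℂ) : lowering (C c) = 0 := by simp [lowering]
  have hzz : (C (starRingEnd ℂ z) * C z : SphPoly) = 1 := by
    rw [← C_mul, ← Complex.normSq_eq_conj_mul_self, hz]; simp
  induction F using MvPolynomial.induction_on with
  | C a => simp [rightTorus, hC]
  | add p q hp hq => simp only [map_add, hp, hq]; ring
  | mul_X F i h =>
    simp only [map_mul, map_add, Derivation.leibniz, h, smul_eq_mul]
    have : rightTorus z (lowering (X i)) =
        C (starRingEnd ℂ z) ^ 2 * lowering (rightTorus z (X i)) := by
      rcases i with i | i
      · rw [lowering_X_inl, rightTorus, aeval_X]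
        fin_cases i <;>
          simp [Derivation.leibniz, hC, lowering_X_inl, secondColumn]
        · linear_combination (-C (starRingEnd ℂ z) * X (Sum.inr 1)) * hzz
        · linear_combination (-C (starRingEnd ℂ z) * X (Sum.inr 0)) * hzz
      · rw [lowering_X_inr, rightTorus, aeval_X]
        simp [Derivation.leibniz, hC, lowering_X_inr]
    rw [this]
    ring

theorem rightTorus_rename (z : ℂ) {f : MvPolynomial (Fin 2) ℂ} {d : ℕ} (hf : f.IsHomogeneous d) :
    rightTorus z (rename Sum.inl f) = C z ^ d * rename Sum.inl f := by
  refine MvPolynomial.funext fun x => ?_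
  have h1 : eval x (rightTorus z (rename Sum.inl f)) = eval (fun i => z * x (Sum.inl i)) f := by
    clear hf
    induction f using MvPolynomial.induction_on with
    | C a => simp [rightTorus]
    | add p q hp hq => simp only [map_add, hp, hq]
    | mul_X F i h =>
      rw [map_mul, map_mul, map_mul, h, map_mul]
      simp [rightTorus]
  rw [h1, eval_mul_of_isHomogeneous hf, map_mul, map_pow, eval_C, eval_rename]
  rfl

theorem rightTorus_iterate_lowering (z : ℂ) (hz : Complex.normSq z = 1)
    {f : MvPolynomial (Fin 2) ℂ} {d : ℕ} (hf : f.IsHomogeneous d) (k : ℕ) :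
    rightTorus z (lowering^[k] (rename Sum.inl f)) =
      C (z ^ d * starRingEnd ℂ z ^ (2 * k)) * lowering^[k] (rename Sum.inl f) := by
  induction k with
  | zero => simp [rightTorus_rename z hf]
  | succ k ih =>
    have hC (c : ℂ) : lowering (C c) = 0 := by simp [lowering]
    rw [Function.iterate_succ_apply', rightTorus_lowering z hz, ih, Derivation.leibniz, hC]
    simp only [smul_eq_mul, mul_zero, add_zero, C_mul, C_pow]
    ring

theorem normSq_exp_I : Complex.normSq (Complex.exp Complex.I) = 1 := by
  rw [Complex.normSq_eq_norm_sq, ← one_mul Complex.I, ← Complex.ofReal_one,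
    Complex.norm_exp_ofReal_mul_I, one_pow]

/-- exp(i) has infinite order since n = 2πm with n ≠ 0 would make π rational. A single torus element
then separates all weights. -/
theorem eq_zero_of_conj_exp_I_pow_eq_one {n : ℕ}
    (h : starRingEnd ℂ (Complex.exp Complex.I) ^ n = 1) : n = 0 := by
  by_contra hn
  rw [← map_pow, map_eq_one_iff _ (starRingEnd ℂ).injective, ← Complex.exp_nat_mul,
    Complex.exp_eq_one_iff] at h
  obtain ⟨m, hm⟩ := h
  have h2 : ((n : ℝ) : ℂ) = ((m * (2 * Real.pi) : ℝ) : ℂ) := by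
    refine mul_right_cancel₀ Complex.I_ne_zero ?_
    push_cast
    linear_combination hm
  have h3 : (n : ℝ) = m * (2 * Real.pi) := Complex.ofReal_injective h2
  have hm0 : (m : ℝ) ≠ 0 := by
    intro h0
    rw [h0, zero_mul] at h3
    exact hn (by exact_mod_cast h3)
  refine irrational_pi ⟨(n : ℚ) / (2 * m), ?_⟩
  push_cast
  rw [h3]
  field_simp

/-- The right translation by an element of infinite order of the diagonal torus. -/
def torusShift : Module.End ℂ (SU2 → ℂ) :=
  LinearMap.funLeft ℂ ℂ (· * diagonal (Complex.exp Complex.I) normSq_exp_I)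

/-- The functions of weight `N - 2k` for the right action of the diagonal torus. -/
def weightSpace (N k : ℕ) : Submodule ℂ (SU2 → ℂ) :=
  torusShift.eigenspace (Complex.exp Complex.I ^ N *
    starRingEnd ℂ (Complex.exp Complex.I) ^ (2 * k))

theorem iSupIndep_weightSpace (N : ℕ) : iSupIndep (weightSpace N) := by
  have key : ∀ k l : ℕ, k ≤ l → starRingEnd ℂ (Complex.exp Complex.I) ^ (2 * k) =
      starRingEnd ℂ (Complex.exp Complex.I) ^ (2 * l) → k = l := by
    intro k l hkl h
    obtain ⟨m, rfl⟩ := Nat.exists_eq_add_of_le hkl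
    rw [mul_add, pow_add, left_eq_mul₀ (pow_ne_zero _ (by simp))] at h
    have := eq_zero_of_conj_exp_I_pow_eq_one h
    omega
  refine torusShift.eigenspaces_iSupIndep.comp fun k l h => ?_
  have h' := mul_left_cancel₀ (pow_ne_zero _ (Complex.exp_ne_zero _)) h
  rcases le_total k l with hkl | hkl
  · exact key k l hkl h'
  · exact (key l k hkl h'.symm).symm

theorem mem_weightSpace_iff {N k : ℕ} {g : SU2 → ℂ} : g ∈ weightSpace N k ↔
    ∀ p, g (p * diagonal (Complex.exp Complex.I) normSq_exp_I) =
      (Complex.exp Complex.I ^ N * starRingEnd ℂ (Complex.exp Complex.I) ^ (2 * k)) * g p := by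
  rw [weightSpace, Module.End.mem_eigenspace_iff, funext_iff]
  rfl

theorem mul_mem_weightSpace {N N' k k' : ℕ} {g g' : SU2 → ℂ} (h : g ∈ weightSpace N k)
    (h' : g' ∈ weightSpace N' k') : g * g' ∈ weightSpace (N + N') (k + k') := by
  rw [mem_weightSpace_iff] at *
  intro p
  rw [Pi.mul_apply, h p, h' p, Pi.mul_apply]
  ring

theorem descendant_mem_weightSpace {f : MvPolynomial (Fin 2) ℂ} {d : ℕ} (hf : f.IsHomogeneous d)
    (k : ℕ) : restrict (lowering^[k] (rename Sum.inl f)) ∈ weightSpace d k := by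
  rw [mem_weightSpace_iff]
  intro p
  rw [← restrict_rightTorus, rightTorus_iterate_lowering _ normSq_exp_I hf, map_mul, Pi.mul_apply,
    restrict_C]

/-- The eigenvalue depends only on the weight N - 2k. -/
theorem weightSpace_add (N k j : ℕ) : weightSpace N k = weightSpace (N + 2 * j) (k + j) := by
  ext g
  rw [mem_weightSpace_iff, mem_weightSpace_iff]
  have h : Complex.exp Complex.I * starRingEnd ℂ (Complex.exp Complex.I) = 1 := by
    rw [Complex.mul_conj, normSq_exp_I, Complex.ofReal_one]
  have : Complex.exp Complex.I ^ (N + 2 * j) *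
      starRingEnd ℂ (Complex.exp Complex.I) ^ (2 * (k + j)) = Complex.exp Complex.I ^ N *
      starRingEnd ℂ (Complex.exp Complex.I) ^ (2 * k) *
      (Complex.exp Complex.I * starRingEnd ℂ (Complex.exp Complex.I)) ^ (2 * j) := by
    ring
  rw [this, h, one_pow, mul_one]

theorem mem_of_iSupIndep {V : Type*} [AddCommGroup V] [Module ℂ V] {E W : ℕ → Submodule ℂ V}
    (hE : iSupIndep E) (hW : ∀ k, W k ≤ E k) {x : V} (hx : x ∈ ⨆ k, W k) {j : ℕ} (hj : x ∈ E j) :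
    x ∈ W j := by
  obtain ⟨w, hw, rfl⟩ := (Submodule.mem_iSup_iff_exists_finsupp _ _).1 hx
  have hsum : (w.sum fun _ => id) = w j + ∑ k ∈ w.support.erase j, w k := by
    by_cases h : j ∈ w.support
    · exact (Finset.add_sum_erase _ _ h).symm
    · rw [Finset.erase_eq_of_notMem h, Finsupp.notMem_support_iff.1 h, zero_add]
      rfl
  have h1 : ∑ k ∈ w.support.erase j, w k ∈ E j := by
    have := sub_mem hj (hW j (hw j))
    change (w.sum fun _ => id) - w j ∈ E j at this
    rwa [hsum, add_sub_cancel_left] at this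
  have h2 : ∑ k ∈ w.support.erase j, w k ∈ ⨆ k, ⨆ (_ : k ≠ j), E k :=
    Submodule.sum_mem _ fun k hk =>
      Submodule.mem_iSup_of_mem k (Submodule.mem_iSup_of_mem (Finset.ne_of_mem_erase hk)
        (hW k (hw k)))
  have h3 : ∑ k ∈ w.support.erase j, w k = 0 := by
    have := (Submodule.disjoint_def.1 (hE j)) _ h1 h2
    exact this
  change (w.sum fun _ => id) ∈ W j
  rw [hsum, h3, add_zero]
  exact hw j

/-! ### Quadratic and cubic products -/

/-- The span of the products of two descendants of total level `k`. -/
def quadraticLevel (P : MvPolynomial (Fin 2) ℂ) (k : ℕ) : Submodule ℂ (SU2 → ℂ) :=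
  Submodule.span ℂ {g | ∃ i j, i + j = k ∧ g = restrict (lowering^[i] (rename Sum.inl P)) *
    restrict (lowering^[j] (rename Sum.inl P))}

/-- The span of the products of three descendants of total level `k`. -/
def cubicLevel (P : MvPolynomial (Fin 2) ℂ) (k : ℕ) : Submodule ℂ (SU2 → ℂ) :=
  Submodule.span ℂ {g | ∃ i j l, i + j + l = k ∧ g = restrict (lowering^[i] (rename Sum.inl P)) *
    restrict (lowering^[j] (rename Sum.inl P)) * restrict (lowering^[l] (rename Sum.inl P))}

theorem multiplet_mul_le (P : MvPolynomial (Fin 2) ℂ) :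
    multiplet P * multiplet P ≤ ⨆ k, quadraticLevel P k := by
  rw [multiplet, Submodule.span_mul_span, Submodule.span_le]
  rintro _ ⟨_, ⟨i, rfl⟩, _, ⟨j, rfl⟩, rfl⟩
  exact Submodule.mem_iSup_of_mem (i + j) (Submodule.subset_span ⟨i, j, rfl, rfl⟩)

theorem multiplet_mul_mul_le (P : MvPolynomial (Fin 2) ℂ) :
    multiplet P * multiplet P * multiplet P ≤ ⨆ k, cubicLevel P k := by
  rw [multiplet, Submodule.span_mul_span, Submodule.span_mul_span, Submodule.span_le]
  rintro _ ⟨_, ⟨_, ⟨i, rfl⟩, _, ⟨j, rfl⟩, rfl⟩, _, ⟨l, rfl⟩, rfl⟩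
  exact Submodule.mem_iSup_of_mem (i + j + l) (Submodule.subset_span ⟨i, j, l, rfl, rfl⟩)

section products

variable {P : MvPolynomial (Fin 2) ℂ} {d : ℕ} (hd : 2 ≤ d) (hP : P.IsHomogeneous d)
include hd hP

/-- The function f has weight 2d - 4 = 2d - 2·2, so weights single out the products of total level
two, spanned by P·J₋²P and (J₋P)². The factor `radiusSq ^ 2` brings both sides to degree 2d, which
turns the identity on the sphere into one of polynomials, where J₊ can be applied. The cubic
analogue below is the same with total level three. -/
theorem exists_of_restrict_mem_mul {f : MvPolynomial (Fin 2) ℂ} (hf : f.IsHomogeneous (2 * d - 4))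
    (h : restrict (rename Sum.inl f) ∈ multiplet P * multiplet P) :
    ∃ a b : ℂ, radiusSq ^ 2 * rename Sum.inl f =
      C a * (rename Sum.inl P * lowering (lowering (rename Sum.inl P))) +
      C b * lowering (rename Sum.inl P) ^ 2 := by
  have hmem : restrict (rename Sum.inl f) ∈ quadraticLevel P 2 := by
    refine mem_of_iSupIndep (iSupIndep_weightSpace (d + d)) (fun k => ?_) (multiplet_mul_le P h) ?_
    · rw [quadraticLevel, Submodule.span_le]
      rintro _ ⟨i, j, rfl, rfl⟩
      exact mul_mem_weightSpace (descendant_mem_weightSpace hP i) (descendant_mem_weightSpace hP j)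
    · have := descendant_mem_weightSpace hf 0
      rwa [weightSpace_add _ 0 2, show 2 * d - 4 + 2 * 2 = d + d by omega] at this
  have hle : quadraticLevel P 2 ≤ Submodule.span ℂ
      {restrict (rename Sum.inl P * lowering (lowering (rename Sum.inl P))),
        restrict (lowering (rename Sum.inl P) ^ 2)} := by
    rw [quadraticLevel, Submodule.span_le]
    rintro _ ⟨i, j, hij, rfl⟩
    refine Submodule.subset_span ?_
    obtain ⟨rfl, rfl⟩ | ⟨rfl, rfl⟩ | ⟨rfl, rfl⟩ :
      (i = 0 ∧ j = 2) ∨ (i = 1 ∧ j = 1) ∨ (i = 2 ∧ j = 0) := by omega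
    · left; simp
    · right; simp [pow_two]
    · left; simp [mul_comm]
  obtain ⟨a, b, hab⟩ := Submodule.mem_span_pair.1 (hle hmem)
  refine ⟨a, b, sub_eq_zero.1 (eq_zero_of_restrict_eq_zero (n := d + d) ?_ ?_)⟩
  · have h0 : (rename Sum.inl P : SphPoly).IsHomogeneous d := hP.rename_isHomogeneous
    have h1 := isHomogeneous_lowering h0
    have h2 := isHomogeneous_lowering h1
    refine IsHomogeneous.sub ?_ (((h0.mul h2).C_mul a).add ?_)
    · have := (isHomogeneous_radiusSq.pow 2).mul
        (hf.rename_isHomogeneous (f := (Sum.inl : Fin 2 → Fin 2 ⊕ Fin 2)))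
      rwa [show 2 * 2 + (2 * d - 4) = d + d by omega] at this
    · rw [pow_two]; exact (h1.mul h1).C_mul b
  · rw [map_sub, map_mul, map_pow, restrict_radiusSq, one_pow, one_mul, ← hab, C_mul', C_mul',
      map_add, map_smul, map_smul, sub_self]

theorem exists_of_restrict_mem_mul_mul {f : MvPolynomial (Fin 2) ℂ}
    (hf : f.IsHomogeneous (3 * d - 6))
    (h : restrict (rename Sum.inl f) ∈ multiplet P * multiplet P * multiplet P) :
    ∃ a b c : ℂ, radiusSq ^ 3 * rename Sum.inl f =
      C a * (rename Sum.inl P ^ 2 * lowering (lowering (lowering (rename Sum.inl P)))) +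
      C b * (rename Sum.inl P * lowering (rename Sum.inl P) *
        lowering (lowering (rename Sum.inl P))) +
      C c * lowering (rename Sum.inl P) ^ 3 := by
  have hmem : restrict (rename Sum.inl f) ∈ cubicLevel P 3 := by
    refine mem_of_iSupIndep (iSupIndep_weightSpace (d + d + d)) (fun k => ?_)
      (multiplet_mul_mul_le P h) ?_
    · rw [cubicLevel, Submodule.span_le]
      rintro _ ⟨i, j, l, rfl, rfl⟩
      exact mul_mem_weightSpace (mul_mem_weightSpace (descendant_mem_weightSpace hP i)
        (descendant_mem_weightSpace hP j)) (descendant_mem_weightSpace hP l)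
    · have := descendant_mem_weightSpace hf 0
      rwa [weightSpace_add _ 0 3, show 3 * d - 6 + 2 * 3 = d + d + d by omega] at this
  have hle : cubicLevel P 3 ≤ Submodule.span ℂ
      {restrict (rename Sum.inl P ^ 2 * lowering (lowering (lowering (rename Sum.inl P)))),
        restrict (rename Sum.inl P * lowering (rename Sum.inl P) *
          lowering (lowering (rename Sum.inl P))),
        restrict (lowering (rename Sum.inl P) ^ 3)} := by
    rw [cubicLevel, Submodule.span_le]
    rintro _ ⟨i, j, l, hij, rfl⟩
    refine Submodule.subset_span ?_
    simp only [← map_mul]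
    have hi : i ≤ 3 := by omega
    have hj : j ≤ 3 - i := by omega
    have hl : l = 3 - i - j := by omega
    interval_cases i <;> interval_cases j <;> norm_num at hl <;> subst hl <;>
      simp only [Function.iterate_succ, Function.iterate_zero, Function.comp_apply, id_eq] <;>
      first
      | exact Or.inl (congrArg restrict (by ring1))
      | exact Or.inr (Or.inl (congrArg restrict (by ring1)))
      | exact Or.inr (Or.inr (congrArg restrict (by ring1)))
  obtain ⟨a, b, c, hab⟩ := Submodule.mem_span_triple.1 (hle hmem)
  refine ⟨a, b, c, sub_eq_zero.1 (eq_zero_of_restrict_eq_zero (n := d + d + d) ?_ ?_)⟩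
  · have h0 : (rename Sum.inl P : SphPoly).IsHomogeneous d := hP.rename_isHomogeneous
    have h1 := isHomogeneous_lowering h0
    have h2 := isHomogeneous_lowering h1
    have h3 := isHomogeneous_lowering h2
    refine IsHomogeneous.sub ?_ ((IsHomogeneous.add ?_ (((h0.mul h1).mul h2).C_mul b)).add ?_)
    · have := (isHomogeneous_radiusSq.pow 3).mul
        (hf.rename_isHomogeneous (f := (Sum.inl : Fin 2 → Fin 2 ⊕ Fin 2)))
      rwa [show 2 * 3 + (3 * d - 6) = d + d + d by omega] at this
    · rw [pow_two]; exact ((h0.mul h0).mul h3).C_mul a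
    · rw [pow_succ, pow_two]; exact ((h1.mul h1).mul h1).C_mul c
  · rw [map_sub, map_mul, map_pow, restrict_radiusSq, one_pow, one_mul, ← hab, C_mul', C_mul',
      C_mul', map_add, map_add, map_smul, map_smul, map_smul, sub_self]

end products

/-! ### Identification of the spin components -/

theorem multiplet_smul_le (c : ℂ) (f : MvPolynomial (Fin 2) ℂ) :
    multiplet (c • f) ≤ multiplet f := by
  rw [multiplet_le_iff]
  intro k
  rw [map_smul, iterate_lowering_smul, map_smul]
  exact Submodule.smul_mem _ _ (mem_multiplet f k)

/-- The span of the descendants of a form, in the ring of polynomials. -/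
def descendantSpan (P : MvPolynomial (Fin 2) ℂ) : Submodule ℂ SphPoly :=
  Submodule.span ℂ (Set.range fun k : ℕ => lowering^[k] (rename Sum.inl P))

theorem map_restrict_descendantSpan (P : MvPolynomial (Fin 2) ℂ) :
    (descendantSpan P).map restrict.toLinearMap = multiplet P := by
  rw [descendantSpan, Submodule.map_span, ← Set.range_comp]
  rfl

theorem mem_descendantSpan (P : MvPolynomial (Fin 2) ℂ) (k : ℕ) :
    lowering^[k] (rename Sum.inl P) ∈ descendantSpan P := Submodule.subset_span ⟨k, rfl⟩

theorem lowering_mem_descendantSpan (P : MvPolynomial (Fin 2) ℂ) :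
    ∀ F ∈ descendantSpan P, lowering F ∈ descendantSpan P := by
  intro F hF
  induction hF using Submodule.span_induction with
  | mem F h =>
    obtain ⟨k, rfl⟩ := h
    have := mem_descendantSpan P (k + 1)
    rwa [Function.iterate_succ_apply'] at this
  | zero => simp
  | add x y _ _ hx hy => rw [map_add]; exact add_mem hx hy
  | smul c x _ hx => rw [Derivation.map_smul]; exact Submodule.smul_mem _ _ hx

theorem lowering_mem_mul {M N : Submodule ℂ SphPoly} (hM : ∀ F ∈ M, lowering F ∈ M)
    (hN : ∀ F ∈ N, lowering F ∈ N) : ∀ F ∈ M * N, lowering F ∈ M * N := by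
  intro F hF
  induction hF using Submodule.mul_induction_on' with
  | mem_mul_mem m hm n hn =>
    rw [Derivation.leibniz, smul_eq_mul, smul_eq_mul, mul_comm n]
    exact add_mem (Submodule.mul_mem_mul hm (hN n hn)) (Submodule.mul_mem_mul (hM m hm) hn)
  | add x _ y _ hx hy => rw [map_add]; exact add_mem hx hy

theorem multiplet_le_map_restrict {M : Submodule ℂ SphPoly} (hM : ∀ F ∈ M, lowering F ∈ M)
    {f : MvPolynomial (Fin 2) ℂ} (n : ℕ) (hf : radiusSq ^ n * rename Sum.inl f ∈ M) :
    multiplet f ≤ M.map restrict.toLinearMap := by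
  rw [multiplet_le_iff]
  intro k
  have h1 : lowering^[k] (radiusSq ^ n * rename Sum.inl f) ∈ M := by
    induction k with
    | zero => exact hf
    | succ k ih => rw [Function.iterate_succ_apply']; exact hM _ ih
  refine ⟨_, h1, ?_⟩
  rw [iterate_lowering_mul_of_eq_zero
    (by rw [Derivation.leibniz_pow, lowering_radiusSq, smul_zero, smul_zero])]
  simp [restrict_radiusSq]

theorem C_mul_mem {M : Submodule ℂ SphPoly} {F : SphPoly} (hF : F ∈ M) (c : ℂ) :
    C c * F ∈ M := by
  rw [C_mul']; exact M.smul_mem c hF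

/-- A multiplet is determined by its highest weight vector, so it suffices to know the forms of
degree e whose own restriction lies in W. -/
theorem spinComponent_eq {W : Submodule ℂ (SU2 → ℂ)} {e : ℕ} {Q : MvPolynomial (Fin 2) ℂ}
    (hQ : Q.IsHomogeneous e) (hQW : multiplet Q ≤ W)
    (h : ∀ f : MvPolynomial (Fin 2) ℂ, f.IsHomogeneous e → restrict (rename Sum.inl f) ∈ W →
      ∃ c : ℂ, f = c • Q) : spinComponent W e = multiplet Q := by
  refine le_antisymm (iSup₂_le fun f hf => ?_) (le_iSup₂_of_le Q ⟨hQ, hQW⟩ le_rfl)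
  obtain ⟨c, rfl⟩ := h f hf.1 (hf.2 (mem_multiplet f 0))
  exact multiplet_smul_le c Q

theorem C_natCast' (d : ℕ) : (d : SphPoly) = C (d : ℂ) := (map_natCast C d).symm

theorem rename_inl_injective :
    Function.Injective (rename (R := ℂ) (Sum.inl : Fin 2 → Fin 2 ⊕ Fin 2)) :=
  rename_injective _ Sum.inl_injective

section products

variable {P : MvPolynomial (Fin 2) ℂ} {d : ℕ} (hd : 2 ≤ d) (hP : P.IsHomogeneous d)
include hd hP

theorem multiplet_hessian_le : multiplet (hessian P) ≤ multiplet P * multiplet P := by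
  rw [← map_restrict_descendantSpan P, ← Submodule.map_mul]
  refine multiplet_le_map_restrict (lowering_mem_mul (lowering_mem_descendantSpan P)
    (lowering_mem_descendantSpan P)) 2 ?_
  rw [radiusSq_sq_mul_hessian (by omega) hP]
  have h0 := mem_descendantSpan P 0
  have h1 := mem_descendantSpan P 1
  have h2 := mem_descendantSpan P 2
  have e : ((d : SphPoly) - 1) * ((d : SphPoly) * rename Sum.inl P *
      lowering (lowering (rename Sum.inl P)) - ((d : SphPoly) - 1) *
      lowering (rename Sum.inl P) ^ 2) =
      C (((d : ℂ) - 1) * d) * (lowering^[0] (rename Sum.inl P) *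
        lowering^[2] (rename Sum.inl P)) -
      C (((d : ℂ) - 1) ^ 2) * (lowering^[1] (rename Sum.inl P) *
        lowering^[1] (rename Sum.inl P)) := by
    simp only [C_natCast', C_mul, C_sub, C_pow, C_1, Function.iterate_succ, Function.iterate_zero,
      Function.comp_apply, id_eq]
    ring
  rw [e]
  exact sub_mem (C_mul_mem (Submodule.mul_mem_mul h0 h2) _)
    (C_mul_mem (Submodule.mul_mem_mul h1 h1) _)

theorem multiplet_cross_le :
    multiplet (cross P (hessian P)) ≤ multiplet P * multiplet P * multiplet P := by
  rw [← map_restrict_descendantSpan P, ← Submodule.map_mul, ← Submodule.map_mul]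
  refine multiplet_le_map_restrict (lowering_mem_mul (lowering_mem_mul
    (lowering_mem_descendantSpan P) (lowering_mem_descendantSpan P))
    (lowering_mem_descendantSpan P)) 3 ?_
  rw [radiusSq_cube_mul_cross hP hd]
  have h0 := mem_descendantSpan P 0
  have h1 := mem_descendantSpan P 1
  have h2 := mem_descendantSpan P 2
  have h3 := mem_descendantSpan P 3
  have e : ((d : SphPoly) - 1) *
      ((d : SphPoly) ^ 2 * rename Sum.inl P ^ 2 * lowering (lowering (lowering (rename Sum.inl P))) -
      3 * (d : SphPoly) * ((d : SphPoly) - 2) * rename Sum.inl P * lowering (rename Sum.inl P) *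
        lowering (lowering (rename Sum.inl P)) +
      2 * ((d : SphPoly) - 1) * ((d : SphPoly) - 2) * lowering (rename Sum.inl P) ^ 3) =
      C (((d : ℂ) - 1) * d ^ 2) * (lowering^[0] (rename Sum.inl P) *
        lowering^[0] (rename Sum.inl P) * lowering^[3] (rename Sum.inl P)) -
      C (((d : ℂ) - 1) * 3 * d * (d - 2)) * (lowering^[0] (rename Sum.inl P) *
        lowering^[1] (rename Sum.inl P) * lowering^[2] (rename Sum.inl P)) +
      C (((d : ℂ) - 1) ^ 2 * 2 * (d - 2)) * (lowering^[1] (rename Sum.inl P) *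
        lowering^[1] (rename Sum.inl P) * lowering^[1] (rename Sum.inl P)) := by
    have hC3 : (C 3 : SphPoly) = 3 := map_ofNat C 3
    have hC2 : (C 2 : SphPoly) = 2 := map_ofNat C 2
    simp only [C_natCast', C_mul, C_sub, C_pow, C_1, Function.iterate_succ, Function.iterate_zero,
      Function.comp_apply, id_eq, hC3, hC2]
    ring
  rw [e]
  exact add_mem (sub_mem
    (C_mul_mem (Submodule.mul_mem_mul (Submodule.mul_mem_mul h0 h0) h3) _)
    (C_mul_mem (Submodule.mul_mem_mul (Submodule.mul_mem_mul h0 h1) h2) _))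
    (C_mul_mem (Submodule.mul_mem_mul (Submodule.mul_mem_mul h1 h1) h1) _)

omit hd in
theorem lowering_rename_ne_zero (hd : 1 ≤ d) (h0 : P ≠ 0) : lowering (rename Sum.inl P) ≠ 0 := by
  intro h
  have h1 := raising_lowering_rename hP
  rw [h, map_zero, eq_comm, mul_eq_zero, map_eq_zero_iff _ rename_inl_injective] at h1
  rcases h1 with h1 | h1
  · have : d = 0 := by exact_mod_cast h1
    omega
  · exact h0 h1

/-- A quadratic form in the descendants of level two that is annihilated by `J₊`. -/
theorem quadratic_coeff_eq (h0 : P ≠ 0) {a b : ℂ}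
    (h : raising (C a * (rename Sum.inl P * lowering (lowering (rename Sum.inl P))) +
      C b * lowering (rename Sum.inl P) ^ 2) = 0) : a * (d - 1) + b * d = 0 := by
  have hC (c : ℂ) : raising (C c) = 0 := by simp [raising]
  have h1 := lowering_rename_ne_zero hP (by omega) h0
  have h2 : (rename Sum.inl P : SphPoly) ≠ 0 := by
    rwa [Ne, map_eq_zero_iff _ rename_inl_injective]
  simp only [map_add, Derivation.leibniz, Derivation.leibniz_pow, hC,
    raising_lowering_lowering_rename hP, raising_rename, raising_lowering_rename hP,
    smul_eq_mul, nsmul_eq_mul, mul_zero, add_zero, Nat.cast_ofNat, pow_one,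
    Nat.add_one_sub_one, C_natCast'] at h
  have h3 : (rename Sum.inl P * lowering (rename Sum.inl P)) * C (2 * (a * (d - 1) + b * d)) =
      (0 : SphPoly) := by
    have hC2 : (C 2 : SphPoly) = 2 := map_ofNat C 2
    simp only [C_mul, C_add, C_sub, C_1, hC2]
    linear_combination h
  have h4 := (mul_eq_zero.1 h3).resolve_left (mul_ne_zero h2 h1)
  rw [C_eq_zero] at h4
  linear_combination (1 / 2 : ℂ) * h4

/-- J₊ kills forms and `radiusSq`, which leaves one linear relation a(d-1) + bd = 0 between the two
coefficients; the coefficients of the Hessian satisfy it too. -/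
theorem eq_smul_hessian_of_mem {f : MvPolynomial (Fin 2) ℂ} (hf : f.IsHomogeneous (2 * d - 4))
    (h : restrict (rename Sum.inl f) ∈ multiplet P * multiplet P) :
    ∃ c : ℂ, f = c • hessian P := by
  obtain ⟨a, b, hab⟩ := exists_of_restrict_mem_mul hd hP hf h
  have hD : (radiusSq ^ 2 : SphPoly) ≠ 0 := pow_ne_zero _ radiusSq_ne_zero
  have hd0 : (d : ℂ) ≠ 0 := by exact_mod_cast (by omega : d ≠ 0)
  have hd1 : (d : ℂ) - 1 ≠ 0 := sub_ne_zero.2 (by exact_mod_cast (by omega : d ≠ 1))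
  rcases eq_or_ne P 0 with rfl | h0
  · refine ⟨0, ?_⟩
    simp only [map_zero, mul_zero, ne_eq, OfNat.ofNat_ne_zero, not_false_eq_true,
      zero_pow, add_zero, mul_eq_zero, hD, false_or] at hab
    rw [map_eq_zero_iff _ rename_inl_injective] at hab
    rw [hab, zero_smul]
  have hr := congrArg raising hab
  rw [Derivation.leibniz, Derivation.leibniz_pow, raising_radiusSq, raising_rename, smul_zero,
    smul_zero, smul_zero, smul_zero, add_zero] at hr
  have hc := quadratic_coeff_eq hd hP h0 hr.symm
  refine ⟨a / (d * (d - 1)), rename_inl_injective (mul_left_cancel₀ hD ?_)⟩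
  rw [map_smul, mul_smul_comm, radiusSq_sq_mul_hessian (by omega) hP, hab, ← C_mul']
  set c : ℂ := a / (d * (d - 1)) with hcdef
  have ha : a = c * (d * (d - 1)) := by rw [hcdef]; field_simp
  have hb : b = -(c * (d - 1) ^ 2) := by
    refine mul_right_cancel₀ hd0 ?_
    rw [ha] at hc
    linear_combination hc
  rw [ha, hb]
  simp only [C_natCast', C_mul, C_sub, C_pow, C_1, C_neg]
  ring

/-- Applying J₊ once and cancelling P leaves αP·J₋²P + β(J₋P)² = 0; applying it again gives α(d-1) +
βd = 0. If α = 0 then β = 0, and these two equations fix (a, b, c) up to scale. Otherwise the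
Hessian of P is zero and f must vanish. -/
theorem eq_smul_cross_of_mem {f : MvPolynomial (Fin 2) ℂ} (hf : f.IsHomogeneous (3 * d - 6))
    (h : restrict (rename Sum.inl f) ∈ multiplet P * multiplet P * multiplet P) :
    ∃ c : ℂ, f = c • cross P (hessian P) := by
  obtain ⟨a, b, c, hab⟩ := exists_of_restrict_mem_mul_mul hd hP hf h
  have hD : (radiusSq ^ 3 : SphPoly) ≠ 0 := pow_ne_zero _ radiusSq_ne_zero
  have hd0 : (d : ℂ) ≠ 0 := by exact_mod_cast (by omega : d ≠ 0)
  have hd1 : (d : ℂ) - 1 ≠ 0 := sub_ne_zero.2 (by exact_mod_cast (by omega : d ≠ 1))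
  have hzero : radiusSq ^ 3 * rename Sum.inl f = 0 → ∃ c : ℂ, f = c • cross P (hessian P) := by
    intro hz
    refine ⟨0, ?_⟩
    rw [mul_eq_zero, map_eq_zero_iff _ rename_inl_injective] at hz
    rw [hz.resolve_left hD, zero_smul]
  have hCz (c : ℂ) : raising (C c) = 0 := by simp [raising]
  have hC3 : (C 3 : SphPoly) = 3 := map_ofNat C 3
  have hC2 : (C 2 : SphPoly) = 2 := map_ofNat C 2
  rcases eq_or_ne P 0 with rfl | h0
  · exact hzero (by rw [hab]; simp)
  have h1 := lowering_rename_ne_zero hP (by omega) h0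
  have h2 : (rename Sum.inl P : SphPoly) ≠ 0 := by
    rwa [Ne, map_eq_zero_iff _ rename_inl_injective]
  have hr := congrArg raising hab
  rw [Derivation.leibniz, Derivation.leibniz_pow, raising_radiusSq, raising_rename, smul_zero,
    smul_zero, smul_zero, smul_zero, add_zero] at hr
  have hr' : C (3 * (d - 2) * a + d * b) *
      (rename Sum.inl P * lowering (lowering (rename Sum.inl P))) +
      C (2 * (d - 1) * b + 3 * d * c) * lowering (rename Sum.inl P) ^ 2 = 0 := by
    refine (mul_eq_zero.1 ?_).resolve_left h2
    simp only [map_add, Derivation.leibniz, Derivation.leibniz_pow, hCz,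
      raising_lowering_lowering_rename hP, raising_rename, raising_lowering_rename hP,
      raising_lowering_lowering_lowering_rename hP,
      smul_eq_mul, nsmul_eq_mul, mul_zero, add_zero, Nat.cast_ofNat,
      Nat.add_one_sub_one, C_natCast', smul_zero] at hr
    simp only [C_mul, C_add, C_sub, C_1, hC2, hC3]
    linear_combination -hr
  have hc := quadratic_coeff_eq hd hP h0 (by rw [hr', map_zero])
  by_cases hα : (3 * (d - 2) * a + d * b : ℂ) = 0
  · have hβ : (2 * (d - 1) * b + 3 * d * c : ℂ) = 0 := by
      rw [hα, zero_mul, zero_add] at hc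
      exact (mul_eq_zero.1 hc).resolve_right hd0
    refine ⟨a / (d ^ 2 * (d - 1)), rename_inl_injective (mul_left_cancel₀ hD ?_)⟩
    rw [map_smul, mul_smul_comm, radiusSq_cube_mul_cross hP hd, hab, ← C_mul']
    set e : ℂ := a / (d ^ 2 * (d - 1)) with he
    have ha : a = e * (d ^ 2 * (d - 1)) := by rw [he]; field_simp
    have hb : b = -(e * (3 * d * (d - 1) * (d - 2))) := by
      refine mul_right_cancel₀ hd0 ?_
      rw [ha] at hα
      linear_combination hα
    have hcc : c = e * (2 * (d - 1) ^ 2 * (d - 2)) := by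
      refine mul_right_cancel₀ hd0 ?_
      rw [hb] at hβ
      linear_combination (1 / 3 : ℂ) * hβ
    rw [ha, hb, hcc]
    simp only [C_natCast', C_mul, C_sub, C_pow, C_1, C_neg, hC2, hC3]
    ring
  -- Now dP·J₋²P = (d-1)(J₋P)², so every cubic term of level three is a multiple of (J₋P)³. J₊ does
  -- not kill that cube, hence its coefficient `e` is zero and f = 0.
  · set α : ℂ := 3 * (d - 2) * a + d * b with hαdef
    have hβ : (2 * (d - 1) * b + 3 * d * c : ℂ) = -(α * (d - 1) / d) := by
      field_simp
      linear_combination hc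
    rw [hβ] at hr'
    have hQ : C (d : ℂ) * (rename Sum.inl P * lowering (lowering (rename Sum.inl P))) =
        C ((d : ℂ) - 1) * lowering (rename Sum.inl P) ^ 2 := by
      have hCα : (C (α / d) : SphPoly) ≠ 0 := by
        rw [Ne, C_eq_zero]; exact div_ne_zero hα hd0
      refine mul_left_cancel₀ hCα ?_
      rw [← mul_assoc, ← mul_assoc (C (α / d)), ← C_mul, ← C_mul, div_mul_cancel₀ _ hd0,
        show α / d * ((d : ℂ) - 1) = α * (d - 1) / d by ring]
      rw [C_neg] at hr'
      linear_combination hr'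
    have hQ1 : C (d : ℂ) * (rename Sum.inl P *
        lowering (lowering (lowering (rename Sum.inl P)))) =
        C ((d : ℂ) - 2) * (lowering (rename Sum.inl P) * lowering (lowering (rename Sum.inl P))) := by
      have hCl (c : ℂ) : lowering (C c) = 0 := by simp [lowering]
      have := congrArg lowering hQ
      simp only [Derivation.leibniz, Derivation.leibniz_pow, hCl, smul_eq_mul, nsmul_eq_mul,
        mul_zero, add_zero, Nat.cast_ofNat, Nat.add_one_sub_one, pow_one] at this
      simp only [C_sub, C_1, hC2] at this ⊢
      linear_combination this
    set e : ℂ := a * (d - 2) * (d - 1) + b * d * (d - 1) + c * d ^ 2 with he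
    have hfe : C ((d : ℂ) ^ 2) * (radiusSq ^ 3 * rename Sum.inl f) =
        C e * lowering (rename Sum.inl P) ^ 3 := by
      rw [hab, he]
      simp only [C_mul, C_add, C_sub, C_pow, C_1, hC2] at hQ hQ1 ⊢
      linear_combination (C a * C (d : ℂ) * rename Sum.inl P) * hQ1 +
        (C a * (C (d : ℂ) - 2) * lowering (rename Sum.inl P) +
          C b * C (d : ℂ) * lowering (rename Sum.inl P)) * hQ
    have hre := congrArg raising hfe
    simp only [Derivation.leibniz, Derivation.leibniz_pow, hCz, raising_radiusSq, raising_rename,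
      raising_lowering_rename hP, smul_eq_mul, nsmul_eq_mul, mul_zero, smul_zero, add_zero] at hre
    have he0 : (C e : SphPoly) = 0 := by
      by_contra hne
      have hd0' : (d : SphPoly) ≠ 0 := by rw [C_natCast', Ne, C_eq_zero]; exact hd0
      refine absurd hre.symm (mul_ne_zero hne (mul_ne_zero ?_ (mul_ne_zero (pow_ne_zero _ h1)
        (mul_ne_zero hd0' h2))))
      exact_mod_cast (by norm_num : (3 : ℕ) ≠ 0)
    rw [he0, zero_mul] at hfe
    refine hzero ((mul_eq_zero.1 hfe).resolve_left ?_)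
    rw [C_eq_zero]
    exact pow_ne_zero _ hd0

theorem spinComponent_mul :
    spinComponent (multiplet P * multiplet P) (2 * d - 4) = multiplet (hessian P) :=
  spinComponent_eq (isHomogeneous_hessian hP) (multiplet_hessian_le hd hP)
    fun _ hf h => eq_smul_hessian_of_mem hd hP hf h

theorem spinComponent_mul_mul :
    spinComponent (multiplet P * multiplet P * multiplet P) (3 * d - 6) =
      multiplet (cross P (hessian P)) :=
  spinComponent_eq (isHomogeneous_cross_hessian hd hP) (multiplet_cross_le hd hP)
    fun _ hf h => eq_smul_cross_of_mem hd hP hf h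

end products

/-! ### Points of the projective line -/

/-- The subgroup of diagonal matrices. -/
def torus : Subgroup SU2 where
  carrier := {g | (g : Matrix (Fin 2) (Fin 2) ℂ) 1 0 = 0}
  mul_mem' := fun {a b} ha hb => by
    have ha' : (a : Matrix (Fin 2) (Fin 2) ℂ) 1 0 = 0 := ha
    have hb' : (b : Matrix (Fin 2) (Fin 2) ℂ) 1 0 = 0 := hb
    change ((a * b : SU2) : Matrix (Fin 2) (Fin 2) ℂ) 1 0 = 0
    rw [SU2.mul_col, ha', hb', zero_mul, mul_zero, add_zero]
  one_mem' := by
    change (1 : Matrix (Fin 2) (Fin 2) ℂ) 1 0 = 0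
    simp
  inv_mem' := fun {a} ha => by
    have ha' : (a : Matrix (Fin 2) (Fin 2) ℂ) 1 0 = 0 := ha
    change ((a⁻¹ : SU2) : Matrix (Fin 2) (Fin 2) ℂ) 1 0 = 0
    rw [SU2.inv_one_zero, ha', neg_zero]

theorem mem_torus_iff {g : SU2} : g ∈ torus ↔ (g : Matrix (Fin 2) (Fin 2) ℂ) 1 0 = 0 := Iff.rfl

/-- The projective line, as a homogeneous space of `SU(2)`. -/
abbrev ProjLine : Type := SU2 ⧸ torus

theorem mul_torus_zero_zero {g h : SU2} (hh : h ∈ torus) (i : Fin 2) :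
    ((g * h : SU2) : Matrix (Fin 2) (Fin 2) ℂ) i 0 =
      (g : Matrix (Fin 2) (Fin 2) ℂ) i 0 * (h : Matrix (Fin 2) (Fin 2) ℂ) 0 0 := by
  rw [SU2.mul_col, mem_torus_iff.1 hh, mul_zero, add_zero]

theorem torus_ext {g h : SU2} (hg : g ∈ torus) (hh : h ∈ torus)
    (e : (g : Matrix (Fin 2) (Fin 2) ℂ) 0 0 = (h : Matrix (Fin 2) (Fin 2) ℂ) 0 0) : g = h :=
  SU2.ext_col e (by rw [mem_torus_iff.1 hg, mem_torus_iff.1 hh])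

theorem torus_comm {g h : SU2} (hg : g ∈ torus) (hh : h ∈ torus) : g * h = h * g :=
  torus_ext (mul_mem hg hh) (mul_mem hh hg) (by
    rw [mul_torus_zero_zero hh, mul_torus_zero_zero hg, mul_comm])

theorem torus_pow_zero_zero {g : SU2} (hg : g ∈ torus) (k : ℕ) :
    ((g ^ k : SU2) : Matrix (Fin 2) (Fin 2) ℂ) 0 0 = (g : Matrix (Fin 2) (Fin 2) ℂ) 0 0 ^ k := by
  induction k with
  | zero => simp
  | succ k ih => rw [pow_succ, mul_torus_zero_zero hg, ih, pow_succ]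

theorem torus_mul_conj {g : SU2} (hg : g ∈ torus) : (g : Matrix (Fin 2) (Fin 2) ℂ) 0 0 *
    starRingEnd ℂ ((g : Matrix (Fin 2) (Fin 2) ℂ) 0 0) = 1 := by
  have := SU2.conj_mul_add g
  rwa [mem_torus_iff.1 hg, zero_mul, add_zero] at this

theorem torus_zero_zero_ne_zero {g : SU2} (hg : g ∈ torus) :
    (g : Matrix (Fin 2) (Fin 2) ℂ) 0 0 ≠ 0 := left_ne_zero_of_mul_eq_one (torus_mul_conj hg)

theorem smul_mk_eq_iff {γ p : SU2} : γ • (p : ProjLine) = p ↔ p⁻¹ * γ * p ∈ torus := by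
  have : γ • (p : ProjLine) = ((γ * p : SU2) : ProjLine) := rfl
  rw [this, eq_comm, QuotientGroup.eq, mul_assoc]

theorem exists_col {v : Fin 2 → ℂ} (hv : v ≠ 0) :
    ∃ (p : SU2) (r : ℂ), r ≠ 0 ∧ ∀ i, v i = r * (p : Matrix (Fin 2) (Fin 2) ℂ) i 0 := by
  set N := Complex.normSq (v 0) + Complex.normSq (v 1) with hN
  have h0 : N ≠ 0 := by
    intro h
    have h0 := (add_eq_zero_iff_of_nonneg (Complex.normSq_nonneg _) (Complex.normSq_nonneg _)).1 h
    refine hv (funext fun i => ?_)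
    fin_cases i
    · exact Complex.normSq_eq_zero.1 h0.1
    · exact Complex.normSq_eq_zero.1 h0.2
  have hNpos : 0 < N := lt_of_le_of_ne
    (add_nonneg (Complex.normSq_nonneg _) (Complex.normSq_nonneg _)) h0.symm
  set r : ℝ := √N with hr
  have hr0 : r ≠ 0 := (Real.sqrt_pos.2 hNpos).ne'
  have hrr : r * r = N := Real.mul_self_sqrt hNpos.le
  have hp : Complex.normSq (v 0 / r) + Complex.normSq (v 1 / r) = 1 := by
    rw [Complex.normSq_div, Complex.normSq_div, Complex.normSq_ofReal, hrr, ← add_div, ← hN,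
      div_self h0]
  have hrc : (r : ℂ) ≠ 0 := by exact_mod_cast hr0
  refine ⟨SU2.mk _ _ hp, r, hrc, fun i => ?_⟩
  fin_cases i <;> simp <;> field_simp

/-- Take a normalized eigenvector of γ as the first column of p. -/
theorem exists_conj_mem_torus (γ : SU2) : ∃ p : SU2, p⁻¹ * γ * p ∈ torus := by
  obtain ⟨μ, hμ⟩ := Module.End.exists_eigenvalue (Matrix.toLin' (γ : Matrix (Fin 2) (Fin 2) ℂ))
  obtain ⟨v, hv⟩ := hμ.exists_hasEigenvector
  obtain ⟨p, r, hr, hp⟩ := exists_col hv.2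
  refine ⟨p, ?_⟩
  have h1 : ∀ i, ((γ * p : SU2) : Matrix (Fin 2) (Fin 2) ℂ) i 0 =
      μ * (p : Matrix (Fin 2) (Fin 2) ℂ) i 0 := by
    intro i
    have h2 := congrFun (hv.apply_eq_smul) i
    rw [Matrix.toLin'_apply, Pi.smul_apply, smul_eq_mul, Matrix.mulVec, dotProduct,
      Fin.sum_univ_two, hp, hp, hp] at h2
    rw [SU2.mul_col]
    refine mul_left_cancel₀ hr ?_
    linear_combination h2
  have h3 : ((p⁻¹ * p : SU2) : Matrix (Fin 2) (Fin 2) ℂ) 1 0 = 0 := by simp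
  rw [SU2.mul_col] at h3
  rw [mem_torus_iff, mul_assoc, SU2.mul_col, h1, h1]
  linear_combination μ * h3

/-- The matrix exchanging the two fixed points of the torus. -/
def weyl : SU2 := SU2.mk 0 1 (by simp)

theorem weyl_inv_mul_mul {g : SU2} (hg : g ∈ torus) : weyl⁻¹ * g * weyl ∈ torus ∧
    ((weyl⁻¹ * g * weyl : SU2) : Matrix (Fin 2) (Fin 2) ℂ) 0 0 =
      starRingEnd ℂ ((g : Matrix (Fin 2) (Fin 2) ℂ) 0 0) := by
  have h00 : (weyl : Matrix (Fin 2) (Fin 2) ℂ) 0 0 = 0 := rfl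
  have h10 : (weyl : Matrix (Fin 2) (Fin 2) ℂ) 1 0 = 1 := rfl
  have hg' := mem_torus_iff.1 hg
  rw [mem_torus_iff, mul_assoc]
  simp only [SU2.mul_col, SU2.apply_one_one, SU2.apply_zero_one, SU2.inv_zero_zero,
    SU2.inv_one_zero, h00, h10, hg']
  simp

theorem mk_mul_weyl_ne (p : SU2) : ((p * weyl : SU2) : ProjLine) ≠ p := by
  intro h
  rw [eq_comm, QuotientGroup.eq, inv_mul_cancel_left] at h
  exact one_ne_zero (α := ℂ) h

/-- The value of a form at the first column of `p`. -/
def evalAt (p : SU2) (P : MvPolynomial (Fin 2) ℂ) : ℂ :=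
  eval (fun i => (p : Matrix (Fin 2) (Fin 2) ℂ) i 0) P

theorem evalAt_mul (p : SU2) (P Q : MvPolynomial (Fin 2) ℂ) :
    evalAt p (P * Q) = evalAt p P * evalAt p Q := map_mul _ P Q

theorem evalAt_sub (p : SU2) (P Q : MvPolynomial (Fin 2) ℂ) :
    evalAt p (P - Q) = evalAt p P - evalAt p Q := map_sub _ P Q

theorem evalAt_pow (p : SU2) (P : MvPolynomial (Fin 2) ℂ) (n : ℕ) :
    evalAt p (P ^ n) = evalAt p P ^ n := map_pow _ P n

theorem evalAt_C (p : SU2) (c : ℂ) : evalAt p (C c) = c := eval_C c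

theorem evalAt_subst (p g : SU2) (P : MvPolynomial (Fin 2) ℂ) :
    evalAt p (subst g P) = evalAt (g * p) P := by
  rw [evalAt, eval_subst, evalAt]
  congr 2

theorem evalAt_mul_torus {P : MvPolynomial (Fin 2) ℂ} {d : ℕ} (hP : P.IsHomogeneous d) (p : SU2)
    {h : SU2} (hh : h ∈ torus) :
    evalAt (p * h) P = (h : Matrix (Fin 2) (Fin 2) ℂ) 0 0 ^ d * evalAt p P := by
  rw [evalAt, evalAt, ← eval_mul_of_isHomogeneous hP]
  congr 2
  ext i
  rw [mul_torus_zero_zero hh, mul_comm]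

theorem evalAt_eq_zero_iff_of_mk_eq {P : MvPolynomial (Fin 2) ℂ} {d : ℕ} (hP : P.IsHomogeneous d)
    {p q : SU2} (h : (p : ProjLine) = q) : evalAt p P = 0 ↔ evalAt q P = 0 := by
  rw [QuotientGroup.eq] at h
  rw [show q = p * (p⁻¹ * q) by group, evalAt_mul_torus hP p h, mul_eq_zero,
    or_iff_right (pow_ne_zero _ (torus_zero_zero_ne_zero h))]

theorem evalAt_smul_of_fixed {P : MvPolynomial (Fin 2) ℂ} {d : ℕ} (hP : P.IsHomogeneous d)
    {γ p : SU2} (h : p⁻¹ * γ * p ∈ torus) : evalAt p (subst γ P) =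
      ((p⁻¹ * γ * p : SU2) : Matrix (Fin 2) (Fin 2) ℂ) 0 0 ^ d * evalAt p P := by
  rw [evalAt_subst, ← evalAt_mul_torus hP p h]
  congr 1
  group

/-! ### Linear factors of binary forms -/

/-- The value at (1, 0) is the coefficient of s^d, the only monomial of degree d without t. When it
vanishes, reduction modulo t leaves nothing. -/
theorem exists_eq_X_one_mul {P : MvPolynomial (Fin 2) ℂ} {d : ℕ} (hP : P.IsHomogeneous d)
    (h : evalAt 1 P = 0) : ∃ G : MvPolynomial (Fin 2) ℂ, G.IsHomogeneous (d - 1) ∧ P = X 1 * G := by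
  refine ⟨P.divMonomial (Finsupp.single 1 1), fun m hm => ?_, ?_⟩
  · rw [coeff_divMonomial] at hm
    have := hP hm
    rw [map_add] at this
    simp only [Finsupp.weight_single, Pi.one_apply, smul_eq_mul, mul_one] at this
    omega
  · suffices hz : P.modMonomial (Finsupp.single 1 1) = 0 by
      conv_lhs => rw [← divMonomial_add_modMonomial P (Finsupp.single 1 1), hz, add_zero]
      rfl
    ext m
    rw [coeff_zero]
    by_cases hm : Finsupp.single 1 1 ≤ m
    · exact coeff_modMonomial_of_le _ hm
    rw [coeff_modMonomial_of_not_le _ hm]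
    by_contra hne
    have hm1 : m 1 = 0 := by
      by_contra h1
      exact hm (Finsupp.single_le_iff.2 (Nat.one_le_iff_ne_zero.2 h1))
    have key : ∀ m' : Fin 2 →₀ ℕ, coeff m' P ≠ 0 → m' 1 = 0 → m' = Finsupp.single 0 d := by
      intro m' h' h1'
      have hdeg : m'.degree = d := by
        by_contra hh
        exact h' (hP.coeff_eq_zero hh)
      rw [Finsupp.degree_eq_sum, Fin.sum_univ_two, h1', add_zero] at hdeg
      ext i
      fin_cases i
      · simpa using hdeg
      · simpa using h1'
    refine hne ?_
    rw [evalAt, eval_eq', Finset.sum_eq_single m] at h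
    · simpa [Fin.prod_univ_two, hm1] using h
    · intro m' hm' hmm
      have h1' : m' 1 ≠ 0 := fun h1' =>
        hmm ((key m' (mem_support_iff.1 hm') h1').trans (key m hne hm1).symm)
      simp [Fin.prod_univ_two, h1']
    · intro hmem
      exact absurd (mem_support_iff.2 hne) hmem

/-- The linear form that vanishes at `p`. -/
def linForm (p : SU2) : MvPolynomial (Fin 2) ℂ := transport p (X 1)

theorem linForm_ne_zero (p : SU2) : linForm p ≠ 0 := by
  rw [linForm, transport, Ne, subst_eq_zero_iff]
  exact X_ne_zero 1

theorem isHomogeneous_linForm (p : SU2) : (linForm p).IsHomogeneous 1 :=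
  isHomogeneous_subst _ (isHomogeneous_X ℂ 1)

theorem evalAt_linForm_eq_zero_iff (p q : SU2) :
    evalAt q (linForm p) = 0 ↔ (p : ProjLine) = q := by
  rw [linForm, transport, evalAt_subst, QuotientGroup.eq, mem_torus_iff, evalAt, eval_X]

theorem exists_eq_linForm_mul {P : MvPolynomial (Fin 2) ℂ} {d : ℕ} (hP : P.IsHomogeneous d)
    {p : SU2} (h : evalAt p P = 0) :
    ∃ G : MvPolynomial (Fin 2) ℂ, G.IsHomogeneous (d - 1) ∧ P = linForm p * G := by
  obtain ⟨G, hG, e⟩ := exists_eq_X_one_mul (isHomogeneous_subst (p : Matrix (Fin 2) (Fin 2) ℂ) hP)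
    (by rwa [evalAt_subst, mul_one])
  refine ⟨subst ((p⁻¹ : SU2) : Matrix (Fin 2) (Fin 2) ℂ) G, isHomogeneous_subst _ hG, ?_⟩
  rw [linForm, transport, ← subst_mul, ← e, subst_subst, ← Submonoid.coe_mul, mul_inv_cancel,
    Submonoid.coe_one, subst_one]

/-- The form with simple zeros at the points of `O`. -/
def formOf (O : Finset ProjLine) : MvPolynomial (Fin 2) ℂ := ∏ q ∈ O, linForm q.out

theorem isHomogeneous_formOf (O : Finset ProjLine) : (formOf O).IsHomogeneous O.card := by
  have := IsHomogeneous.prod O (fun q => linForm q.out) (fun _ => 1)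
    (fun q _ => isHomogeneous_linForm _)
  simpa [formOf] using this

theorem formOf_ne_zero (O : Finset ProjLine) : formOf O ≠ 0 :=
  Finset.prod_ne_zero_iff.2 fun _ _ => linForm_ne_zero _

theorem evalAt_formOf_eq_zero_iff (O : Finset ProjLine) (p : SU2) :
    evalAt p (formOf O) = 0 ↔ (p : ProjLine) ∈ O := by
  rw [formOf, evalAt, map_prod, Finset.prod_eq_zero_iff]
  constructor
  · rintro ⟨q, hq, h⟩
    have := (evalAt_linForm_eq_zero_iff q.out p).1 h
    rw [QuotientGroup.out_eq'] at this
    rwa [← this]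
  · intro h
    exact ⟨_, h, (evalAt_linForm_eq_zero_iff _ p).2 (QuotientGroup.out_eq' _)⟩

theorem exists_eq_formOf_mul (O : Finset ProjLine) {P : MvPolynomial (Fin 2) ℂ} {d : ℕ}
    (hP : P.IsHomogeneous d) (h : ∀ q ∈ O, evalAt q.out P = 0) :
    ∃ G : MvPolynomial (Fin 2) ℂ, G.IsHomogeneous (d - O.card) ∧ P = formOf O * G := by
  classical
  induction O using Finset.induction_on with
  | empty => exact ⟨P, by simpa using hP, by simp [formOf]⟩
  | insert q O hq ih =>
    obtain ⟨G, hG, e⟩ := ih fun q' hq' => h q' (Finset.mem_insert_of_mem hq')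
    have h1 := h q (Finset.mem_insert_self q O)
    rw [e, evalAt_mul, mul_eq_zero, evalAt_formOf_eq_zero_iff, QuotientGroup.out_eq',
      or_iff_right hq] at h1
    obtain ⟨G', hG', e'⟩ := exists_eq_linForm_mul hG h1
    refine ⟨G', ?_, ?_⟩
    · rwa [Finset.card_insert_of_notMem hq, ← Nat.sub_sub]
    · rw [e, e', formOf, formOf, Finset.prod_insert hq]
      ring

/-- A non-zero form has at most as many zeros as its degree. -/
theorem card_le_of_evalAt_eq_zero (O : Finset ProjLine) {P : MvPolynomial (Fin 2) ℂ} {d : ℕ}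
    (hP : P.IsHomogeneous d) (h0 : P ≠ 0) (h : ∀ q ∈ O, evalAt q.out P = 0) : O.card ≤ d := by
  obtain ⟨G, hG, e⟩ := exists_eq_formOf_mul O hP h
  have := hP.inj_right (e ▸ (isHomogeneous_formOf O).mul hG) h0
  omega

/-! ### Stabilizers -/

section stabilizers

variable (Γ : Subgroup SU2)

theorem mem_stabilizer_mk_iff {p : SU2} {γ : Γ} :
    γ ∈ MulAction.stabilizer Γ (p : ProjLine) ↔ p⁻¹ * γ * p ∈ torus :=
  smul_mk_eq_iff

/-- The character by which the stabilizer of a line acts on the line. -/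
def stabilizerChar (p : SU2) : MulAction.stabilizer Γ (p : ProjLine) →* ℂ where
  toFun γ := ((p⁻¹ * ((γ : Γ) : SU2) * p : SU2) : Matrix (Fin 2) (Fin 2) ℂ) 0 0
  map_one' := by simp
  map_mul' := fun a b => by
    rw [← mul_torus_zero_zero ((mem_stabilizer_mk_iff Γ).1 b.2)]
    simp [mul_assoc]

theorem stabilizerChar_injective (p : SU2) : Function.Injective (stabilizerChar Γ p) := by
  intro a b h
  have := torus_ext ((mem_stabilizer_mk_iff Γ).1 a.2) ((mem_stabilizer_mk_iff Γ).1 b.2) h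
  rw [mul_left_inj, mul_right_inj] at this
  exact Subtype.ext (Subtype.ext this)

theorem isCyclic_stabilizer [Finite Γ] (x : ProjLine) : IsCyclic (MulAction.stabilizer Γ x) := by
  obtain ⟨p, rfl⟩ := QuotientGroup.mk_surjective x
  exact isCyclic_of_injective_ringHom _ (stabilizerChar_injective Γ p)

theorem pow_eq_one_of_card_stabilizer_dvd {p γ : SU2} (hγ : γ ∈ Γ) (h : p⁻¹ * γ * p ∈ torus)
    {k : ℕ} (hk : Nat.card (MulAction.stabilizer Γ (p : ProjLine)) ∣ k) :
    ((p⁻¹ * γ * p : SU2) : Matrix (Fin 2) (Fin 2) ℂ) 0 0 ^ k = 1 := by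
  let g : MulAction.stabilizer Γ (p : ProjLine) := ⟨⟨γ, hγ⟩, (mem_stabilizer_mk_iff Γ).2 h⟩
  have h1 : g ^ k = 1 := by
    obtain ⟨j, rfl⟩ := hk
    rw [pow_mul, pow_card_eq_one', one_pow]
  have h2 : stabilizerChar Γ p g ^ k = 1 := by rw [← map_pow, h1, map_one]
  exact h2

theorem card_orbit_mul_card_stabilizer (x : ProjLine) :
    Nat.card (MulAction.orbit Γ x) * Nat.card (MulAction.stabilizer Γ x) = Nat.card Γ := by
  rw [← Nat.card_prod]
  exact Nat.card_congr (MulAction.orbitProdStabilizerEquivGroup Γ x)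

variable [Finite Γ]

/-- The degree of an invariant form that does not vanish at a point is divisible by the order of
the stabilizer of that point. -/
theorem card_stabilizer_dvd {F : MvPolynomial (Fin 2) ℂ} {k : ℕ} (hF : F.IsHomogeneous k)
    (hinv : IsInvariant Γ F) {p : SU2} (h : evalAt p F ≠ 0) :
    Nat.card (MulAction.stabilizer Γ (p : ProjLine)) ∣ k := by
  have := isCyclic_stabilizer Γ (p : ProjLine)
  rw [← IsCyclic.exponent_eq_card]
  refine Monoid.exponent_dvd_of_forall_pow_eq_one fun g => stabilizerChar_injective Γ p ?_
  rw [map_pow, map_one]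
  -- An element of the stabilizer multiplies the non-zero value of F at p by the k-th power of its
  -- character, so that power is 1. The character is faithful and the stabilizer is cyclic.
  have h1 := evalAt_smul_of_fixed hF ((mem_stabilizer_mk_iff Γ).1 g.2)
  rw [hinv _ (g : Γ).2] at h1
  exact (mul_eq_right₀ h).1 h1.symm

theorem finite_orbit (x : ProjLine) : (MulAction.orbit Γ x).Finite :=
  Set.finite_range _

/-- The orbit of a point, as a finite set. -/
def orbitFinset (x : ProjLine) : Finset ProjLine := (finite_orbit Γ x).toFinset

theorem mem_orbitFinset {x y : ProjLine} : y ∈ orbitFinset Γ x ↔ y ∈ MulAction.orbit Γ x :=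
  Set.Finite.mem_toFinset _

theorem card_orbitFinset (x : ProjLine) :
    (orbitFinset Γ x).card = Nat.card (MulAction.orbit Γ x) :=
  (Nat.card_eq_card_finite_toFinset _).symm

theorem card_stabilizer_eq_of_mem_orbit {x y : ProjLine} (h : y ∈ MulAction.orbit Γ x) :
    Nat.card (MulAction.stabilizer Γ y) = Nat.card (MulAction.stabilizer Γ x) := by
  have h1 := card_orbit_mul_card_stabilizer Γ x
  have h2 := card_orbit_mul_card_stabilizer Γ y
  rw [MulAction.orbit_eq_iff.2 h, ← h1] at h2
  refine Nat.eq_of_mul_eq_mul_left (Nat.pos_of_ne_zero fun h0 => ?_) h2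
  rw [h0, zero_mul] at h1
  exact Nat.card_pos.ne' h1.symm

theorem evalAt_eq_zero_of_mem_orbit {F : MvPolynomial (Fin 2) ℂ} {k : ℕ} (hF : F.IsHomogeneous k)
    (hinv : IsInvariant Γ F) {p : SU2} (h : evalAt p F = 0) :
    ∀ q ∈ orbitFinset Γ (p : ProjLine), evalAt q.out F = 0 := by
  intro q hq
  obtain ⟨γ, rfl⟩ := (mem_orbitFinset Γ).1 hq
  have h1 : (((γ : SU2) * p : SU2) : ProjLine) =
      ((γ • (p : ProjLine) : ProjLine).out : SU2) := by
    rw [QuotientGroup.out_eq']; rfl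
  rw [← evalAt_eq_zero_iff_of_mk_eq hF h1, ← evalAt_subst, hinv _ γ.2, h]

/-- The number of points in a union of two orbits of zeros is at most the degree. -/
theorem card_orbit_le {F : MvPolynomial (Fin 2) ℂ} {k : ℕ} (hF : F.IsHomogeneous k) (h0 : F ≠ 0)
    (hinv : IsInvariant Γ F) {p : SU2} (h : evalAt p F = 0) :
    Nat.card (MulAction.orbit Γ (p : ProjLine)) ≤ k := by
  rw [← card_orbitFinset]
  exact card_le_of_evalAt_eq_zero _ hF h0 (evalAt_eq_zero_of_mem_orbit Γ hF hinv h)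

theorem card_orbit_add_card_orbit_le {F : MvPolynomial (Fin 2) ℂ} {k : ℕ} (hF : F.IsHomogeneous k)
    (h0 : F ≠ 0) (hinv : IsInvariant Γ F) {p q : SU2} (hp : evalAt p F = 0) (hq : evalAt q F = 0)
    (hpq : (q : ProjLine) ∉ MulAction.orbit Γ (p : ProjLine)) :
    Nat.card (MulAction.orbit Γ (p : ProjLine)) + Nat.card (MulAction.orbit Γ (q : ProjLine)) ≤ k := by
  classical
  rw [← card_orbitFinset, ← card_orbitFinset, ← Finset.card_union_of_disjoint]
  · refine card_le_of_evalAt_eq_zero _ hF h0 fun x hx => ?_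
    rcases Finset.mem_union.1 hx with hx | hx
    · exact evalAt_eq_zero_of_mem_orbit Γ hF hinv hp x hx
    · exact evalAt_eq_zero_of_mem_orbit Γ hF hinv hq x hx
  · rw [Finset.disjoint_left]
    intro x hx hx'
    rw [mem_orbitFinset, ← MulAction.orbit_eq_iff] at hx hx'
    exact hpq (MulAction.orbit_eq_iff.1 (hx'.symm.trans hx))

theorem subst_linForm_of_fixed {γ p : SU2} (h : p⁻¹ * γ * p ∈ torus) : subst γ (linForm p) =
    C (starRingEnd ℂ (((p⁻¹ * γ * p : SU2) : Matrix (Fin 2) (Fin 2) ℂ) 0 0)) * linForm p := by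
  have h1 : subst ((p⁻¹ * γ * p : SU2) : Matrix (Fin 2) (Fin 2) ℂ) (X 1) =
      C (starRingEnd ℂ (((p⁻¹ * γ * p : SU2) : Matrix (Fin 2) (Fin 2) ℂ) 0 0)) * X 1 := by
    rw [subst_X, mem_torus_iff.1 h, SU2.apply_one_one]
    simp
  rw [linForm, transport, subst_subst, ← Submonoid.coe_mul]
  have h2 := congrArg (subst ((p⁻¹ : SU2) : Matrix (Fin 2) (Fin 2) ℂ)) h1
  rw [subst_subst, ← Submonoid.coe_mul, mul_inv_cancel_right, subst_mul, subst_C] at h2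
  exact h2

theorem conj_zero_zero_eq_of_mk_eq {γ p q : SU2} (h : (p : ProjLine) = q)
    (hp : p⁻¹ * γ * p ∈ torus) : q⁻¹ * γ * q ∈ torus ∧
    ((q⁻¹ * γ * q : SU2) : Matrix (Fin 2) (Fin 2) ℂ) 0 0 =
      ((p⁻¹ * γ * p : SU2) : Matrix (Fin 2) (Fin 2) ℂ) 0 0 := by
  rw [QuotientGroup.eq] at h
  have : q⁻¹ * γ * q = p⁻¹ * γ * p := by
    have h1 : q⁻¹ * γ * q = (p⁻¹ * q)⁻¹ * ((p⁻¹ * γ * p) * (p⁻¹ * q)) := by group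
    rw [h1, torus_comm hp h, inv_mul_cancel_left]
  rw [this]
  exact ⟨hp, rfl⟩

/-- The form with simple zeros at the points of an orbit is invariant under suitable
divisibility conditions. -/
theorem isInvariant_formOf_orbit (x : ProjLine) {n : ℕ}
    (hm : Nat.card (MulAction.orbit Γ x) = n + 2)
    (hx : Nat.card (MulAction.stabilizer Γ x) ∣ n)
    (hy : ∀ y ∉ MulAction.orbit Γ x, Nat.card (MulAction.stabilizer Γ y) ∣ n + 2) :
    IsInvariant Γ (formOf (orbitFinset Γ x)) := by
  classical
  intro γ hγ
  set O := orbitFinset Γ x with hO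
  have hcard : O.card = n + 2 := by rw [hO, card_orbitFinset, hm]
  have hF := isHomogeneous_formOf O
  rw [hcard] at hF
  obtain ⟨G, hG, e⟩ := exists_eq_formOf_mul O (isHomogeneous_subst (γ : Matrix _ _ ℂ) hF) (by
    intro q hq
    rw [evalAt_subst, evalAt_formOf_eq_zero_iff, hO, mem_orbitFinset]
    rw [hO, mem_orbitFinset] at hq
    have h1 : (((γ : SU2) * q.out : SU2) : ProjLine) = (⟨γ, hγ⟩ : Γ) • q := by
      conv_rhs => rw [← QuotientGroup.out_eq' q]
      rfl
    rw [h1]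
    exact MulAction.mem_orbit_of_mem_orbit _ hq)
  -- γ permutes the zeros, so it multiplies the form by a constant `c`; its value is read off at a
  -- fixed point of γ.
  rw [hcard, Nat.sub_self, ← totalDegree_zero_iff_isHomogeneous,
    totalDegree_eq_zero_iff_eq_C] at hG
  set c := coeff 0 G
  rw [hG] at e
  suffices hc : c = 1 by rw [e, hc, C_1, mul_one]
  -- At a fixed point outside the orbit the form is non-zero, and `c` is the (n+2)-th power of a
  -- root of unity whose order divides n + 2.
  have key : ∀ p : SU2, p⁻¹ * γ * p ∈ torus → (p : ProjLine) ∉ O → c = 1 := by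
    intro p hp hpO
    have h1 := evalAt_smul_of_fixed hF hp
    rw [pow_eq_one_of_card_stabilizer_dvd Γ hγ hp (hy _ (by rwa [hO, mem_orbitFinset] at hpO)),
      one_mul, e, evalAt_mul, evalAt_C] at h1
    exact (mul_eq_left₀ (by rwa [Ne, evalAt_formOf_eq_zero_iff])).1 h1
  obtain ⟨p, hp⟩ := exists_conj_mem_torus γ
  by_cases hpO : (p : ProjLine) ∉ O
  · exact key p hp hpO
  obtain ⟨hw, hw0⟩ := weyl_inv_mul_mul hp
  have hwe : weyl⁻¹ * (p⁻¹ * γ * p) * weyl = (p * weyl)⁻¹ * γ * (p * weyl) := by group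
  rw [hwe] at hw hw0
  by_cases hpwO : ((p * weyl : SU2) : ProjLine) ∉ O
  · exact key _ hw hpwO
  -- Both fixed points lie in the orbit. Their linear factors are scaled by inverse numbers, so `c`
  -- is the factor of the remaining form `G'` of degree n. That form is non-zero at p, and the
  -- stabilizer order divides n.
  rw [not_not] at hpO hpwO
  have hne := mk_mul_weyl_ne p
  set x1 : ProjLine := (p : ProjLine) with hx1
  set x2 : ProjLine := ((p * weyl : SU2) : ProjLine) with hx2
  have hx2O : x2 ∈ O.erase x1 := Finset.mem_erase.2 ⟨hne, hpwO⟩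
  have hdec : formOf O = linForm x1.out * (linForm x2.out * formOf ((O.erase x1).erase x2)) := by
    rw [formOf, ← Finset.mul_prod_erase O _ hpO, ← Finset.mul_prod_erase _ _ hx2O]
    rfl
  set G' := formOf ((O.erase x1).erase x2) with hG'
  have hG'hom : G'.IsHomogeneous n := by
    have := isHomogeneous_formOf ((O.erase x1).erase x2)
    rwa [Finset.card_erase_of_mem hx2O, Finset.card_erase_of_mem hpO, hcard] at this
  obtain ⟨h1, h1'⟩ := conj_zero_zero_eq_of_mk_eq (QuotientGroup.out_eq' x1).symm hp
  obtain ⟨h2, h2'⟩ := conj_zero_zero_eq_of_mk_eq (QuotientGroup.out_eq' x2).symm hw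
  have e1 := subst_linForm_of_fixed h1
  have e2 := subst_linForm_of_fixed h2
  rw [h1'] at e1
  rw [h2', hw0, Complex.conj_conj] at e2
  have hζ : (C (starRingEnd ℂ (((p⁻¹ * γ * p : SU2) : Matrix (Fin 2) (Fin 2) ℂ) 0 0)) *
      C (((p⁻¹ * γ * p : SU2) : Matrix (Fin 2) (Fin 2) ℂ) 0 0) : MvPolynomial (Fin 2) ℂ) = 1 := by
    rw [← C_mul, mul_comm, torus_mul_conj hp, C_1]
  rw [hdec, subst_mul, subst_mul, e1, e2] at e
  have e3 : subst γ G' = G' * C c := by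
    refine mul_left_cancel₀ (mul_ne_zero (linForm_ne_zero x1.out) (linForm_ne_zero x2.out)) ?_
    linear_combination e - linForm x1.out * linForm x2.out * subst γ G' * hζ
  have h3 := evalAt_smul_of_fixed hG'hom hp
  rw [pow_eq_one_of_card_stabilizer_dvd Γ hγ hp (by
    rw [card_stabilizer_eq_of_mem_orbit Γ (by rwa [hO, mem_orbitFinset] at hpO)]; exact hx),
    one_mul, e3, evalAt_mul, evalAt_C] at h3
  refine (mul_eq_left₀ ?_).1 h3
  rw [Ne, evalAt_formOf_eq_zero_iff]
  simp [hx1]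

end stabilizers

/-! ### Invariants of the polyhedral groups -/

theorem evalAt_eq_restrict (p : SU2) (f : MvPolynomial (Fin 2) ℂ) :
    evalAt p f = restrict (rename Sum.inl f) p := (restrict_rename f p).symm

theorem restrict_lowering_linForm (p : SU2) :
    restrict (lowering (rename Sum.inl (linForm p))) p = 1 := by
  have := restrict_iterate_lowering_subst p⁻¹ p (X 1) 1
  simp only [Function.iterate_one, inv_mul_cancel] at this
  rw [linForm, transport, this, rename_X, lowering_X_inl]
  simp [secondColumn, restrict_X_inr]

/-- At a zero p, the value of J₋P detects whether the zero is simple, since J₋ of the linear factor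
is 1 at p. -/
theorem restrict_lowering_ne_zero {P G : MvPolynomial (Fin 2) ℂ} {p : SU2}
    (hP : P = linForm p * G) (hG : evalAt p G ≠ 0) :
    restrict (lowering (rename Sum.inl P)) p ≠ 0 := by
  have h0 : restrict (rename Sum.inl (linForm p)) p = 0 := by
    rw [← evalAt_eq_restrict, evalAt_linForm_eq_zero_iff]
  rw [hP, map_mul, Derivation.leibniz, map_add, smul_eq_mul, smul_eq_mul, map_mul, map_mul,
    Pi.add_apply, Pi.mul_apply, Pi.mul_apply, h0, restrict_lowering_linForm, zero_mul, zero_add,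
    mul_one, ← evalAt_eq_restrict]
  exact hG

/-- At a zero of P the Hessian formula reduces to -(d-1)²(J₋P)². -/
theorem evalAt_hessian_ne_zero {P : MvPolynomial (Fin 2) ℂ} {d : ℕ} (hd : 2 ≤ d)
    (hP : P.IsHomogeneous d) {p : SU2} (h0 : evalAt p P = 0)
    (h1 : restrict (lowering (rename Sum.inl P)) p ≠ 0) : evalAt p (hessian P) ≠ 0 := by
  have h := congrFun (congrArg restrict (radiusSq_sq_mul_hessian (by omega) hP)) p
  rw [evalAt_eq_restrict] at h0
  simp only [map_mul, map_pow, restrict_radiusSq, one_pow, one_mul, map_sub, map_natCast, map_one,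
    Pi.mul_apply, Pi.sub_apply, Pi.pow_apply, Pi.natCast_apply, Pi.one_apply, h0, mul_zero,
    zero_mul, zero_sub] at h
  have hd1 : (d : ℂ) - 1 ≠ 0 := sub_ne_zero.2 (by exact_mod_cast (by omega : d ≠ 1))
  rw [evalAt_eq_restrict, h]
  exact mul_ne_zero hd1 (neg_ne_zero.2 (mul_ne_zero hd1 (pow_ne_zero _ h1)))

/-- At a zero of P the formula reduces to R = -(2d-4)·J₋P·Q; the factor 2d - 4 is why d ≥ 3 is
needed. -/
theorem evalAt_cross_hessian_ne_zero {P : MvPolynomial (Fin 2) ℂ} {d : ℕ} (hd : 3 ≤ d)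
    (hP : P.IsHomogeneous d) {p : SU2} (h0 : evalAt p P = 0)
    (h1 : restrict (lowering (rename Sum.inl P)) p ≠ 0) :
    evalAt p (cross P (hessian P)) ≠ 0 := by
  have h2 := evalAt_hessian_ne_zero (by omega) hP h0 h1
  have h := congrFun (congrArg restrict (radiusSq_mul_cross hP (isHomogeneous_hessian hP))) p
  rw [evalAt_eq_restrict] at h0 h2
  simp only [map_mul, restrict_radiusSq, one_mul, map_sub, map_natCast, Pi.one_apply,
    Pi.mul_apply, Pi.sub_apply, Pi.natCast_apply, h0, mul_zero,
    zero_mul, zero_sub] at h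
  have hd1 : ((2 * d - 4 : ℕ) : ℂ) ≠ 0 := by exact_mod_cast (by omega : 2 * d - 4 ≠ 0)
  rw [evalAt_eq_restrict, h]
  exact neg_ne_zero.2 (mul_ne_zero (mul_ne_zero hd1 h1) h2)

theorem IsInvariant.sub {Γ : Subgroup SU2} {P Q : MvPolynomial (Fin 2) ℂ}
    (hP : IsInvariant Γ P) (hQ : IsInvariant Γ Q) : IsInvariant Γ (P - Q) := fun γ hγ => by
  rw [subst_sub, hP γ hγ, hQ γ hγ]

theorem IsInvariant.mul {Γ : Subgroup SU2} {P Q : MvPolynomial (Fin 2) ℂ}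
    (hP : IsInvariant Γ P) (hQ : IsInvariant Γ Q) : IsInvariant Γ (P * Q) := fun γ hγ => by
  rw [subst_mul, hP γ hγ, hQ γ hγ]

theorem IsInvariant.pow {Γ : Subgroup SU2} {P : MvPolynomial (Fin 2) ℂ}
    (hP : IsInvariant Γ P) (n : ℕ) : IsInvariant Γ (P ^ n) := fun γ hγ => by
  rw [subst_pow, hP γ hγ]

theorem IsInvariant.smul {Γ : Subgroup SU2} {P : MvPolynomial (Fin 2) ℂ}
    (hP : IsInvariant Γ P) (c : ℂ) : IsInvariant Γ (c • P) := fun γ hγ => by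
  rw [subst_smul, hP γ hγ]

theorem IsInvariant.of_mul {Γ : Subgroup SU2} {P Q : MvPolynomial (Fin 2) ℂ} (h0 : P ≠ 0)
    (hP : IsInvariant Γ P) (hQ : IsInvariant Γ (P * Q)) : IsInvariant Γ Q := fun γ hγ => by
  have := hQ γ hγ
  rw [subst_mul, hP γ hγ] at this
  exact mul_left_cancel₀ h0 this

theorem exists_two_mul_add_three_mul {j : ℕ} (h0 : j ≠ 1) : ∃ a b, j = 2 * a + 3 * b := by
  rcases Nat.even_or_odd' j with ⟨a, rfl | rfl⟩
  · exact ⟨a, 0, by omega⟩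
  · exact ⟨a - 1, 1, by omega⟩

section

variable (Γ : Subgroup SU2) [Finite Γ] (x : ProjLine) {n : ℕ} (hn : 2 < n)
  (hst : Nat.card (MulAction.stabilizer Γ x) = n)
  (horb : Nat.card (MulAction.orbit Γ x) = n + 2)
  (hy : ∀ y ∉ MulAction.orbit Γ x, Nat.card (MulAction.stabilizer Γ y) ∣ n + 2)
  (hno : ∀ F, ¬ IsInvariantForm Γ F n)
include hn hst horb hy hno

/-- The lowest invariant form is the form with simple zeros at the distinguished orbit. -/
theorem eq_smul_formOf_of_isLowestInvariant {P : MvPolynomial (Fin 2) ℂ} {d : ℕ}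
    (hP : IsLowestInvariant Γ P d) :
    d = n + 2 ∧ ∃ c : ℂ, c ≠ 0 ∧ P = formOf (orbitFinset Γ x) * C c := by
  obtain ⟨⟨hP0, hd0, hPhom, hPinv⟩, hlow⟩ := hP
  have hcard : (orbitFinset Γ x).card = n + 2 := by rw [card_orbitFinset, horb]
  have hF := isHomogeneous_formOf (orbitFinset Γ x)
  rw [hcard] at hF
  have hle : d ≤ n + 2 := hlow _ _ ⟨formOf_ne_zero (orbitFinset Γ x), by omega, hF,
    isInvariant_formOf_orbit Γ x horb (hst ▸ dvd_rfl) hy⟩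
  have hPx : evalAt x.out P = 0 := by
    by_contra h
    have h1 := card_stabilizer_dvd Γ hPhom hPinv h
    rw [QuotientGroup.out_eq', hst] at h1
    obtain ⟨j, rfl⟩ := h1
    -- n divides d, and 0 < d ≤ n + 2 < 2n because n > 2. So d = n, which is excluded.
    obtain rfl : j = 1 := by
      rcases Nat.lt_or_ge j 2 with hj | hj
      · have : j ≠ 0 := by rintro rfl; simp at hd0
        omega
      · nlinarith
    rw [mul_one] at *
    exact hno P ⟨hP0, hd0, hPhom, hPinv⟩
  have hz := evalAt_eq_zero_of_mem_orbit Γ hPhom hPinv hPx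
  rw [QuotientGroup.out_eq'] at hz
  obtain ⟨G, hG, e⟩ := exists_eq_formOf_mul _ hPhom hz
  have hge := card_le_of_evalAt_eq_zero _ hPhom hP0 hz
  have hd : d = n + 2 := by omega
  rw [hcard, hd, Nat.sub_self, ← totalDegree_zero_iff_isHomogeneous,
    totalDegree_eq_zero_iff_eq_C] at hG
  refine ⟨hd, coeff 0 G, fun h => ?_, by rw [← hG, ← e]⟩
  rw [h, C_0] at hG
  rw [hG, mul_zero] at e
  exact hP0 e

theorem hessian_cross_ne_zero_at {P : MvPolynomial (Fin 2) ℂ} {d : ℕ}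
    (hP : IsLowestInvariant Γ P d) :
    evalAt x.out (hessian P) ≠ 0 ∧ evalAt x.out (cross P (hessian P)) ≠ 0 := by
  classical
  obtain ⟨hd, c, hc, e⟩ := eq_smul_formOf_of_isLowestInvariant Γ x hn hst horb hy hno hP
  have hx : x ∈ orbitFinset Γ x := (mem_orbitFinset Γ).2 (MulAction.mem_orbit_self x)
  have hPx : evalAt x.out P = 0 := by
    rw [e, evalAt_mul, (evalAt_formOf_eq_zero_iff _ _).2 (by rwa [QuotientGroup.out_eq']), zero_mul]
  have e' : P = linForm x.out * (formOf ((orbitFinset Γ x).erase x) * C c) := by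
    rw [e, formOf, ← Finset.mul_prod_erase _ _ hx, mul_assoc]
    rfl
  have h1 := restrict_lowering_ne_zero e' (by
    rw [evalAt_mul, evalAt_C]
    refine mul_ne_zero ?_ hc
    rw [Ne, evalAt_formOf_eq_zero_iff, QuotientGroup.out_eq']
    simp)
  exact ⟨evalAt_hessian_ne_zero (by omega) hP.1.2.2.1 hPx h1,
    evalAt_cross_hessian_ne_zero (by omega) hP.1.2.2.1 hPx h1⟩

/-- The invariant forms are polynomials in the lowest invariant form, its Hessian and the cross
product of the two. -/
theorem mem_of_isInvariant {P : MvPolynomial (Fin 2) ℂ} {d : ℕ} (hP : IsLowestInvariant Γ P d)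
    (S : Subalgebra ℂ (MvPolynomial (Fin 2) ℂ)) (hPS : P ∈ S) (hQS : hessian P ∈ S)
    (hRS : cross P (hessian P) ∈ S) (k : ℕ) : ∀ F : MvPolynomial (Fin 2) ℂ, F.IsHomogeneous k →
      IsInvariant Γ F → F ∈ S := by
  obtain ⟨hd, c, hc, e⟩ := eq_smul_formOf_of_isLowestInvariant Γ x hn hst horb hy hno hP
  obtain ⟨hQ0, hR0⟩ := hessian_cross_ne_zero_at Γ x hn hst horb hy hno hP
  obtain ⟨⟨hP0, hd0, hPhom, hPinv⟩, hlow⟩ := hP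
  have hcard : (orbitFinset Γ x).card = d := by rw [card_orbitFinset, horb, hd]
  induction k using Nat.strong_induction_on with
  | _ k ih =>
    -- An invariant that vanishes at x vanishes on the orbit, hence is divisible by P, with
    -- invariant quotient of lower degree.
    have hzero : ∀ F : MvPolynomial (Fin 2) ℂ, F.IsHomogeneous k → IsInvariant Γ F →
        evalAt x.out F = 0 → F ∈ S := by
      intro F hF hFinv hFx
      rcases eq_or_ne F 0 with rfl | hF0
      · exact S.zero_mem
      have hz := evalAt_eq_zero_of_mem_orbit Γ hF hFinv hFx
      rw [QuotientGroup.out_eq'] at hz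
      obtain ⟨G, hG, eG⟩ := exists_eq_formOf_mul _ hF hz
      have hge := card_le_of_evalAt_eq_zero _ hF hF0 hz
      rw [hcard] at hG hge
      have eG' : F = P * (c⁻¹ • G) := by
        rw [e, ← C_mul', mul_assoc, ← mul_assoc (C c), ← C_mul, mul_inv_cancel₀ hc, C_1, one_mul,
          ← eG]
      rw [eG']
      refine S.mul_mem hPS (ih (k - d) (by omega) _ (isHomogeneous_smul hG _) ?_)
      rw [eG'] at hFinv
      exact hPinv.of_mul hP0 hFinv
    intro F hF hFinv
    by_cases hFx : evalAt x.out F = 0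
    · exact hzero F hF hFinv hFx
    have hdvd := card_stabilizer_dvd Γ hF hFinv hFx
    rw [QuotientGroup.out_eq', hst] at hdvd
    obtain ⟨j, hj⟩ := hdvd
    have hj1 : j ≠ 1 := by
      rintro rfl
      rw [mul_one] at hj
      refine hno F ⟨?_, by omega, hj ▸ hF, hFinv⟩
      rintro rfl
      exact hFx (map_zero _)
    -- The degree is jn with j ≠ 1, and Q, R have degrees 2n and 3n. So some Q^a R^b has the same
    -- degree and is non-zero at x; subtracting a multiple of it makes the value at x zero.
    obtain ⟨a, b, hab⟩ := exists_two_mul_add_three_mul hj1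
    set E := hessian P ^ a * cross P (hessian P) ^ b with hE
    have hEhom : E.IsHomogeneous k := by
      have := ((isHomogeneous_hessian hPhom).pow a).mul
        ((isHomogeneous_cross_hessian (by omega) hPhom).pow b)
      convert this using 1
      rw [hj, hab, hd, show 2 * (n + 2) - 4 = 2 * n by omega, show 3 * (n + 2) - 6 = 3 * n by omega]
      ring
    have hEinv : IsInvariant Γ E := (hPinv.hessian.pow a).mul ((hPinv.cross hPinv.hessian).pow b)
    have hES : E ∈ S := S.mul_mem (S.pow_mem hQS a) (S.pow_mem hRS b)
    have hE0 : evalAt x.out E ≠ 0 := by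
      rw [hE, evalAt_mul, evalAt_pow, evalAt_pow]
      exact mul_ne_zero (pow_ne_zero _ hQ0) (pow_ne_zero _ hR0)
    set r := evalAt x.out F / evalAt x.out E with hr
    have h1 : F - r • E ∈ S := by
      refine hzero _ (hF.sub (isHomogeneous_smul hEhom _)) (hFinv.sub (hEinv.smul r)) ?_
      rw [evalAt_sub, ← C_mul', evalAt_mul, evalAt_C, hr, div_mul_cancel₀ _ hE0, sub_self]
    have := S.add_mem h1 (S.smul_mem hES r)
    rwa [sub_add_cancel] at this

theorem adjoin_multiplet_eq_of_isLowestInvariant {P : MvPolynomial (Fin 2) ℂ} {d : ℕ}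
    (hP : IsLowestInvariant Γ P d) :
    hessian P ≠ 0 ∧ cross P (hessian P) ≠ 0 ∧
      Algebra.adjoin ℂ (multiplet P : Set (SU2 → ℂ)) = quotientFunctions Γ := by
  obtain ⟨hQ0, hR0⟩ := hessian_cross_ne_zero_at Γ x hn hst horb hy hno hP
  refine ⟨fun h => hQ0 (by rw [h]; exact map_zero _), fun h => hR0 (by rw [h]; exact map_zero _), ?_⟩
  refine adjoin_eq_quotientFunctions Γ _ (multiplet_le_quotientFunctions hP.1.2.2.2) ?_
  have hPB : P ∈ formsIn (Algebra.adjoin ℂ (multiplet P : Set (SU2 → ℂ))) := by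
    rw [mem_formsIn_iff]; exact Algebra.subset_adjoin
  have hPhom := hP.1.2.2.1
  have hQB := hessian_mem_formsIn hP.1.2.1 hPhom hPB
  exact mem_of_isInvariant Γ x hn hst horb hy hno hP _ hPB hQB
    (cross_mem_formsIn hPhom (isHomogeneous_hessian hPhom) hPB hQB)

end

/-! ### Subgroups fixing a point or a pair of points -/

theorem mem_conjugate_iff {k g : SU2} {H : Subgroup SU2} :
    g ∈ conjugate k H ↔ k⁻¹ * g * k ∈ H := by
  rw [conjugate, Subgroup.mem_map]
  constructor
  · rintro ⟨h, hh, rfl⟩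
    simpa [mul_assoc] using hh
  · intro h
    exact ⟨_, h, by simp [mul_assoc]⟩

theorem conjugate_conjugate_inv (k : SU2) (H : Subgroup SU2) :
    conjugate k (conjugate k⁻¹ H) = H := by
  ext g
  rw [mem_conjugate_iff, mem_conjugate_iff]
  simp [mul_assoc]

theorem finite_conjugate (k : SU2) (H : Subgroup SU2) [Finite H] : Finite (conjugate k H) :=
  (Set.Finite.image (MulAut.conj k) (Set.toFinite (H : Set SU2))).to_subtype

theorem rotation_mem_torus (n : ℕ) : rotation n ∈ torus := rfl

theorem rotation_zero_zero (n : ℕ) : (rotation n : Matrix (Fin 2) (Fin 2) ℂ) 0 0 =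
    Complex.exp (2 * Real.pi * Complex.I / n) := rfl

theorem cyclicGroup_le_torus (n : ℕ) : cyclicGroup n ≤ torus := by
  rw [cyclicGroup, Subgroup.zpowers_le]
  exact rotation_mem_torus n

theorem rotation_pow_eq_one {n : ℕ} (hn : 1 ≤ n) : rotation n ^ n = 1 := by
  refine torus_ext (pow_mem (rotation_mem_torus n) n) (one_mem _) ?_
  rw [torus_pow_zero_zero (rotation_mem_torus n), rotation_zero_zero,
    (Complex.isPrimitiveRoot_exp n (by omega)).pow_eq_one]
  simp

theorem mem_cyclicGroup {n : ℕ} (hn : 1 ≤ n) {g : SU2} (hg : g ∈ torus)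
    (h : (g : Matrix (Fin 2) (Fin 2) ℂ) 0 0 ^ n = 1) : g ∈ cyclicGroup n := by
  have : NeZero n := ⟨by omega⟩
  obtain ⟨i, -, hi⟩ := (Complex.isPrimitiveRoot_exp n (by omega)).eq_pow_of_pow_eq_one h
  have : g = rotation n ^ i := torus_ext hg (pow_mem (rotation_mem_torus n) i) (by
    rw [torus_pow_zero_zero (rotation_mem_torus n), rotation_zero_zero, hi])
  rw [this]
  exact pow_mem (Subgroup.mem_zpowers _) i

/-- By Lagrange the diagonal entries are N-th roots of unity, where N is the order of H, and there
are only N of these. -/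
theorem eq_cyclicGroup_of_le_torus (H : Subgroup SU2) [Finite H] (hH : H ≤ torus) :
    H = cyclicGroup (Nat.card H) := by
  have hc : 1 ≤ Nat.card H := Nat.card_pos
  have hle : H ≤ cyclicGroup (Nat.card H) := fun g hg => by
    refine mem_cyclicGroup hc (hH hg) ?_
    rw [← torus_pow_zero_zero (hH hg)]
    have h1 : (⟨g, hg⟩ : H) ^ Nat.card H = 1 := pow_card_eq_one'
    have h2 : g ^ Nat.card H = 1 := congrArg Subtype.val h1
    rw [h2]
    simp
  have hfin : Finite (cyclicGroup (Nat.card H)) := by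
    rw [cyclicGroup, Subgroup.zpowers_eq_closure, ← Subgroup.zpowers_eq_closure]
    exact finite_zpowers.2 (isOfFinOrder_iff_pow_eq_one.2 ⟨_, hc, rotation_pow_eq_one hc⟩)
  refine Subgroup.eq_of_le_of_card_ge hle ?_
  rw [cyclicGroup, Nat.card_zpowers]
  exact Nat.le_of_dvd hc (orderOf_dvd_of_pow_eq_one (rotation_pow_eq_one hc))

/-- A finite group that fixes a point of the projective line is cyclic. -/
theorem exists_eq_conjugate_cyclicGroup (Γ : Subgroup SU2) [Finite Γ] (x : ProjLine)
    (hx : ∀ γ ∈ Γ, γ • x = x) : ∃ n k, 1 ≤ n ∧ Γ = conjugate k (cyclicGroup n) := by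
  obtain ⟨k, rfl⟩ := QuotientGroup.mk_surjective x
  have := finite_conjugate k⁻¹ Γ
  refine ⟨Nat.card (conjugate k⁻¹ Γ), k, Nat.card_pos, ?_⟩
  rw [← eq_cyclicGroup_of_le_torus, conjugate_conjugate_inv]
  intro g hg
  rw [mem_conjugate_iff, inv_inv] at hg
  have := smul_mk_eq_iff.1 (hx _ hg)
  simpa [mul_assoc] using this

theorem weyl_mul_mul_weyl {g : SU2} (hg : g ∈ torus) : weyl⁻¹ * g * weyl = g⁻¹ := by
  obtain ⟨h1, h2⟩ := weyl_inv_mul_mul hg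
  exact torus_ext h1 (inv_mem hg) (by rw [h2, SU2.inv_zero_zero])

theorem exists_sq_eq_of_mem_torus {g : SU2} (hg : g ∈ torus) : ∃ h ∈ torus, h ^ 2 = g := by
  obtain ⟨c, hc⟩ := IsAlgClosed.exists_pow_nat_eq ((g : Matrix (Fin 2) (Fin 2) ℂ) 0 0)
    (show 0 < 2 by norm_num)
  have h1 : Complex.normSq ((g : Matrix (Fin 2) (Fin 2) ℂ) 0 0) = 1 := by
    have := torus_mul_conj hg
    rw [Complex.mul_conj] at this
    exact_mod_cast this
  have hn : Complex.normSq c = 1 := by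
    rw [← hc, map_pow] at h1
    exact (pow_eq_one_iff_of_nonneg (Complex.normSq_nonneg c) (by norm_num)).1 h1
  have hmem : diagonal c hn ∈ torus := rfl
  refine ⟨diagonal c hn, hmem, torus_ext (pow_mem hmem 2) hg ?_⟩
  rw [torus_pow_zero_zero hmem]
  exact hc

theorem weyl_sq : weyl ^ 2 = diagonal (-1) (by simp) := by
  refine SU2.ext_col ?_ ?_ <;>
  simp [pow_two, SU2.mul_col, weyl, diagonal, SU2.apply_zero_one, SU2.apply_one_one]

theorem diagonal_neg_one_ne_one : diagonal (-1) (by simp) ≠ 1 := by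
  intro h
  have := congrArg (fun g : SU2 => (g : Matrix (Fin 2) (Fin 2) ℂ) 0 0) h
  simp [diagonal] at this
  norm_num at this

theorem diagonal_neg_one_sq : diagonal (-1) (by simp) ^ 2 = 1 := by
  refine SU2.ext_col ?_ ?_ <;>
  simp [pow_two, SU2.mul_col, diagonal]

/-- A finite group that contains the Weyl element and permutes the two coordinate lines is binary
dihedral. -/
theorem eq_binaryDihedralGroup (H : Subgroup SU2) [Finite H] (hw : weyl ∈ H)
    (hH : ∀ g ∈ H, g ∈ torus ∨ weyl⁻¹ * g ∈ torus) :
    ∃ n, 1 ≤ n ∧ H = binaryDihedralGroup n := by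
  set H₀ : Subgroup SU2 := H ⊓ torus with hH₀
  have hfin : Finite H₀ := Finite.Set.subset (H : Set SU2) fun g hg => hg.1
  have hcyc := eq_cyclicGroup_of_le_torus H₀ inf_le_right
  have hneg : diagonal (-1) (by simp) ∈ H₀ := by
    refine ⟨?_, rfl⟩
    rw [← weyl_sq]
    exact pow_mem hw 2
  have hdvd : 2 ∣ Nat.card H₀ := by
    have h1 : orderOf (⟨_, hneg⟩ : H₀) = 2 := by
      refine orderOf_eq_prime (Subtype.ext diagonal_neg_one_sq) fun h => ?_
      exact diagonal_neg_one_ne_one (congrArg Subtype.val h)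
    have h2 := orderOf_dvd_natCard (⟨_, hneg⟩ : H₀)
    rwa [h1] at h2
  obtain ⟨n, hn⟩ := hdvd
  have hpos : 0 < Nat.card H₀ := Nat.card_pos
  rw [hn] at hcyc
  refine ⟨n, by omega, le_antisymm (fun g hg => ?_) ?_⟩
  · have hle : H₀ ≤ binaryDihedralGroup n := by
      rw [hcyc, cyclicGroup, Subgroup.zpowers_le]
      exact Subgroup.subset_closure (by simp)
    have hwD : weyl ∈ binaryDihedralGroup n := Subgroup.subset_closure (by simp [weyl])
    rcases hH g hg with h | h
    · exact hle ⟨hg, h⟩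
    · have := mul_mem hwD (hle ⟨H.mul_mem (H.inv_mem hw) hg, h⟩)
      rwa [mul_inv_cancel_left] at this
  · rw [binaryDihedralGroup, Subgroup.closure_le]
    rintro g (rfl | rfl)
    · have : rotation (2 * n) ∈ H₀ := by
        rw [hcyc]; exact Subgroup.mem_zpowers _
      exact this.1
    · exact hw

/-- A finite group that exchanges two orthogonal lines is binary dihedral. -/
theorem exists_eq_conjugate_binaryDihedralGroup (Γ : Subgroup SU2) [Finite Γ] (k γ₀ : SU2)
    (hγ₀ : γ₀ ∈ Γ) (h₀ : γ₀ • (k : ProjLine) ≠ k)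
    (h : ∀ γ ∈ Γ, γ • (k : ProjLine) = k ∨ γ • (k : ProjLine) = ((k * weyl : SU2) : ProjLine)) :
    ∃ n k, 1 ≤ n ∧ Γ = conjugate k (binaryDihedralGroup n) := by
  have key : ∀ γ : SU2, γ • (k : ProjLine) = ((k * weyl : SU2) : ProjLine) ↔
      weyl⁻¹ * (k⁻¹ * γ * k) ∈ torus := by
    intro γ
    have : γ • (k : ProjLine) = ((γ * k : SU2) : ProjLine) := rfl
    rw [this, eq_comm, QuotientGroup.eq]
    simp [mul_assoc]
  have hτ := (key γ₀).1 ((h γ₀ hγ₀).resolve_left h₀)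
  -- In the coordinates of k, γ₀ is `weyl` times a diagonal matrix. Conjugation by δ multiplies
  -- `weyl` by the square of a diagonal matrix, so this square root moves γ₀ exactly to `weyl`.
  obtain ⟨δ, hδ, hδ2⟩ := exists_sq_eq_of_mem_torus (inv_mem hτ)
  have hτ' : weyl⁻¹ * (k⁻¹ * γ₀ * k) = (δ ^ 2)⁻¹ := by rw [hδ2, inv_inv]
  have hδw : δ * weyl = weyl * δ⁻¹ := by
    rw [← weyl_mul_mul_weyl hδ]; group
  have hfin := finite_conjugate (k * δ)⁻¹ Γ
  obtain ⟨n, hn, e⟩ := eq_binaryDihedralGroup (conjugate (k * δ)⁻¹ Γ) (by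
    rw [mem_conjugate_iff, inv_inv]
    have : k * δ * weyl * (k * δ)⁻¹ = γ₀ := by
      have h1 : γ₀ = k * weyl * (δ ^ 2)⁻¹ * k⁻¹ := by rw [← hτ']; group
      rw [h1, mul_assoc k δ, hδw]
      group
    rwa [this]) (by
    intro g hg
    rw [mem_conjugate_iff, inv_inv] at hg
    rcases h _ hg with h1 | h1
    · left
      rw [smul_mk_eq_iff] at h1
      have h2 := mul_mem (mul_mem (inv_mem hδ) h1) hδ
      convert h2 using 1
      group
    · right
      rw [key] at h1
      have h2 := mul_mem (mul_mem hδ h1) hδ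
      have h3 : weyl⁻¹ * δ⁻¹ = δ * weyl⁻¹ := by
        rw [← mul_inv_rev, hδw, mul_inv_rev, inv_inv]
      convert h2 using 1
      rw [← mul_assoc δ, ← h3]
      group)
  exact ⟨n, k * δ, hn, by rw [← e, conjugate_conjugate_inv]⟩

/-! ### Fixed points on the projective line -/

theorem smul_eq_self_of_conj_eq {γ p : SU2} (hp : p⁻¹ * γ * p ∈ torus)
    (h : starRingEnd ℂ (((p⁻¹ * γ * p : SU2) : Matrix (Fin 2) (Fin 2) ℂ) 0 0) =
      ((p⁻¹ * γ * p : SU2) : Matrix (Fin 2) (Fin 2) ℂ) 0 0) (x : ProjLine) : γ • x = x := by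
  set τ := p⁻¹ * γ * p with hτ
  have hcomm : ∀ g : SU2, τ * g = g * τ := by
    intro g
    refine SU2.ext_col ?_ ?_
    · rw [mul_torus_zero_zero hp, SU2.mul_col, SU2.apply_zero_one, mem_torus_iff.1 hp]
      simp [mul_comm]
    · rw [mul_torus_zero_zero hp, SU2.mul_col, SU2.apply_one_one, mem_torus_iff.1 hp, h]
      simp [mul_comm]
  have hγ : γ = τ := by
    have : γ = p * τ * p⁻¹ := by rw [hτ]; group
    rw [this, ← hcomm, mul_inv_cancel_right]
  obtain ⟨q, rfl⟩ := QuotientGroup.mk_surjective x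
  rw [smul_mk_eq_iff, mul_assoc, hγ, hcomm, inv_mul_cancel_left]
  exact hp

/-- With (a, b) the coordinates of q in the eigenbasis, being fixed means ab times the difference of
the two eigenvalues is zero. -/
theorem mk_eq_or_of_smul_eq {γ p q : SU2} (hp : p⁻¹ * γ * p ∈ torus)
    (h : starRingEnd ℂ (((p⁻¹ * γ * p : SU2) : Matrix (Fin 2) (Fin 2) ℂ) 0 0) ≠
      ((p⁻¹ * γ * p : SU2) : Matrix (Fin 2) (Fin 2) ℂ) 0 0) (hq : γ • (q : ProjLine) = q) :
    (q : ProjLine) = p ∨ (q : ProjLine) = ((p * weyl : SU2) : ProjLine) := by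
  set τ := p⁻¹ * γ * p with hτ
  have h1 : (p⁻¹ * q)⁻¹ * (τ * (p⁻¹ * q)) ∈ torus := by
    rw [smul_mk_eq_iff] at hq
    convert hq using 1
    rw [hτ]; group
  rw [mem_torus_iff, SU2.mul_col (p⁻¹ * q)⁻¹, SU2.mul_col τ, SU2.mul_col τ,
    SU2.apply_one_one (p⁻¹ * q)⁻¹, SU2.apply_one_one τ, SU2.apply_zero_one τ, mem_torus_iff.1 hp,
    SU2.inv_zero_zero, SU2.inv_one_zero, Complex.conj_conj] at h1
  set a := ((p⁻¹ * q : SU2) : Matrix (Fin 2) (Fin 2) ℂ) 0 0 with ha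
  set b := ((p⁻¹ * q : SU2) : Matrix (Fin 2) (Fin 2) ℂ) 1 0 with hb
  have h2 : b * (a * (starRingEnd ℂ ((τ : Matrix (Fin 2) (Fin 2) ℂ) 0 0) -
      (τ : Matrix (Fin 2) (Fin 2) ℂ) 0 0)) = 0 := by
    rw [map_zero] at h1
    linear_combination h1
  rcases mul_eq_zero.1 h2 with h3 | h3
  · left
    rw [eq_comm, QuotientGroup.eq, mem_torus_iff]
    exact h3
  · right
    have h4 := (mul_eq_zero.1 h3).resolve_right (sub_ne_zero.2 h)
    have w0 : (weyl : Matrix (Fin 2) (Fin 2) ℂ) 0 0 = 0 := rfl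
    rw [eq_comm, QuotientGroup.eq, mem_torus_iff, mul_inv_rev, mul_assoc, SU2.mul_col, ← ha, h4,
      SU2.apply_one_one, SU2.inv_zero_zero, w0]
    simp

theorem exists_smul_ne {γ p : SU2} (hp : p⁻¹ * γ * p ∈ torus)
    (h : starRingEnd ℂ (((p⁻¹ * γ * p : SU2) : Matrix (Fin 2) (Fin 2) ℂ) 0 0) ≠
      ((p⁻¹ * γ * p : SU2) : Matrix (Fin 2) (Fin 2) ℂ) 0 0) : ∃ x : ProjLine, γ • x ≠ x := by
  -- Any column with both entries non-zero works, as it differs from both eigenlines.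
  let g : SU2 := SU2.mk (3 / 5) (4 / 5) (by simp; norm_num)
  refine ⟨((p * g : SU2) : ProjLine), fun hx => ?_⟩
  rcases mk_eq_or_of_smul_eq hp h hx with h1 | h1
  · rw [eq_comm, QuotientGroup.eq, inv_mul_cancel_left, mem_torus_iff] at h1
    simp [g] at h1
  · rw [eq_comm, QuotientGroup.eq, mem_torus_iff] at h1
    have w0 : (weyl : Matrix (Fin 2) (Fin 2) ℂ) 0 0 = 0 := rfl
    have w1 : (weyl : Matrix (Fin 2) (Fin 2) ℂ) 1 0 = 1 := rfl
    rw [mul_inv_rev, mul_assoc, inv_mul_cancel_left, SU2.mul_col, SU2.inv_one_zero,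
      SU2.apply_one_one, SU2.inv_zero_zero, w0, w1] at h1
    simp [g] at h1

/-! ### Elements acting trivially on the projective line -/

section poles

variable (Γ : Subgroup SU2)

/-- The elements that act trivially on the projective line. -/
def scalars : Subgroup Γ := (MulAction.toPermHom Γ ProjLine).ker

theorem mem_scalars_iff {γ : Γ} : γ ∈ scalars Γ ↔ ∀ x : ProjLine, γ • x = x := by
  rw [scalars, MonoidHom.mem_ker, Equiv.ext_iff]
  rfl

theorem mem_scalars_iff_conj {γ : Γ} {p : SU2} (hp : p⁻¹ * γ * p ∈ torus) : γ ∈ scalars Γ ↔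
    starRingEnd ℂ (((p⁻¹ * γ * p : SU2) : Matrix (Fin 2) (Fin 2) ℂ) 0 0) =
      ((p⁻¹ * γ * p : SU2) : Matrix (Fin 2) (Fin 2) ℂ) 0 0 := by
  rw [mem_scalars_iff]
  constructor
  · intro h
    by_contra hne
    obtain ⟨x, hx⟩ := exists_smul_ne hp hne
    exact hx (h x)
  · exact fun h x => smul_eq_self_of_conj_eq hp h x

theorem scalars_le_stabilizer (x : ProjLine) : scalars Γ ≤ MulAction.stabilizer Γ x :=
  fun _ hγ => (mem_scalars_iff Γ).1 hγ x

theorem sq_eq_one_iff_mem_scalars {γ : Γ} {p : SU2} (hp : p⁻¹ * γ * p ∈ torus) :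
    γ ∈ scalars Γ ↔ γ ^ 2 = 1 := by
  rw [mem_scalars_iff_conj Γ hp]
  have h1 := torus_mul_conj hp
  have h2 : γ ^ 2 = 1 ↔ (((p⁻¹ * γ * p : SU2) : Matrix (Fin 2) (Fin 2) ℂ) 0 0) ^ 2 = 1 := by
    rw [← torus_pow_zero_zero hp, ← Subtype.coe_inj, Subgroup.coe_pow, Subgroup.coe_one]
    have h3 : (p⁻¹ * (γ : SU2) * p) ^ 2 = p⁻¹ * (γ : SU2) ^ 2 * p := by
      rw [pow_two, pow_two]; group
    constructor
    · intro h
      rw [h3, h]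
      simp
    · intro h
      have h4 : (p⁻¹ * (γ : SU2) * p) ^ 2 = 1 := torus_ext (pow_mem hp 2) (one_mem _) (by
        rw [h]; simp)
      rw [h3] at h4
      have h5 : (γ : SU2) ^ 2 = p * (p⁻¹ * (γ : SU2) ^ 2 * p) * p⁻¹ := by group
      rw [h5, h4]; group
  rw [h2]
  have h0 := torus_zero_zero_ne_zero hp
  constructor
  · intro h
    rw [h] at h1
    rw [pow_two, h1]
  · intro h
    refine mul_left_cancel₀ h0 ?_
    rw [h1, ← h, pow_two]

theorem card_scalars_dvd_card_stabilizer (x : ProjLine) :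
    Nat.card (scalars Γ) ∣ Nat.card (MulAction.stabilizer Γ x) :=
  Subgroup.card_dvd_of_le (scalars_le_stabilizer Γ x)

variable [Finite Γ]

theorem card_scalars_dvd_two : Nat.card (scalars Γ) ∣ 2 := by
  have := isCyclic_stabilizer Γ ((1 : SU2) : ProjLine)
  have hc : IsCyclic (scalars Γ) := isCyclic_of_injective
    (Subgroup.inclusion (scalars_le_stabilizer Γ ((1 : SU2) : ProjLine)))
    (Subgroup.inclusion_injective _)
  rw [← IsCyclic.exponent_eq_card]
  refine Monoid.exponent_dvd_of_forall_pow_eq_one fun g => Subtype.ext ?_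
  have h1 := (mem_stabilizer_mk_iff Γ).1 (scalars_le_stabilizer Γ ((1 : SU2) : ProjLine) g.2)
  exact (sq_eq_one_iff_mem_scalars Γ h1).1 g.2

/-- An element of order two in SU(2) is a scalar, so a stabilizer of even order would supply a
non-trivial one. -/
theorem odd_card_stabilizer (h : Nat.card (scalars Γ) = 1) (x : ProjLine) :
    ¬ 2 ∣ Nat.card (MulAction.stabilizer Γ x) := by
  intro h2
  have : Fact (Nat.Prime 2) := ⟨Nat.prime_two⟩
  obtain ⟨g, hg⟩ := exists_prime_orderOf_dvd_card' 2 h2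
  obtain ⟨p, rfl⟩ := QuotientGroup.mk_surjective x
  have h3 : (g : Γ) ^ 2 = 1 := by
    have := pow_orderOf_eq_one g
    rw [hg] at this
    exact congrArg Subtype.val this
  have h4 := (sq_eq_one_iff_mem_scalars Γ ((mem_stabilizer_mk_iff Γ).1 g.2)).2 h3
  rw [Subgroup.card_eq_one] at h
  rw [h, Subgroup.mem_bot] at h4
  have h5 : g = 1 := Subtype.ext h4
  rw [h5, orderOf_one] at hg
  omega

end poles

/-! ### Counting the poles -/

section counting

variable (Γ : Subgroup SU2)

/-- The points fixed by some element that is not a scalar. -/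
def poles : SubMulAction Γ ProjLine where
  carrier := {x | ∃ γ : Γ, γ ∉ scalars Γ ∧ γ • x = x}
  smul_mem' := fun g x ⟨γ, hγ, hx⟩ => by
    refine ⟨g * γ * g⁻¹, fun h => hγ ?_, ?_⟩
    · have hn : (scalars Γ).Normal := MonoidHom.normal_ker _
      have := hn.conj_mem _ h g⁻¹
      simpa [mul_assoc] using this
    · rw [mul_smul, mul_smul, inv_smul_smul, hx]

theorem stabilizer_eq_scalars_of_notMem_poles {x : ProjLine} (hx : x ∉ poles Γ) :
    MulAction.stabilizer Γ x = scalars Γ := by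
  refine le_antisymm (fun γ hγ => ?_) (scalars_le_stabilizer Γ x)
  by_contra h
  exact hx ⟨γ, h, hγ⟩

theorem exists_fixedBy_eq_pair {γ : Γ} (hγ : γ ∉ scalars Γ) :
    ∃ x y : ProjLine, x ≠ y ∧ MulAction.fixedBy ProjLine γ = {x, y} := by
  obtain ⟨p, hp⟩ := exists_conj_mem_torus (γ : SU2)
  rw [mem_scalars_iff_conj Γ hp] at hγ
  refine ⟨(p : ProjLine), ((p * weyl : SU2) : ProjLine), (mk_mul_weyl_ne p).symm, ?_⟩
  ext x
  obtain ⟨q, rfl⟩ := QuotientGroup.mk_surjective x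
  constructor
  · intro hq
    exact mk_eq_or_of_smul_eq hp hγ hq
  · rintro (h | h)
    · rw [h]
      exact smul_mk_eq_iff.2 hp
    · rw [h]
      have h' : (p * weyl)⁻¹ * (γ : SU2) * (p * weyl) ∈ torus := by
        simpa only [mul_inv_rev, mul_assoc] using (weyl_inv_mul_mul hp).1
      exact smul_mk_eq_iff.2 h'

theorem card_fixedBy_poles (γ : Γ) [Decidable (γ ∈ scalars Γ)] :
    Nat.card (MulAction.fixedBy (poles Γ) γ) =
      if γ ∈ scalars Γ then Nat.card (poles Γ) else 2 := by
  split_ifs with h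
  · refine Nat.card_congr (Equiv.subtypeUnivEquiv fun x => ?_)
    exact Subtype.ext ((mem_scalars_iff Γ).1 h x)
  · obtain ⟨x, y, hxy, e⟩ := exists_fixedBy_eq_pair Γ h
    have hx : γ • x = x := by
      change x ∈ MulAction.fixedBy ProjLine γ
      rw [e]; simp
    have hy : γ • y = y := by
      change y ∈ MulAction.fixedBy ProjLine γ
      rw [e]; simp
    have e' : MulAction.fixedBy (poles Γ) γ = {⟨x, γ, h, hx⟩, ⟨y, γ, h, hy⟩} := by
      ext z
      have h1 : z ∈ MulAction.fixedBy (poles Γ) γ ↔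
          (z : ProjLine) ∈ MulAction.fixedBy ProjLine γ := Subtype.ext_iff
      rw [h1, e]
      simp [Subtype.ext_iff]
    rw [e', Nat.card_coe_set_eq, Set.ncard_pair]
    simpa [Subtype.ext_iff] using hxy

variable [Finite Γ]

instance finite_poles : Finite (poles Γ) := by
  have : ((poles Γ : SubMulAction Γ ProjLine) : Set ProjLine) ⊆
      ⋃ γ ∈ {γ : Γ | γ ∉ scalars Γ}, MulAction.fixedBy ProjLine γ := by
    rintro x ⟨γ, hγ, hx⟩
    exact Set.mem_biUnion hγ hx
  refine ((Set.toFinite {γ : Γ | γ ∉ scalars Γ}).biUnion fun γ hγ => ?_).subset this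
  obtain ⟨x, y, -, h⟩ := exists_fixedBy_eq_pair Γ hγ
  rw [h]
  exact Set.toFinite _

/-- The counting formula for the poles. -/
theorem sum_inv_card_stabilizer [Fintype (MulAction.orbitRel.Quotient Γ (poles Γ))] :
    (Nat.card (scalars Γ) : ℚ) * ∑ ω : MulAction.orbitRel.Quotient Γ (poles Γ),
        (1 / (Nat.card (MulAction.stabilizer Γ (ω.out : ProjLine)) : ℚ)) =
      Fintype.card (MulAction.orbitRel.Quotient Γ (poles Γ)) - 2 +
        2 * Nat.card (scalars Γ) / Nat.card Γ := by
  classical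
  have := Fintype.ofFinite Γ
  have := Fintype.ofFinite (poles Γ)
  have hT : (Nat.card Γ : ℚ) ≠ 0 := by exact_mod_cast Nat.card_pos.ne'
  -- Burnside's lemma: scalars fix all poles and every other element fixes exactly two. The number
  -- of poles is then rewritten through the orders of the stabilizers.
  have h1 := MulAction.sum_card_fixedBy_eq_card_orbits_mul_card_group Γ (poles Γ)
  simp only [← Nat.card_eq_fintype_card, card_fixedBy_poles] at h1
  rw [Finset.sum_ite, Finset.sum_const, Finset.sum_const, smul_eq_mul, smul_eq_mul] at h1
  have hz : (Finset.univ.filter fun γ : Γ => γ ∈ scalars Γ).card = Nat.card (scalars Γ) := by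
    rw [Nat.card_eq_fintype_card, Fintype.card_subtype]
  have hz' : Nat.card (scalars Γ) + (Finset.univ.filter fun γ : Γ => γ ∉ scalars Γ).card =
      Nat.card Γ := by
    rw [← hz, Finset.card_filter_add_card_filter_not, Nat.card_eq_fintype_card, Finset.card_univ]
  rw [hz] at h1
  have h2 := MulAction.card_eq_sum_card_group_div_card_stabilizer Γ (poles Γ)
  have h3 : (Nat.card (poles Γ) : ℚ) = Nat.card Γ *
      ∑ ω : MulAction.orbitRel.Quotient Γ (poles Γ),
        (1 / (Nat.card (MulAction.stabilizer Γ (ω.out : ProjLine)) : ℚ)) := by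
    rw [Nat.card_eq_fintype_card, h2, Nat.cast_sum, Finset.mul_sum]
    refine Finset.sum_congr rfl fun ω _ => ?_
    rw [← Nat.card_eq_fintype_card, ← Nat.card_eq_fintype_card,
      SubMulAction.stabilizer_of_subMul, Nat.cast_div (Subgroup.card_subgroup_dvd_card _)]
    · rw [mul_one_div]
    · exact_mod_cast Nat.card_pos.ne'
  have h1' : (Nat.card (scalars Γ) : ℚ) * Nat.card (poles Γ) +
      (Nat.card Γ - Nat.card (scalars Γ)) * 2 =
      Fintype.card (MulAction.orbitRel.Quotient Γ (poles Γ)) * Nat.card Γ := by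
    have e1 : (Nat.card Γ : ℚ) = Nat.card (scalars Γ) +
        (Finset.univ.filter fun γ : Γ => γ ∉ scalars Γ).card := by exact_mod_cast hz'.symm
    rw [e1, add_sub_cancel_left, ← e1, ← Nat.card_eq_fintype_card]
    exact_mod_cast h1
  rw [h3] at h1'
  field_simp
  linear_combination h1'

/-- The sum exceeds 1, so a = 2 and b ≤ 3; for b = 3 also c ≤ 5. The case b = 2 leaves T = 4c, which
is the dihedral family: a stabilizer of order 2c then has index two. -/
theorem arith_classification {a b c T : ℕ} (ha : 2 ≤ a) (hab : a ≤ b) (hbc : b ≤ c) (hT : 0 < T)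
    (h : (1 / a + 1 / b + 1 / c : ℚ) = 1 + 4 / T) :
    (T = 4 * c) ∨ (a = 2 ∧ b = 3 ∧ c = 3 ∧ T = 24) ∨ (a = 2 ∧ b = 3 ∧ c = 4 ∧ T = 48) ∨
      (a = 2 ∧ b = 3 ∧ c = 5 ∧ T = 120) := by
  have hTq : (0 : ℚ) < T := by exact_mod_cast hT
  have h4 : (0 : ℚ) < 4 / T := by positivity
  have inv_le : ∀ m n : ℕ, 0 < m → m ≤ n → (1 / n : ℚ) ≤ 1 / m := fun m n hm hmn =>
    one_div_le_one_div_of_le (by exact_mod_cast hm) (by exact_mod_cast hmn)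
  obtain rfl : a = 2 := by
    by_contra hne
    have h1 := inv_le 3 a (by norm_num) (by omega)
    have h2 := inv_le 3 b (by norm_num) (by omega)
    have h3 := inv_le 3 c (by norm_num) (by omega)
    norm_num at h1 h2 h3 h
    linarith
  have hb : b ≤ 3 := by
    by_contra hne
    have h2 := inv_le 4 b (by norm_num) (by omega)
    have h3 := inv_le 4 c (by norm_num) (by omega)
    norm_num at h2 h3 h
    linarith
  have hc0 : (0 : ℚ) < c := by exact_mod_cast (by omega : 0 < c)
  obtain rfl | rfl : b = 2 ∨ b = 3 := by omega
  · left
    have h1 : (1 / c : ℚ) = 4 / T := by push_cast at h; linarith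
    rw [div_eq_div_iff hc0.ne' hTq.ne'] at h1
    have : (T : ℚ) = ((4 * c : ℕ) : ℚ) := by push_cast; linarith
    exact_mod_cast this
  · have hc : c ≤ 5 := by
      by_contra hne
      have h3 := inv_le 6 c (by norm_num) (by omega)
      norm_num at h3 h
      linarith
    right
    have hTe : ∀ q : ℚ, 4 / (T : ℚ) = q → (T : ℚ) * q = 4 := fun q hq => by
      rw [← hq]; field_simp
    interval_cases c
    · left
      have := hTe (1 / 6) (by push_cast at h; linarith)
      exact ⟨rfl, rfl, rfl, by exact_mod_cast (by linarith : (T : ℚ) = 24)⟩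
    · right; left
      have := hTe (1 / 12) (by push_cast at h; linarith)
      exact ⟨rfl, rfl, rfl, by exact_mod_cast (by linarith : (T : ℚ) = 48)⟩
    · right; right
      have := hTe (1 / 30) (by push_cast at h; linarith)
      exact ⟨rfl, rfl, rfl, by exact_mod_cast (by linarith : (T : ℚ) = 120)⟩

end counting

/-! ### Finite subgroups that are neither cyclic nor binary dihedral -/

section classification

variable (Γ : Subgroup SU2)

/-- There are exactly three orbits of poles, with the given orders of stabilizers, and all other
points have stabilizers of order at most two. -/
def ThreeOrbits (n₁ n₂ n₃ : ℕ) : Prop :=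
  ∃ x₁ x₂ x₃ : ProjLine, Nat.card (MulAction.stabilizer Γ x₁) = n₁ ∧
    Nat.card (MulAction.stabilizer Γ x₂) = n₂ ∧ Nat.card (MulAction.stabilizer Γ x₃) = n₃ ∧
    (x₂ ∉ MulAction.orbit Γ x₁ ∧ x₃ ∉ MulAction.orbit Γ x₁ ∧ x₃ ∉ MulAction.orbit Γ x₂) ∧
    ∀ y, y ∈ MulAction.orbit Γ x₁ ∨ y ∈ MulAction.orbit Γ x₂ ∨ y ∈ MulAction.orbit Γ x₃ ∨
      Nat.card (MulAction.stabilizer Γ y) ∣ 2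

theorem mem_orbit_iff_mk_eq {x y : poles Γ} :
    (y : ProjLine) ∈ MulAction.orbit Γ (x : ProjLine) ↔
      (Quotient.mk'' y : MulAction.orbitRel.Quotient Γ (poles Γ)) = Quotient.mk'' x := by
  rw [Quotient.eq'']
  change _ ↔ y ∈ MulAction.orbit Γ x
  rw [← SubMulAction.val_image_orbit, Set.mem_image]
  constructor
  · rintro ⟨z, hz, e⟩
    rwa [← Subtype.ext e]
  · exact fun h => ⟨y, h, rfl⟩

variable [Finite Γ]

theorem exists_fixed_of_card_scalars_eq (h : Nat.card (scalars Γ) = Nat.card Γ) :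
    ∃ x : ProjLine, ∀ γ ∈ Γ, γ • x = x := by
  have htop := Subgroup.eq_top_of_card_eq _ h
  refine ⟨((1 : SU2) : ProjLine), fun γ hγ => ?_⟩
  have : (⟨γ, hγ⟩ : Γ) ∈ scalars Γ := by rw [htop]; trivial
  exact (mem_scalars_iff Γ).1 this ((1 : SU2) : ProjLine)

theorem exists_fixed_of_card_stabilizer_eq {x : ProjLine}
    (h : Nat.card (MulAction.stabilizer Γ x) = Nat.card Γ) :
    ∃ x : ProjLine, ∀ γ ∈ Γ, γ • x = x := by
  have htop := Subgroup.eq_top_of_card_eq _ h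
  refine ⟨x, fun γ hγ => ?_⟩
  have : (⟨γ, hγ⟩ : Γ) ∈ MulAction.stabilizer Γ x := by rw [htop]; trivial
  exact this

/-- The stabilizer has index two, so it is normal. A non-scalar τ in it therefore fixes every
translate of x, and τ has only two fixed points. -/
theorem exists_dihedral_of_card_stabilizer {x : ProjLine} (hx : x ∈ poles Γ)
    (h : Nat.card Γ = 2 * Nat.card (MulAction.stabilizer Γ x)) :
    ∃ n k, 1 ≤ n ∧ Γ = conjugate k (binaryDihedralGroup n) := by
  obtain ⟨k, rfl⟩ := QuotientGroup.mk_surjective x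
  have hindex : (MulAction.stabilizer Γ (k : ProjLine)).index = 2 := by
    have h1 := Subgroup.card_mul_index (MulAction.stabilizer Γ (k : ProjLine))
    rw [h, mul_comm] at h1
    exact Nat.eq_of_mul_eq_mul_right Nat.card_pos h1
  have hnormal := Subgroup.normal_of_index_eq_two hindex
  obtain ⟨τ, hτ, hτk⟩ := hx
  have hτk' := smul_mk_eq_iff.1 hτk
  rw [mem_scalars_iff_conj Γ hτk'] at hτ
  obtain ⟨γ₀, hγ₀⟩ : ∃ γ₀ : Γ, γ₀ ∉ MulAction.stabilizer Γ (k : ProjLine) := by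
    by_contra! hall
    have htop : MulAction.stabilizer Γ (k : ProjLine) = ⊤ := (Subgroup.eq_top_iff' _).2 hall
    rw [htop, Subgroup.index_top] at hindex
    omega
  refine exists_eq_conjugate_binaryDihedralGroup Γ k γ₀ γ₀.2 hγ₀ fun γ hγ => ?_
  have h1 : (⟨γ, hγ⟩ : Γ)⁻¹ * τ * (⟨γ, hγ⟩ : Γ) ∈ MulAction.stabilizer Γ (k : ProjLine) := by
    have := hnormal.conj_mem τ hτk (⟨γ, hγ⟩ : Γ)⁻¹
    rwa [inv_inv] at this
  have h2 : τ • ((⟨γ, hγ⟩ : Γ) • (k : ProjLine)) = (⟨γ, hγ⟩ : Γ) • (k : ProjLine) := by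
    have h3 : ((⟨γ, hγ⟩ : Γ)⁻¹ * τ * (⟨γ, hγ⟩ : Γ)) • (k : ProjLine) = k := h1
    rw [mul_smul, mul_smul, inv_smul_eq_iff] at h3
    exact h3
  exact mk_eq_or_of_smul_eq (q := γ * k) hτk' hτ h2

/-- Three orbits of poles, with the orders of the stabilizers sorted. -/
theorem dihedral_or_threeOrbits {x₁ x₂ x₃ : ProjLine} {e₁ e₂ e₃ : ℕ} (hx₃ : x₃ ∈ poles Γ)
    (h₁ : Nat.card (MulAction.stabilizer Γ x₁) = 2 * e₁)
    (h₂ : Nat.card (MulAction.stabilizer Γ x₂) = 2 * e₂)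
    (h₃ : Nat.card (MulAction.stabilizer Γ x₃) = 2 * e₃)
    (h₁₂ : x₂ ∉ MulAction.orbit Γ x₁) (h₁₃ : x₃ ∉ MulAction.orbit Γ x₁)
    (h₂₃ : x₃ ∉ MulAction.orbit Γ x₂)
    (hall : ∀ y, y ∈ MulAction.orbit Γ x₁ ∨ y ∈ MulAction.orbit Γ x₂ ∨ y ∈ MulAction.orbit Γ x₃ ∨
      Nat.card (MulAction.stabilizer Γ y) ∣ 2)
    (he : 2 ≤ e₁) (he₁₂ : e₁ ≤ e₂) (he₂₃ : e₂ ≤ e₃)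
    (h : (1 / e₁ + 1 / e₂ + 1 / e₃ : ℚ) = 1 + 4 / Nat.card Γ) :
    (∃ n k, 1 ≤ n ∧ Γ = conjugate k (binaryDihedralGroup n)) ∨
      (ThreeOrbits Γ 4 6 6 ∧ Nat.card Γ = 24) ∨ (ThreeOrbits Γ 4 6 8 ∧ Nat.card Γ = 48) ∨
      (ThreeOrbits Γ 4 6 10 ∧ Nat.card Γ = 120) := by
  rcases arith_classification he he₁₂ he₂₃ Nat.card_pos h with hT | ⟨rfl, rfl, rfl, hT⟩ |
    ⟨rfl, rfl, rfl, hT⟩ | ⟨rfl, rfl, rfl, hT⟩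
  · exact Or.inl (exists_dihedral_of_card_stabilizer Γ hx₃ (by omega))
  · exact Or.inr (Or.inl ⟨⟨x₁, x₂, x₃, h₁, h₂, h₃, ⟨h₁₂, h₁₃, h₂₃⟩, hall⟩, hT⟩)
  · exact Or.inr (Or.inr (Or.inl ⟨⟨x₁, x₂, x₃, h₁, h₂, h₃, ⟨h₁₂, h₁₃, h₂₃⟩, hall⟩, hT⟩))
  · exact Or.inr (Or.inr (Or.inr ⟨⟨x₁, x₂, x₃, h₁, h₂, h₃, ⟨h₁₂, h₁₃, h₂₃⟩, hall⟩, hT⟩))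

theorem dihedral_or_threeOrbits_of_unsorted {x₁ x₂ x₃ : ProjLine} {e₁ e₂ e₃ : ℕ}
    (hx₁ : x₁ ∈ poles Γ) (hx₂ : x₂ ∈ poles Γ) (hx₃ : x₃ ∈ poles Γ)
    (h₁ : Nat.card (MulAction.stabilizer Γ x₁) = 2 * e₁)
    (h₂ : Nat.card (MulAction.stabilizer Γ x₂) = 2 * e₂)
    (h₃ : Nat.card (MulAction.stabilizer Γ x₃) = 2 * e₃)
    (h₁₂ : x₂ ∉ MulAction.orbit Γ x₁) (h₁₃ : x₃ ∉ MulAction.orbit Γ x₁)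
    (h₂₃ : x₃ ∉ MulAction.orbit Γ x₂)
    (hall : ∀ y, y ∈ MulAction.orbit Γ x₁ ∨ y ∈ MulAction.orbit Γ x₂ ∨ y ∈ MulAction.orbit Γ x₃ ∨
      Nat.card (MulAction.stabilizer Γ y) ∣ 2)
    (he₁ : 2 ≤ e₁) (he₂ : 2 ≤ e₂) (he₃ : 2 ≤ e₃)
    (h : (1 / e₁ + 1 / e₂ + 1 / e₃ : ℚ) = 1 + 4 / Nat.card Γ) :
    (∃ n k, 1 ≤ n ∧ Γ = conjugate k (binaryDihedralGroup n)) ∨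
      (ThreeOrbits Γ 4 6 6 ∧ Nat.card Γ = 24) ∨ (ThreeOrbits Γ 4 6 8 ∧ Nat.card Γ = 48) ∨
      (ThreeOrbits Γ 4 6 10 ∧ Nat.card Γ = 120) := by
  have h₂₁ : x₁ ∉ MulAction.orbit Γ x₂ := fun h => h₁₂ (MulAction.mem_orbit_symm.1 h)
  have h₃₁ : x₁ ∉ MulAction.orbit Γ x₃ := fun h => h₁₃ (MulAction.mem_orbit_symm.1 h)
  have h₃₂ : x₂ ∉ MulAction.orbit Γ x₃ := fun h => h₂₃ (MulAction.mem_orbit_symm.1 h)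
  rcases le_total e₁ e₂ with a | a <;> rcases le_total e₂ e₃ with b | b <;>
    rcases le_total e₁ e₃ with c | c
  · exact dihedral_or_threeOrbits Γ hx₃ h₁ h₂ h₃ h₁₂ h₁₃ h₂₃ hall he₁ a b h
  · exact dihedral_or_threeOrbits Γ hx₃ h₁ h₂ h₃ h₁₂ h₁₃ h₂₃ hall he₁ a b h
  · exact dihedral_or_threeOrbits Γ hx₂ h₁ h₃ h₂ h₁₃ h₁₂ h₃₂
      (fun y => by have := hall y; tauto) he₁ c b (by linarith)
  · exact dihedral_or_threeOrbits Γ hx₂ h₃ h₁ h₂ h₃₁ h₃₂ h₁₂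
      (fun y => by have := hall y; tauto) he₃ c a (by linarith)
  · exact dihedral_or_threeOrbits Γ hx₃ h₂ h₁ h₃ h₂₁ h₂₃ h₁₃
      (fun y => by have := hall y; tauto) he₂ a c (by linarith)
  · exact dihedral_or_threeOrbits Γ hx₁ h₂ h₃ h₁ h₂₃ h₂₁ h₃₁
      (fun y => by have := hall y; tauto) he₂ b c (by linarith)
  · exact dihedral_or_threeOrbits Γ hx₁ h₃ h₂ h₁ h₃₂ h₃₁ h₂₁
      (fun y => by have := hall y; tauto) he₃ b a (by linarith)
  · exact dihedral_or_threeOrbits Γ hx₁ h₃ h₂ h₁ h₃₂ h₃₁ h₂₁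
      (fun y => by have := hall y; tauto) he₃ b a (by linarith)

/-- The classification of the finite subgroups of `SU(2)`, in the form of the orbits on the
projective line. -/
theorem cyclic_or_dihedral_or_threeOrbits :
    (∃ n k, 1 ≤ n ∧ Γ = conjugate k (cyclicGroup n)) ∨
    (∃ n k, 1 ≤ n ∧ Γ = conjugate k (binaryDihedralGroup n)) ∨
      (ThreeOrbits Γ 4 6 6 ∧ Nat.card Γ = 24) ∨ (ThreeOrbits Γ 4 6 8 ∧ Nat.card Γ = 48) ∨
      (ThreeOrbits Γ 4 6 10 ∧ Nat.card Γ = 120) := by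
  classical
  have hcyc : (∃ x : ProjLine, ∀ γ ∈ Γ, γ • x = x) →
      ∃ n k, 1 ≤ n ∧ Γ = conjugate k (cyclicGroup n) :=
    fun ⟨x, hx⟩ => exists_eq_conjugate_cyclicGroup Γ x hx
  let Ω := MulAction.orbitRel.Quotient Γ (poles Γ)
  let _ : Fintype Ω := Fintype.ofFinite (MulAction.orbitRel.Quotient Γ (poles Γ))
  have hsum := sum_inv_card_stabilizer Γ
  set z := Nat.card (scalars Γ) with hz
  set T := Nat.card Γ with hT
  have hTpos : 0 < T := Nat.card_pos
  have hzpos : 0 < z := Nat.card_pos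
  have hTq : (0 : ℚ) < T := by exact_mod_cast hTpos
  have hzq : (0 : ℚ) < z := by exact_mod_cast hzpos
  have hz2 : z = 1 ∨ z = 2 := (Nat.dvd_prime Nat.prime_two).1 (card_scalars_dvd_two Γ)
  let n : Ω → ℕ := fun ω => Nat.card (MulAction.stabilizer Γ (ω.out : ProjLine))
  have hnpos : ∀ ω, 0 < n ω := fun ω => Nat.card_pos
  have hnT : ∀ ω, n ω ≤ T := fun ω => Subgroup.card_le_card_group _
  have hnz : ∀ ω, 2 * z ≤ n ω ∧ (z = 1 → 3 ≤ n ω) := by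
    intro ω
    obtain ⟨j, hj⟩ := card_scalars_dvd_card_stabilizer Γ (ω.out : ProjLine)
    have hj' : n ω = z * j := hj
    have hne : n ω ≠ z := by
      intro h
      obtain ⟨γ, hγ, hx⟩ := ω.out.2
      have := Subgroup.eq_of_le_of_card_ge (scalars_le_stabilizer Γ (ω.out : ProjLine)) h.le
      rw [this] at hγ
      exact hγ hx
    have h0 := hnpos ω
    constructor
    · rw [hj', mul_comm]
      refine Nat.mul_le_mul_left _ ?_
      rcases Nat.lt_or_ge j 2 with h | h
      · interval_cases j
        · omega
        · omega
      · exact h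
    · intro h1
      have h2 := odd_card_stabilizer Γ h1 (ω.out : ProjLine)
      have h3 : ¬ 2 ∣ n ω := h2
      omega
  have hlow : ∀ ω, (1 / T : ℚ) ≤ 1 / n ω := fun ω =>
    one_div_le_one_div_of_le (by exact_mod_cast hnpos ω) (by exact_mod_cast hnT ω)
  have hup : ∀ ω, (z : ℚ) * (1 / n ω) ≤ 1 / 2 := fun ω => by
    have h1 : (0 : ℚ) < n ω := by exact_mod_cast hnpos ω
    have h2 : ((2 * z : ℕ) : ℚ) ≤ n ω := by exact_mod_cast (hnz ω).1
    push_cast at h2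
    rw [mul_one_div, div_le_iff₀ h1]
    linarith
  change (z : ℚ) * ∑ ω : Ω, (1 / (n ω : ℚ)) = Fintype.card Ω - 2 + 2 * z / T at hsum
  have hzT : (z : ℚ) / T > 0 := by positivity
  have hr : Fintype.card Ω ≤ 3 := by
    by_contra hr
    -- Each term is at most 1/2, so r orbits would give r - 2 + 2z/T ≤ r/2, impossible for r ≥ 4.
    have h1 : (z : ℚ) * ∑ ω : Ω, (1 / (n ω : ℚ)) ≤ Fintype.card Ω * (1 / 2) := by
      rw [Finset.mul_sum]
      refine (Finset.sum_le_sum fun ω _ => hup ω).trans (le_of_eq ?_)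
      rw [Finset.sum_const, nsmul_eq_mul, Finset.card_univ]
    have h2 : (4 : ℚ) ≤ Fintype.card Ω := by exact_mod_cast (by omega : 4 ≤ Fintype.card Ω)
    rw [hsum, mul_div_assoc] at h1
    linarith
  have hcard_eq : (1 : ℚ) ≤ z / T → z = T := by
    intro h
    rw [le_div_iff₀ hTq, one_mul] at h
    exact le_antisymm (Subgroup.card_le_card_group _) (by exact_mod_cast h)
  rw [mul_div_assoc] at hsum
  -- With at most one orbit the formula forces all elements to be scalars. With two, both
  -- stabilizers are the whole group. In each case Γ has a fixed point and is cyclic.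
  obtain hr | hr | hr | hr : Fintype.card Ω = 0 ∨ Fintype.card Ω = 1 ∨ Fintype.card Ω = 2 ∨
    Fintype.card Ω = 3 := by omega
  · left
    have := Fintype.card_eq_zero_iff.1 hr
    rw [hr, Fintype.sum_empty] at hsum
    refine hcyc (exists_fixed_of_card_scalars_eq Γ (hcard_eq ?_))
    push_cast at hsum
    linarith
  · left
    obtain ⟨ω, hω⟩ := Fintype.card_eq_one_iff.1 hr
    have hu : (Finset.univ : Finset Ω) = {ω} := by ext y; simp [hω y]
    rw [hr, hu, Finset.sum_singleton] at hsum
    refine hcyc (exists_fixed_of_card_scalars_eq Γ (hcard_eq ?_))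
    have h1 := mul_le_mul_of_nonneg_left (hlow ω) hzq.le
    rw [hsum, mul_one_div] at h1
    push_cast at h1
    linarith
  · left
    obtain ⟨ω₁, ω₂, hne, hu⟩ := Finset.card_eq_two.1 (Finset.card_univ.trans hr)
    rw [hr, hu, Finset.sum_pair hne] at hsum
    have h1 := hlow ω₁
    have h2 := hlow ω₂
    have h3 : (1 / n ω₁ : ℚ) + 1 / n ω₂ = 2 * (1 / T) := by
      refine mul_left_cancel₀ hzq.ne' ?_
      rw [hsum]
      push_cast
      ring
    have h4 : (1 / n ω₁ : ℚ) = 1 / T := by linarith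
    have h5 : (n ω₁ : ℚ) = T := by
      rw [one_div, one_div] at h4
      exact inv_injective h4
    exact hcyc (exists_fixed_of_card_stabilizer_eq Γ (x := (ω₁.out : ProjLine))
      (by exact_mod_cast h5))
  · right
    obtain ⟨ω₁, ω₂, ω₃, h12, h13, h23, hu⟩ := Finset.card_eq_three.1 (Finset.card_univ.trans hr)
    have hsum' : (z : ℚ) * (1 / n ω₁) + z * (1 / n ω₂) + z * (1 / n ω₃) = 1 + 2 * (z / T) := by
      rw [hr, hu, Finset.sum_insert (by simp [h12, h13]), Finset.sum_pair h23] at hsum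
      push_cast at hsum
      linarith
    rcases hz2 with hz1 | hz2
    -- Without non-trivial scalars the stabilizers of poles have odd order, at least 3, so the left
    -- side is at most 1 and cannot equal 1 + 2/T.
    · exfalso
      have hthird : ∀ ω, (z : ℚ) * (1 / n ω) ≤ 1 / 3 := fun ω => by
        have h3 : (3 : ℚ) ≤ n ω := by exact_mod_cast (hnz ω).2 hz1
        rw [hz1, Nat.cast_one, one_mul]
        exact one_div_le_one_div_of_le (by norm_num) h3
      linarith [hthird ω₁, hthird ω₂, hthird ω₃]
    · have heven : ∀ ω, ∃ e, n ω = 2 * e ∧ 2 ≤ e := fun ω => by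
        obtain ⟨j, hj⟩ := card_scalars_dvd_card_stabilizer Γ (ω.out : ProjLine)
        have hj' : n ω = 2 * j := by rw [← hz2]; exact hj
        have := (hnz ω).1
        exact ⟨j, hj', by omega⟩
      obtain ⟨e₁, he₁, he₁'⟩ := heven ω₁
      obtain ⟨e₂, he₂, he₂'⟩ := heven ω₂
      obtain ⟨e₃, he₃, he₃'⟩ := heven ω₃
      have hout : ∀ ω ω' : Ω, (ω.out : ProjLine) ∈ MulAction.orbit Γ (ω'.out : ProjLine) ↔
          ω = ω' := fun ω ω' => by
        rw [mem_orbit_iff_mk_eq]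
        exact Eq.congr (Quotient.out_eq' ω) (Quotient.out_eq' ω')
      refine dihedral_or_threeOrbits_of_unsorted Γ ω₁.out.2 ω₂.out.2 ω₃.out.2 he₁ he₂ he₃
        ?_ ?_ ?_ ?_ he₁' he₂' he₃' ?_
      · rw [hout]; exact h12.symm
      · rw [hout]; exact h13.symm
      · rw [hout]; exact h23.symm
      · intro y
        by_cases hy : y ∈ poles Γ
        · have h1 : (Quotient.mk'' (⟨y, hy⟩ : poles Γ) : Ω) ∈ (Finset.univ : Finset Ω) :=
            Finset.mem_univ _
          rw [hu] at h1
          have h2 : ∀ ω : Ω, (Quotient.mk'' (⟨y, hy⟩ : poles Γ) : Ω) = ω →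
              y ∈ MulAction.orbit Γ (ω.out : ProjLine) := fun ω h => by
            have := (mem_orbit_iff_mk_eq Γ (x := ω.out) (y := ⟨y, hy⟩)).2
              (h.trans (Quotient.out_eq' ω).symm)
            exact this
          simp only [Finset.mem_insert, Finset.mem_singleton] at h1
          rcases h1 with h1 | h1 | h1
          · exact Or.inl (h2 _ h1)
          · exact Or.inr (Or.inl (h2 _ h1))
          · exact Or.inr (Or.inr (Or.inl (h2 _ h1)))
        · refine Or.inr (Or.inr (Or.inr ?_))
          rw [stabilizer_eq_scalars_of_notMem_poles Γ hy]
          exact card_scalars_dvd_two Γ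
      · rw [hz2, he₁, he₂, he₃] at hsum'
        push_cast at hsum'
        have : ∀ e : ℕ, (2 : ℚ) * (1 / (2 * e)) = 1 / e := fun e => by
          rw [mul_one_div, div_mul_eq_div_div]; norm_num
        rw [this, this, this] at hsum'
        rw [hsum']
        ring

end classification

/-! ### The polyhedral groups -/

section polyhedral

variable (Γ : Subgroup SU2) [Finite Γ]

theorem card_orbit_le_of_not_dvd {F : MvPolynomial (Fin 2) ℂ} {k : ℕ}
    (hF : IsInvariantForm Γ F k) {x : ProjLine}
    (h : ¬ Nat.card (MulAction.stabilizer Γ x) ∣ k) : Nat.card (MulAction.orbit Γ x) ≤ k := by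
  obtain ⟨p, rfl⟩ := QuotientGroup.mk_surjective x
  refine card_orbit_le Γ hF.2.2.1 hF.1 hF.2.2.2 (p := p) ?_
  by_contra h0
  exact h (card_stabilizer_dvd Γ hF.2.2.1 hF.2.2.2 h0)

theorem card_orbit_add_card_orbit_le_of_not_dvd {F : MvPolynomial (Fin 2) ℂ} {k : ℕ}
    (hF : IsInvariantForm Γ F k) {x y : ProjLine}
    (hx : ¬ Nat.card (MulAction.stabilizer Γ x) ∣ k)
    (hy : ¬ Nat.card (MulAction.stabilizer Γ y) ∣ k) (hxy : y ∉ MulAction.orbit Γ x) :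
    Nat.card (MulAction.orbit Γ x) + Nat.card (MulAction.orbit Γ y) ≤ k := by
  obtain ⟨p, rfl⟩ := QuotientGroup.mk_surjective x
  obtain ⟨q, rfl⟩ := QuotientGroup.mk_surjective y
  refine card_orbit_add_card_orbit_le Γ hF.2.2.1 hF.1 hF.2.2.2 (p := p) (q := q) ?_ ?_ hxy
  · by_contra h0
    exact hx (card_stabilizer_dvd Γ hF.2.2.1 hF.2.2.2 h0)
  · by_contra h0
    exact hy (card_stabilizer_dvd Γ hF.2.2.1 hF.2.2.2 h0)

variable {P : MvPolynomial (Fin 2) ℂ} {d : ℕ}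

/-- The orbits of poles have 6, 4, 4 points; n = 4 with the orbit of 6. An invariant of degree 4
would vanish on both orbits of 4 points, as 6 does not divide 4: too many zeros. -/
theorem adjoin_multiplet_eq_of_tetrahedral (h : ThreeOrbits Γ 4 6 6) (hT : Nat.card Γ = 24)
    (hP : IsLowestInvariant Γ P d) :
    hessian P ≠ 0 ∧ cross P (hessian P) ≠ 0 ∧
      Algebra.adjoin ℂ (multiplet P : Set (SU2 → ℂ)) = quotientFunctions Γ := by
  obtain ⟨x₁, x₂, x₃, h₁, h₂, h₃, ⟨h₁₂, h₁₃, h₂₃⟩, hall⟩ := h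
  have o₁ := card_orbit_mul_card_stabilizer Γ x₁
  have o₂ := card_orbit_mul_card_stabilizer Γ x₂
  have o₃ := card_orbit_mul_card_stabilizer Γ x₃
  rw [h₁, hT] at o₁
  rw [h₂, hT] at o₂
  rw [h₃, hT] at o₃
  refine adjoin_multiplet_eq_of_isLowestInvariant Γ x₁ (n := 4) (by norm_num) h₁ (by omega)
    (fun y hy => ?_) (fun F hF => ?_) hP
  · rcases hall y with h | h | h | h
    · exact absurd h hy
    · rw [card_stabilizer_eq_of_mem_orbit Γ h, h₂]
    · rw [card_stabilizer_eq_of_mem_orbit Γ h, h₃]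
    · exact h.trans (by norm_num)
  · have := card_orbit_add_card_orbit_le_of_not_dvd Γ hF (x := x₂) (y := x₃) (by rw [h₂]; norm_num)
      (by rw [h₃]; norm_num) h₂₃
    omega

/-- The orbits of poles have 12, 8, 6 points; n = 6 with the orbit of 8. An invariant of degree 6
would have 12 zeros, as 4 does not divide 6. -/
theorem adjoin_multiplet_eq_of_octahedral (h : ThreeOrbits Γ 4 6 8) (hT : Nat.card Γ = 48)
    (hP : IsLowestInvariant Γ P d) :
    hessian P ≠ 0 ∧ cross P (hessian P) ≠ 0 ∧
      Algebra.adjoin ℂ (multiplet P : Set (SU2 → ℂ)) = quotientFunctions Γ := by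
  obtain ⟨x₁, x₂, x₃, h₁, h₂, h₃, ⟨h₁₂, h₁₃, h₂₃⟩, hall⟩ := h
  have o₁ := card_orbit_mul_card_stabilizer Γ x₁
  have o₂ := card_orbit_mul_card_stabilizer Γ x₂
  rw [h₁, hT] at o₁
  rw [h₂, hT] at o₂
  refine adjoin_multiplet_eq_of_isLowestInvariant Γ x₂ (n := 6) (by norm_num) h₂ (by omega)
    (fun y hy => ?_) (fun F hF => ?_) hP
  · rcases hall y with h | h | h | h
    · rw [card_stabilizer_eq_of_mem_orbit Γ h, h₁]; norm_num
    · exact absurd h hy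
    · rw [card_stabilizer_eq_of_mem_orbit Γ h, h₃]
    · exact h.trans (by norm_num)
  · have := card_orbit_le_of_not_dvd Γ hF (x := x₁) (by rw [h₁]; norm_num)
    omega

/-- The orbits of poles have 30, 20, 12 points; n = 10 with the orbit of 12. An invariant of degree
10 would have 30 zeros, as 4 does not divide 10. -/
theorem adjoin_multiplet_eq_of_icosahedral (h : ThreeOrbits Γ 4 6 10) (hT : Nat.card Γ = 120)
    (hP : IsLowestInvariant Γ P d) :
    hessian P ≠ 0 ∧ cross P (hessian P) ≠ 0 ∧
      Algebra.adjoin ℂ (multiplet P : Set (SU2 → ℂ)) = quotientFunctions Γ := by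
  obtain ⟨x₁, x₂, x₃, h₁, h₂, h₃, ⟨h₁₂, h₁₃, h₂₃⟩, hall⟩ := h
  have o₁ := card_orbit_mul_card_stabilizer Γ x₁
  have o₃ := card_orbit_mul_card_stabilizer Γ x₃
  rw [h₁, hT] at o₁
  rw [h₃, hT] at o₃
  refine adjoin_multiplet_eq_of_isLowestInvariant Γ x₃ (n := 10) (by norm_num) h₃ (by omega)
    (fun y hy => ?_) (fun F hF => ?_) hP
  · rcases hall y with h | h | h | h
    · rw [card_stabilizer_eq_of_mem_orbit Γ h, h₁]; norm_num
    · rw [card_stabilizer_eq_of_mem_orbit Γ h, h₂]; norm_num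
    · exact absurd h hy
    · exact h.trans (by norm_num)
  · have := card_orbit_le_of_not_dvd Γ hF (x := x₁) (by rw [h₁]; norm_num)
    omega

theorem adjoin_multiplet_eq_of_polyhedral
    (hc : ∀ n k, 1 ≤ n → Γ ≠ conjugate k (cyclicGroup n))
    (hb : ∀ n k, 1 ≤ n → Γ ≠ conjugate k (binaryDihedralGroup n))
    (hP : IsLowestInvariant Γ P d) :
    hessian P ≠ 0 ∧ cross P (hessian P) ≠ 0 ∧
      Algebra.adjoin ℂ (multiplet P : Set (SU2 → ℂ)) = quotientFunctions Γ := by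
  rcases cyclic_or_dihedral_or_threeOrbits Γ with ⟨n, k, hn, e⟩ | ⟨n, k, hn, e⟩ | ⟨h, hT⟩ |
    ⟨h, hT⟩ | ⟨h, hT⟩
  · exact absurd e (hc n k hn)
  · exact absurd e (hb n k hn)
  · exact adjoin_multiplet_eq_of_tetrahedral Γ h hT hP
  · exact adjoin_multiplet_eq_of_octahedral Γ h hT hP
  · exact adjoin_multiplet_eq_of_icosahedral Γ h hT hP

/-- The product of all translates of s is invariant. -/
theorem exists_isInvariantForm : ∃ P d, IsInvariantForm Γ P d := by
  have := Fintype.ofFinite Γ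
  refine ⟨∏ γ : Γ, subst ((γ : SU2) : Matrix (Fin 2) (Fin 2) ℂ) (X 0), ∑ _γ : Γ, 1, ?_, ?_, ?_, ?_⟩
  · exact Finset.prod_ne_zero_iff.2 fun γ _ => (subst_eq_zero_iff (γ : SU2) _).not.2 (X_ne_zero 0)
  · simpa using Fintype.card_pos
  · exact IsHomogeneous.prod _ _ _ fun γ _ => isHomogeneous_subst _ (isHomogeneous_X ℂ 0)
  · intro γ hγ
    rw [← substHom_apply, map_prod]
    refine Fintype.prod_equiv (Equiv.mulRight (⟨γ, hγ⟩ : Γ)) _ _ fun g => ?_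
    rw [substHom_apply, subst_subst]
    rfl

theorem exists_isLowestInvariant : ∃ P d, IsLowestInvariant Γ P d := by
  classical
  have h : ∃ d P, IsInvariantForm Γ P d := by
    obtain ⟨P, d, h⟩ := exists_isInvariantForm Γ
    exact ⟨d, P, h⟩
  obtain ⟨P, hP⟩ := Nat.find_spec h
  exact ⟨P, Nat.find h, hP, fun P' d' h' => Nat.find_min' h ⟨P', h'⟩⟩

end polyhedral

/-! ### Change of coordinates -/

section coordinates

variable (k : SU2) (H : Subgroup SU2)

theorem subst_transport (P : MvPolynomial (Fin 2) ℂ) : subst k (transport k P) = P := by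
  rw [transport, subst_subst, ← Submonoid.coe_mul, inv_mul_cancel, Submonoid.coe_one, subst_one]

theorem transport_subst (P : MvPolynomial (Fin 2) ℂ) : transport k (subst k P) = P := by
  rw [transport, subst_subst, ← Submonoid.coe_mul, mul_inv_cancel, Submonoid.coe_one, subst_one]

theorem isInvariant_conjugate_iff {P : MvPolynomial (Fin 2) ℂ} :
    IsInvariant (conjugate k H) P ↔ IsInvariant H (subst k P) := by
  constructor
  · intro h g hg
    have h1 := h (k * g * k⁻¹) (mem_conjugate_iff.2 (by simpa [mul_assoc] using hg))
    rw [subst_subst, ← Submonoid.coe_mul, show k * g = k * g * k⁻¹ * k by group,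
      Submonoid.coe_mul, ← subst_subst, h1]
  · intro h g hg
    have h1 := h _ (mem_conjugate_iff.1 hg)
    refine subst_injective k ?_
    rw [subst_subst] at h1 ⊢
    rwa [← Submonoid.coe_mul, mul_assoc k⁻¹, mul_inv_cancel_left, Submonoid.coe_mul] at h1

theorem isHomogeneous_subst_iff {P : MvPolynomial (Fin 2) ℂ} {d : ℕ} :
    (subst k P).IsHomogeneous d ↔ P.IsHomogeneous d :=
  ⟨fun h => by
    rw [← transport_subst k P]
    exact isHomogeneous_subst _ h, isHomogeneous_subst _⟩

theorem isInvariantForm_conjugate_iff {P : MvPolynomial (Fin 2) ℂ} {d : ℕ} :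
    IsInvariantForm (conjugate k H) P d ↔ IsInvariantForm H (subst k P) d := by
  rw [IsInvariantForm, IsInvariantForm, isInvariant_conjugate_iff, isHomogeneous_subst_iff,
    Ne, Ne, subst_eq_zero_iff]

theorem isInvariantForm_transport_iff {P : MvPolynomial (Fin 2) ℂ} {d : ℕ} :
    IsInvariantForm (conjugate k H) (transport k P) d ↔ IsInvariantForm H P d := by
  rw [isInvariantForm_conjugate_iff, subst_transport]

theorem IsLowestInvariant.transport {P : MvPolynomial (Fin 2) ℂ} {d : ℕ}
    (h : IsLowestInvariant H P d) :
    IsLowestInvariant (conjugate k H) (transport k P) d :=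
  ⟨(isInvariantForm_transport_iff k H).2 h.1, fun _ d' h' =>
    h.2 _ d' ((isInvariantForm_conjugate_iff k H).1 h')⟩

theorem mem_formsIn_of_isInvariant_conjugate {P S : MvPolynomial (Fin 2) ℂ} {d e : ℕ}
    (hP : P.IsHomogeneous d) (hS : S.IsHomogeneous e)
    (h : ∀ A : Subalgebra ℂ (MvPolynomial (Fin 2) ℂ), P ∈ A → S ∈ A → cross P S ∈ A →
      ∀ F, IsInvariant H F → F ∈ A)
    (B : Subalgebra ℂ (SU2 → ℂ)) (hPB : transport k P ∈ formsIn B)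
    (hSB : transport k S ∈ formsIn B) {F : MvPolynomial (Fin 2) ℂ}
    (hF : IsInvariant (conjugate k H) F) : F ∈ formsIn B := by
  have hmem : ∀ G, G ∈ (formsIn B).comap (substHom ((k⁻¹ : SU2) : Matrix (Fin 2) (Fin 2) ℂ)) ↔
      transport k G ∈ formsIn B := fun G => by
    rw [Subalgebra.mem_comap, substHom_apply, transport]
  have hcross := cross_mem_formsIn (isHomogeneous_subst _ hP) (isHomogeneous_subst _ hS) hPB hSB
  rw [cross_subst] at hcross
  have := h _ ((hmem P).2 hPB) ((hmem S).2 hSB) ((hmem (cross P S)).2 hcross)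
    (subst k F) ((isInvariant_conjugate_iff k H).1 hF)
  rwa [hmem, transport_subst] at this

/-- Two forms whose multiplets generate the functions on the quotient, in any coordinates. -/
theorem adjoin_multiplet_transport_eq [Finite (conjugate k H)] {P S : MvPolynomial (Fin 2) ℂ}
    {d e : ℕ} (hP : IsInvariantForm H P d) (hS : IsInvariantForm H S e)
    (h : ∀ A : Subalgebra ℂ (MvPolynomial (Fin 2) ℂ), P ∈ A → S ∈ A → cross P S ∈ A →
      ∀ F, IsInvariant H F → F ∈ A) :
    Algebra.adjoin ℂ (multiplet (transport k P) ∪ multiplet (transport k S) : Set (SU2 → ℂ)) =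
      quotientFunctions (conjugate k H) := by
  have hP' := (isInvariantForm_transport_iff k H).2 hP
  have hS' := (isInvariantForm_transport_iff k H).2 hS
  refine adjoin_eq_quotientFunctions _ _ (Set.union_subset
    (multiplet_le_quotientFunctions hP'.2.2.2) (multiplet_le_quotientFunctions hS'.2.2.2)) ?_
  intro m F _ hF
  refine mem_formsIn_of_isInvariant_conjugate k H hP.2.2.1 hS.2.2.1 h _ ?_ ?_ hF
  · exact mem_formsIn_iff.2 (Set.subset_union_left.trans Algebra.subset_adjoin)
  · exact mem_formsIn_iff.2 (Set.subset_union_right.trans Algebra.subset_adjoin)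

/-- The multiplet of a form that is invariant under the torus does not generate the functions on
the quotient by a group with an invariant form that is not. -/
theorem adjoin_multiplet_transport_ne {P S : MvPolynomial (Fin 2) ℂ} (hP : IsInvariant torus P)
    (hS : IsInvariant H S) (h : ∃ g ∈ torus, evalAt g S ≠ evalAt 1 S) :
    Algebra.adjoin ℂ (multiplet (transport k P) : Set (SU2 → ℂ)) ≠
      quotientFunctions (conjugate k H) := by
  intro e
  obtain ⟨g, hg, hne⟩ := h
  have h1 : IsInvariant (conjugate k torus) (transport k P) := by
    rwa [isInvariant_conjugate_iff, subst_transport]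
  have h2 : IsInvariant (conjugate k H) (transport k S) := by
    rwa [isInvariant_conjugate_iff, subst_transport]
  -- All generators, hence the whole generated algebra, are invariant under the conjugated torus; if
  -- that algebra were all of A_Γ, it would contain the transported S.
  have h3 : restrict (rename Sum.inl (transport k S)) ∈ quotientFunctions (conjugate k torus) := by
    have h4 : Algebra.adjoin ℂ (multiplet (transport k P) : Set (SU2 → ℂ)) ≤
      quotientFunctions (conjugate k torus) :=
      Algebra.adjoin_le (multiplet_le_quotientFunctions h1)
    rw [e] at h4
    exact h4 (multiplet_le_quotientFunctions h2 (mem_multiplet _ 0))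
  have h5 := h3.2 (k * g * k⁻¹) (mem_conjugate_iff.2 (by simpa [mul_assoc] using hg)) k
  rw [← evalAt_eq_restrict, ← evalAt_eq_restrict, transport, evalAt_subst, evalAt_subst] at h5
  apply hne
  simpa [mul_assoc] using h5

end coordinates

/-- The elements of `SU(2)` that fix a form. -/
def fixingGroup (P : MvPolynomial (Fin 2) ℂ) : Subgroup SU2 where
  carrier := {g | subst g P = P}
  one_mem' := subst_one P
  mul_mem' := fun {a b} ha hb => by
    have ha' : subst a P = P := ha
    have hb' : subst b P = P := hb
    change subst ((a * b : SU2) : Matrix (Fin 2) (Fin 2) ℂ) P = P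
    rw [Submonoid.coe_mul, ← subst_subst, ha', hb']
  inv_mem' := fun {a} ha => by
    have ha' : subst a P = P := ha
    exact (congrArg (transport a) ha').symm.trans (transport_subst a P)

theorem isInvariant_iff_le_fixingGroup {Γ : Subgroup SU2} {P : MvPolynomial (Fin 2) ℂ} :
    IsInvariant Γ P ↔ Γ ≤ fixingGroup P := Iff.rfl

/-! ### Monomials -/

section monomials

theorem eq_sum_X_pow (F : MvPolynomial (Fin 2) ℂ) :
    F = ∑ m ∈ F.support, C (coeff m F) * (X 0 ^ m 0 * X 1 ^ m 1) := by
  conv_lhs => rw [F.as_sum]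
  refine Finset.sum_congr rfl fun m _ => ?_
  rw [monomial_eq, Finsupp.prod_fintype _ _ (by simp), Fin.prod_univ_two]

theorem subst_X_zero_of_mem_torus {g : SU2} (hg : g ∈ torus) :
    subst g (X 0) = C ((g : Matrix (Fin 2) (Fin 2) ℂ) 0 0) * X 0 := by
  rw [subst_X, SU2.apply_zero_one, mem_torus_iff.1 hg]
  simp

theorem subst_X_one_of_mem_torus {g : SU2} (hg : g ∈ torus) :
    subst g (X 1) = C (starRingEnd ℂ ((g : Matrix (Fin 2) (Fin 2) ℂ) 0 0)) * X 1 := by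
  rw [subst_X, SU2.apply_one_one, mem_torus_iff.1 hg]
  simp

theorem coeff_subst_of_mem_torus {g : SU2} (hg : g ∈ torus) (F : MvPolynomial (Fin 2) ℂ)
    (m : Fin 2 →₀ ℕ) : coeff m (subst g F) = (g : Matrix (Fin 2) (Fin 2) ℂ) 0 0 ^ m 0 *
      starRingEnd ℂ ((g : Matrix (Fin 2) (Fin 2) ℂ) 0 0) ^ m 1 * coeff m F := by
  classical
  induction F using MvPolynomial.induction_on' with
  | monomial u a =>
    have : subst g (monomial u a) = monomial u ((g : Matrix (Fin 2) (Fin 2) ℂ) 0 0 ^ u 0 *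
        starRingEnd ℂ ((g : Matrix (Fin 2) (Fin 2) ℂ) 0 0) ^ u 1 * a) := by
      rw [monomial_eq, monomial_eq, Finsupp.prod_fintype _ _ (by simp), Fin.prod_univ_two,
        subst_mul, subst_mul, subst_C, subst_pow, subst_pow, subst_X_zero_of_mem_torus hg,
        subst_X_one_of_mem_torus hg]
      simp only [map_mul, map_pow]
      ring
    rw [this, coeff_monomial, coeff_monomial]
    split_ifs with h
    · rw [h]
    · rw [mul_zero]
  | add p q hp hq => rw [subst_add, coeff_add, coeff_add, hp, hq, mul_add]

theorem modEq_of_coeff_ne_zero {n : ℕ} (hn : 1 ≤ n) {F : MvPolynomial (Fin 2) ℂ}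
    (hF : subst (rotation n) F = F) {m : Fin 2 →₀ ℕ} (hm : coeff m F ≠ 0) :
    m 0 ≡ m 1 [MOD n] := by
  have h1 := coeff_subst_of_mem_torus (rotation_mem_torus n) F m
  rw [hF] at h1
  have h2 : (rotation n : Matrix (Fin 2) (Fin 2) ℂ) 0 0 ^ m 0 *
      starRingEnd ℂ ((rotation n : Matrix (Fin 2) (Fin 2) ℂ) 0 0) ^ m 1 = 1 :=
    mul_right_cancel₀ hm (by rw [one_mul, ← h1])
  have h3 := torus_mul_conj (rotation_mem_torus n)
  rw [rotation_zero_zero] at h2 h3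
  have hζ := Complex.isPrimitiveRoot_exp n (by omega)
  set ζ := Complex.exp (2 * Real.pi * Complex.I / n)
  have h4 : ζ ^ m 0 = ζ ^ m 1 := by
    calc ζ ^ m 0 = ζ ^ m 0 * (ζ * starRingEnd ℂ ζ) ^ m 1 := by rw [h3, one_pow, mul_one]
      _ = ζ ^ m 0 * starRingEnd ℂ ζ ^ m 1 * ζ ^ m 1 := by rw [mul_pow]; ring
      _ = ζ ^ m 1 := by rw [h2, one_mul]
  have hu : IsUnit ζ := hζ.isUnit (by omega)
  have h5 : hu.unit ^ m 0 = hu.unit ^ m 1 := Units.ext h4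
  have h6 := pow_eq_pow_iff_modEq.1 h5
  rwa [← orderOf_units, IsUnit.unit_spec, ← hζ.eq_orderOf] at h6

theorem isInvariant_torus_mul : IsInvariant torus (X 0 * X 1) := fun g hg => by
  rw [subst_mul, subst_X_zero_of_mem_torus hg, subst_X_one_of_mem_torus hg]
  have := congrArg (C : ℂ → MvPolynomial (Fin 2) ℂ) (torus_mul_conj hg)
  rw [map_mul, map_one] at this
  linear_combination (X 0 * X 1) * this

theorem subst_rotation_X_pow_add {n : ℕ} (hn : 1 ≤ n) :
    subst (rotation n) (X 0 ^ n + X 1 ^ n) = X 0 ^ n + X 1 ^ n := by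
  have h := (Complex.isPrimitiveRoot_exp n (by omega)).pow_eq_one
  rw [subst_add, subst_pow, subst_pow, subst_X_zero_of_mem_torus (rotation_mem_torus n),
    subst_X_one_of_mem_torus (rotation_mem_torus n), rotation_zero_zero, mul_pow, mul_pow,
    ← map_pow, ← map_pow, ← map_pow, h, map_one, map_one, map_one, one_mul, one_mul]

theorem evalAt_X_pow_add {n : ℕ} (hn : 1 ≤ n) {g : SU2} (hg : g ∈ torus) :
    evalAt g (X 0 ^ n + X 1 ^ n) = (g : Matrix (Fin 2) (Fin 2) ℂ) 0 0 ^ n := by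
  simp [evalAt, mem_torus_iff.1 hg, show n ≠ 0 by omega]

theorem X_pow_add_ne_zero {n : ℕ} (hn : 1 ≤ n) :
    (X 0 ^ n + X 1 ^ n : MvPolynomial (Fin 2) ℂ) ≠ 0 := by
  intro h
  have := evalAt_X_pow_add hn (one_mem torus)
  rw [h] at this
  simp [evalAt] at this

theorem isHomogeneous_X_pow_add (n : ℕ) :
    (X 0 ^ n + X 1 ^ n : MvPolynomial (Fin 2) ℂ).IsHomogeneous n :=
  (isHomogeneous_X_pow 0 n).add (isHomogeneous_X_pow 1 n)

theorem exists_mem_torus_evalAt_ne {n : ℕ} (hn : 1 ≤ n) :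
    ∃ g ∈ torus, evalAt g (X 0 ^ n + X 1 ^ n) ≠ evalAt 1 (X 0 ^ n + X 1 ^ n) := by
  have hg : diagonal (Complex.exp Complex.I) normSq_exp_I ∈ torus := rfl
  refine ⟨_, hg, ?_⟩
  rw [evalAt_X_pow_add hn hg, evalAt_X_pow_add hn (one_mem torus), diagonal, SU2.mk_zero_zero]
  simp only [Submonoid.coe_one, Matrix.one_apply_eq, one_pow]
  intro h
  have := eq_zero_of_conj_exp_I_pow_eq_one (n := n) (by rw [← map_pow, h, map_one])
  omega

end monomials

/-! ### The cyclic groups -/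

section cyclic

variable {n : ℕ}

theorem isInvariantForm_cyclicGroup_mul (n : ℕ) : IsInvariantForm (cyclicGroup n) (X 0 * X 1) 2 :=
  ⟨mul_ne_zero (X_ne_zero 0) (X_ne_zero 1), by norm_num,
    (isHomogeneous_X ℂ 0).mul (isHomogeneous_X ℂ 1),
    fun g hg => isInvariant_torus_mul g (cyclicGroup_le_torus n hg)⟩

theorem isInvariantForm_cyclicGroup_add (hn : 1 ≤ n) :
    IsInvariantForm (cyclicGroup n) (X 0 ^ n + X 1 ^ n) n :=
  ⟨X_pow_add_ne_zero hn, hn, isHomogeneous_X_pow_add n, by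
    rw [isInvariant_iff_le_fixingGroup, cyclicGroup, Subgroup.zpowers_le]
    exact subst_rotation_X_pow_add hn⟩

theorem add_eq_of_coeff_ne_zero {F : MvPolynomial (Fin 2) ℂ} {d : ℕ} (hF : F.IsHomogeneous d)
    {m : Fin 2 →₀ ℕ} (hm : coeff m F ≠ 0) : m 0 + m 1 = d := by
  have := hF hm
  rwa [Finsupp.weight_apply, Finsupp.sum_fintype _ _ (by simp), Fin.sum_univ_two, Pi.one_apply,
    Pi.one_apply, smul_eq_mul, smul_eq_mul, mul_one, mul_one] at this

theorem isLowestInvariant_cyclicGroup (hn : 2 ≤ n) :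
    IsLowestInvariant (cyclicGroup n) (X 0 * X 1) 2 := by
  refine ⟨isInvariantForm_cyclicGroup_mul n, fun F d hF => ?_⟩
  obtain ⟨h0, hd, hFd, hinv⟩ := hF
  obtain ⟨m, hm⟩ := ne_zero_iff.1 h0
  have h1 := add_eq_of_coeff_ne_zero hFd hm
  have h2 := modEq_of_coeff_ne_zero (by omega)
    (hinv (rotation n) (Subgroup.mem_zpowers (rotation n))) hm
  by_contra hlt
  obtain ⟨h3, h4⟩ | ⟨h3, h4⟩ : (m 0 = 0 ∧ m 1 = 1) ∨ (m 0 = 1 ∧ m 1 = 0) := by omega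
  all_goals
    rw [h3, h4, Nat.ModEq, Nat.mod_eq_of_lt (by omega), Nat.mod_eq_of_lt (by omega)] at h2
    omega

theorem cross_mul_X_pow_add (n : ℕ) : cross (X 0 * X 1) (X 0 ^ (n + 1) + X 1 ^ (n + 1)) =
    ((n + 1 : ℕ) : ℂ) • (X 1 ^ (n + 1) - X 0 ^ (n + 1) : MvPolynomial (Fin 2) ℂ) := by
  simp only [cross, Derivation.leibniz, Derivation.leibniz_pow, map_add, pderiv_X_self,
    pderiv_X_of_ne (show (0 : Fin 2) ≠ 1 by decide), pderiv_X_of_ne (show (1 : Fin 2) ≠ 0 by decide),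
    smul_eq_mul, smul_eq_C_mul, map_natCast, nsmul_eq_mul, Nat.add_sub_cancel]
  ring

/-- An exponent vector with congruent entries. -/
theorem exists_eq_add_mul_of_modEq {a b : ℕ} (h : a ≡ b [MOD n]) :
    ∃ q, a = b + n * q ∨ b = a + n * q := by
  rcases le_total a b with hab | hab
  · obtain ⟨q, hq⟩ := (Nat.modEq_iff_dvd' hab).1 h
    exact ⟨q, Or.inr (by omega)⟩
  · obtain ⟨q, hq⟩ := (Nat.modEq_iff_dvd' hab).1 h.symm
    exact ⟨q, Or.inl (by omega)⟩

/-- The cross product is n(t^n - s^n), so s^n and t^n are separately in A. Invariance under the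
rotation leaves only monomials whose exponents agree modulo n, and these are products of st with s^n
or t^n. -/
theorem mem_of_isInvariant_cyclicGroup (hn : 1 ≤ n)
    (A : Subalgebra ℂ (MvPolynomial (Fin 2) ℂ)) (hP : X 0 * X 1 ∈ A) (hS : X 0 ^ n + X 1 ^ n ∈ A)
    (hR : cross (X 0 * X 1) (X 0 ^ n + X 1 ^ n) ∈ A) (F : MvPolynomial (Fin 2) ℂ)
    (hF : IsInvariant (cyclicGroup n) F) : F ∈ A := by
  have hn0 : (n : ℂ) ≠ 0 := by exact_mod_cast (by omega : n ≠ 0)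
  have hR' : X 1 ^ n - X 0 ^ n ∈ A := by
    obtain ⟨m, rfl⟩ := Nat.exists_eq_add_of_le' hn
    rw [cross_mul_X_pow_add] at hR
    have := A.smul_mem hR ((m + 1 : ℕ) : ℂ)⁻¹
    rwa [smul_smul, inv_mul_cancel₀ hn0, one_smul] at this
  have hhalf : ∀ G : MvPolynomial (Fin 2) ℂ, (2 : ℂ) • G ∈ A → G ∈ A := fun G hG => by
    have := A.smul_mem hG (2 : ℂ)⁻¹
    rwa [smul_smul, inv_mul_cancel₀ two_ne_zero, one_smul] at this
  have h0 : X 0 ^ n ∈ A := hhalf _ (by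
    rw [two_smul, show (X 0 ^ n + X 0 ^ n : MvPolynomial (Fin 2) ℂ) =
      (X 0 ^ n + X 1 ^ n) - (X 1 ^ n - X 0 ^ n) by ring]
    exact sub_mem hS hR')
  have h1 : X 1 ^ n ∈ A := hhalf _ (by
    rw [two_smul, show (X 1 ^ n + X 1 ^ n : MvPolynomial (Fin 2) ℂ) =
      (X 0 ^ n + X 1 ^ n) + (X 1 ^ n - X 0 ^ n) by ring]
    exact add_mem hS hR')
  rw [eq_sum_X_pow F]
  refine sum_mem fun m hm => mul_mem (A.algebraMap_mem _) ?_
  obtain ⟨q, hq | hq⟩ := exists_eq_add_mul_of_modEq (modEq_of_coeff_ne_zero hn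
    (hF (rotation n) (Subgroup.mem_zpowers (rotation n))) (mem_support_iff.1 hm))
  · rw [hq, show (X 0 ^ (m 1 + n * q) * X 1 ^ m 1 : MvPolynomial (Fin 2) ℂ) =
      (X 0 * X 1) ^ m 1 * (X 0 ^ n) ^ q by ring]
    exact mul_mem (pow_mem hP _) (pow_mem h0 _)
  · rw [hq, show (X 0 ^ m 0 * X 1 ^ (m 0 + n * q) : MvPolynomial (Fin 2) ℂ) =
      (X 0 * X 1) ^ m 0 * (X 1 ^ n) ^ q by ring]
    exact mul_mem (pow_mem hP _) (pow_mem h1 _)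

end cyclic

/-! ### The binary dihedral groups -/

section dihedral

variable {n : ℕ}

theorem subst_weyl_X_zero : subst weyl (X 0) = -X 1 := by
  rw [subst_X, SU2.apply_zero_one, weyl, SU2.mk_zero_zero, SU2.mk_one_zero]
  simp

theorem subst_weyl_X_one : subst weyl (X 1) = X 0 := by
  rw [subst_X, SU2.apply_one_one, weyl, SU2.mk_zero_zero, SU2.mk_one_zero]
  simp

theorem isInvariant_binaryDihedralGroup_iff {F : MvPolynomial (Fin 2) ℂ} :
    IsInvariant (binaryDihedralGroup n) F ↔
      subst (rotation (2 * n)) F = F ∧ subst weyl F = F := by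
  rw [isInvariant_iff_le_fixingGroup, binaryDihedralGroup, Subgroup.closure_le,
    Set.insert_subset_iff, Set.singleton_subset_iff]
  rfl

theorem isInvariantForm_binaryDihedralGroup_mul (n : ℕ) :
    IsInvariantForm (binaryDihedralGroup n) (X 0 ^ 2 * X 1 ^ 2) 4 := by
  refine ⟨mul_ne_zero (pow_ne_zero 2 (X_ne_zero 0)) (pow_ne_zero 2 (X_ne_zero 1)), by norm_num,
    (isHomogeneous_X_pow 0 2).mul (isHomogeneous_X_pow 1 2), ?_⟩
  rw [isInvariant_binaryDihedralGroup_iff, ← mul_pow]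
  constructor
  · exact isInvariant_torus_mul.pow 2 _ (rotation_mem_torus _)
  · rw [subst_pow, subst_mul, subst_weyl_X_zero, subst_weyl_X_one]
    ring

theorem isInvariantForm_binaryDihedralGroup_add (hn : 1 ≤ n) :
    IsInvariantForm (binaryDihedralGroup n) (X 0 ^ (2 * n) + X 1 ^ (2 * n)) (2 * n) := by
  refine ⟨X_pow_add_ne_zero (by omega), by omega, isHomogeneous_X_pow_add _, ?_⟩
  rw [isInvariant_binaryDihedralGroup_iff]
  constructor
  · exact subst_rotation_X_pow_add (by omega)
  · rw [subst_add, subst_pow, subst_pow, subst_weyl_X_zero, subst_weyl_X_one,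
      (even_two_mul n).neg_pow, add_comm]

theorem isLowestInvariant_binaryDihedralGroup (hn : 2 ≤ n) :
    IsLowestInvariant (binaryDihedralGroup n) (X 0 ^ 2 * X 1 ^ 2) 4 := by
  refine ⟨isInvariantForm_binaryDihedralGroup_mul n, fun F d hF => ?_⟩
  obtain ⟨h0, hd, hFd, hinv⟩ := hF
  obtain ⟨hrot, hweyl⟩ := isInvariant_binaryDihedralGroup_iff.1 hinv
  by_contra hlt
  -- Below degree 4 ≤ 2n, congruent exponents are equal, which leaves only st; but `weyl` changes
  -- its sign.
  have hone : ∀ m, coeff m F ≠ 0 → m 0 = 1 ∧ m 1 = 1 := fun m hm => by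
    have h1 := add_eq_of_coeff_ne_zero hFd hm
    have h2 := modEq_of_coeff_ne_zero (n := 2 * n) (by omega) hrot hm
    rw [Nat.ModEq, Nat.mod_eq_of_lt (by omega), Nat.mod_eq_of_lt (by omega)] at h2
    omega
  have h1 : F = C (∑ m ∈ F.support, coeff m F) * (X 0 * X 1) := by
    conv_lhs => rw [eq_sum_X_pow F]
    rw [map_sum, Finset.sum_mul]
    refine Finset.sum_congr rfl fun m hm => ?_
    obtain ⟨e0, e1⟩ := hone m (mem_support_iff.1 hm)
    rw [e0, e1, pow_one, pow_one]
  have h2 : subst weyl F = -F := by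
    rw [h1, subst_mul, subst_mul, subst_C, subst_weyl_X_zero, subst_weyl_X_one]
    ring
  rw [hweyl] at h2
  exact h0 (self_eq_neg.1 h2)

theorem cross_sq_mul_sq_X_pow_add (n : ℕ) :
    cross (X 0 ^ 2 * X 1 ^ 2) (X 0 ^ (n + 1) + X 1 ^ (n + 1)) =
      (2 * (n + 1 : ℕ) : ℂ) •
        (X 0 * X 1 * (X 1 ^ (n + 1) - X 0 ^ (n + 1)) : MvPolynomial (Fin 2) ℂ) := by
  simp only [cross, Derivation.leibniz, Derivation.leibniz_pow, map_add, pderiv_X_self,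
    pderiv_X_of_ne (show (0 : Fin 2) ≠ 1 by decide), pderiv_X_of_ne (show (1 : Fin 2) ≠ 0 by decide),
    smul_eq_mul, smul_eq_C_mul, map_natCast, nsmul_eq_mul, Nat.add_sub_cancel, map_mul, map_ofNat]
  ring

/-! ### Newton recursions for sums and differences of powers -/

section recursion

variable {R : Type*} [CommRing R] [Algebra ℂ R] (A : Subalgebra ℂ R) {x y : R}

theorem pow_add_pow_mem (hadd : x + y ∈ A) (hmul : x * y ∈ A) (q : ℕ) : x ^ q + y ^ q ∈ A := by
  induction q using Nat.strong_induction_on with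
  | _ q ih =>
    match q, ih with
    | 0, _ => simpa using add_mem A.one_mem A.one_mem
    | 1, _ => simpa using hadd
    | q + 2, ih =>
      rw [show x ^ (q + 2) + y ^ (q + 2) =
        (x + y) * (x ^ (q + 1) + y ^ (q + 1)) - x * y * (x ^ q + y ^ q) by ring]
      exact sub_mem (mul_mem hadd (ih _ (by omega))) (mul_mem hmul (ih _ (by omega)))

/-- Used with x = s^(2n), y = t^(2n), z = st: the differences are not themselves available, only
their products with st. -/
theorem mul_pow_sub_pow_mem {z : R} (hadd : x + y ∈ A) (hmul : x * y ∈ A)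
    (hsub : z * (x - y) ∈ A) (q : ℕ) : z * (x ^ q - y ^ q) ∈ A := by
  induction q using Nat.strong_induction_on with
  | _ q ih =>
    match q, ih with
    | 0, _ => simp
    | 1, _ => simpa using hsub
    | q + 2, ih =>
      rw [show z * (x ^ (q + 2) - y ^ (q + 2)) =
        (x + y) * (z * (x ^ (q + 1) - y ^ (q + 1))) - x * y * (z * (x ^ q - y ^ q)) by ring]
      exact sub_mem (mul_mem hadd (ih _ (by omega))) (mul_mem hmul (ih _ (by omega)))

variable {s t : R} {n : ℕ}

/-- For even b, (st)^b is a power of s²t²; for odd b one spare factor st is absorbed by the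
difference of powers. -/
theorem mul_pow_mul_mem (hP : s ^ 2 * t ^ 2 ∈ A) (hS : s ^ (2 * n) + t ^ (2 * n) ∈ A)
    (hR : s * t * (s ^ (2 * n) - t ^ (2 * n)) ∈ A) (b q : ℕ) :
    (s * t) ^ b * ((s ^ (2 * n)) ^ q + (-1) ^ b * (t ^ (2 * n)) ^ q) ∈ A := by
  have hxy : s ^ (2 * n) * t ^ (2 * n) ∈ A := by
    rw [pow_mul, pow_mul, ← mul_pow]
    exact pow_mem hP n
  rcases Nat.even_or_odd' b with ⟨e, rfl | rfl⟩
  · rw [(even_two_mul e).neg_one_pow, one_mul, pow_mul, mul_pow]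
    exact mul_mem (pow_mem hP e) (pow_add_pow_mem A hS hxy q)
  · rw [(odd_two_mul_add_one e).neg_one_pow, neg_one_mul, ← sub_eq_add_neg, pow_succ, mul_assoc,
      pow_mul, mul_pow]
    exact mul_mem (pow_mem hP e) (mul_pow_sub_pow_mem A hS hxy hR q)

theorem pow_mul_pow_add_mem (hP : s ^ 2 * t ^ 2 ∈ A) (hS : s ^ (2 * n) + t ^ (2 * n) ∈ A)
    (hR : s * t * (s ^ (2 * n) - t ^ (2 * n)) ∈ A) {a b : ℕ} (hab : a ≡ b [MOD 2 * n]) :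
    s ^ a * t ^ b + (-1) ^ a * (s ^ b * t ^ a) ∈ A := by
  obtain ⟨q, rfl | rfl⟩ := exists_eq_add_mul_of_modEq hab
  · have he : ((-1) ^ (b + 2 * n * q) : R) = (-1) ^ b := by
      rw [pow_add, mul_assoc, (even_two_mul (n * q)).neg_one_pow, mul_one]
    have := mul_pow_mul_mem A hP hS hR b q
    rw [mul_pow, ← pow_mul, ← pow_mul] at this
    rw [he, pow_add, pow_add]
    convert this using 1
    ring
  · have hs : ((-1) ^ a * (-1) ^ a : R) = 1 := by
      rw [← mul_pow, neg_one_mul, neg_neg, one_pow]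
    have := A.mul_mem (pow_mem (A.neg_mem A.one_mem) a) (mul_pow_mul_mem A hP hS hR a q)
    rw [mul_pow, ← pow_mul, ← pow_mul] at this
    rw [pow_add, pow_add]
    convert this using 1
    generalize ((-1) ^ a : R) = c at *
    linear_combination -(s ^ a * (t ^ a * t ^ (2 * n * q))) * hs

end recursion

/-- `weyl` sends s to -t and t to s. For an invariant F the left side is 2F, so F becomes a
combination of symmetrized monomials. -/
theorem add_subst_weyl (F : MvPolynomial (Fin 2) ℂ) :
    F + subst weyl F = ∑ m ∈ F.support, C (coeff m F) *
      (X 0 ^ m 0 * X 1 ^ m 1 + (-1) ^ m 0 * (X 0 ^ m 1 * X 1 ^ m 0)) := by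
  have h : subst weyl F = ∑ m ∈ F.support, C (coeff m F) *
      ((-1) ^ m 0 * (X 0 ^ m 1 * X 1 ^ m 0)) := by
    rw [congrArg (subst weyl) (eq_sum_X_pow F), subst_sum]
    refine Finset.sum_congr rfl fun m _ => ?_
    rw [subst_mul, subst_mul, subst_C, subst_pow, subst_pow, subst_weyl_X_zero,
      subst_weyl_X_one, neg_pow, mul_comm (X 0 ^ m 1), mul_assoc]
  rw [h]
  simp only [mul_add, Finset.sum_add_distrib]
  exact congrArg (· + _) (eq_sum_X_pow F)

theorem mem_of_isInvariant_binaryDihedralGroup (hn : 1 ≤ n)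
    (A : Subalgebra ℂ (MvPolynomial (Fin 2) ℂ)) (hP : X 0 ^ 2 * X 1 ^ 2 ∈ A)
    (hS : X 0 ^ (2 * n) + X 1 ^ (2 * n) ∈ A)
    (hR : cross (X 0 ^ 2 * X 1 ^ 2) (X 0 ^ (2 * n) + X 1 ^ (2 * n)) ∈ A)
    (F : MvPolynomial (Fin 2) ℂ) (hF : IsInvariant (binaryDihedralGroup n) F) : F ∈ A := by
  obtain ⟨hrot, hweyl⟩ := isInvariant_binaryDihedralGroup_iff.1 hF
  have hR' : X 0 * X 1 * (X 0 ^ (2 * n) - X 1 ^ (2 * n)) ∈ A := by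
    obtain ⟨m, hm⟩ := Nat.exists_eq_add_of_le' (show 1 ≤ 2 * n by omega)
    rw [hm] at hR ⊢
    rw [cross_sq_mul_sq_X_pow_add] at hR
    have hc : (2 * (m + 1 : ℕ) : ℂ) ≠ 0 :=
      mul_ne_zero two_ne_zero (by exact_mod_cast (by omega : m + 1 ≠ 0))
    have := A.neg_mem (A.smul_mem hR (2 * (m + 1 : ℕ) : ℂ)⁻¹)
    rwa [smul_smul, inv_mul_cancel₀ hc, one_smul, ← mul_neg, neg_sub] at this
  have h2 : (2 : ℂ) • F ∈ A := by
    have e : (2 : ℂ) • F = F + subst weyl F := by rw [hweyl, two_smul]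
    rw [e, add_subst_weyl]
    exact sum_mem fun m hm => mul_mem (A.algebraMap_mem _) (pow_mul_pow_add_mem A hP hS hR'
      (modEq_of_coeff_ne_zero (by omega) hrot (mem_support_iff.1 hm)))
  have := A.smul_mem h2 (2 : ℂ)⁻¹
  rwa [smul_smul, inv_mul_cancel₀ two_ne_zero, one_smul] at this

end dihedral

/-! ### Assembly: generating multiplets for each type of group -/

theorem cyclic_generators (n : ℕ) (k : SU2) [Finite (conjugate k (cyclicGroup n))] (hn : 1 ≤ n) :
    IsInvariantForm (conjugate k (cyclicGroup n)) (transport k (X 0 * X 1)) 2 ∧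
    IsInvariantForm (conjugate k (cyclicGroup n)) (transport k (X 0 ^ n + X 1 ^ n)) n ∧
    (2 ≤ n → IsLowestInvariant (conjugate k (cyclicGroup n)) (transport k (X 0 * X 1)) 2) ∧
    Algebra.adjoin ℂ (multiplet (transport k (X 0 * X 1)) : Set (SU2 → ℂ)) ≠
      quotientFunctions (conjugate k (cyclicGroup n)) ∧
    Algebra.adjoin ℂ (multiplet (transport k (X 0 * X 1)) ∪
        multiplet (transport k (X 0 ^ n + X 1 ^ n)) : Set (SU2 → ℂ)) =
      quotientFunctions (conjugate k (cyclicGroup n)) := by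
  have hP := isInvariantForm_cyclicGroup_mul n
  have hS := isInvariantForm_cyclicGroup_add hn
  exact ⟨(isInvariantForm_transport_iff k _).2 hP, (isInvariantForm_transport_iff k _).2 hS,
    fun h => (isLowestInvariant_cyclicGroup h).transport k,
    adjoin_multiplet_transport_ne k _ isInvariant_torus_mul hS.2.2.2
      (exists_mem_torus_evalAt_ne hn),
    adjoin_multiplet_transport_eq k _ hP hS (mem_of_isInvariant_cyclicGroup hn)⟩

theorem binaryDihedral_generators (n : ℕ) (k : SU2)
    [Finite (conjugate k (binaryDihedralGroup n))] (hn : 1 ≤ n) :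
    IsInvariantForm (conjugate k (binaryDihedralGroup n)) (transport k (X 0 ^ 2 * X 1 ^ 2)) 4 ∧
    IsInvariantForm (conjugate k (binaryDihedralGroup n))
      (transport k (X 0 ^ (2 * n) + X 1 ^ (2 * n))) (2 * n) ∧
    (2 ≤ n → IsLowestInvariant (conjugate k (binaryDihedralGroup n))
      (transport k (X 0 ^ 2 * X 1 ^ 2)) 4) ∧
    Algebra.adjoin ℂ (multiplet (transport k (X 0 ^ 2 * X 1 ^ 2)) : Set (SU2 → ℂ)) ≠
      quotientFunctions (conjugate k (binaryDihedralGroup n)) ∧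
    Algebra.adjoin ℂ (multiplet (transport k (X 0 ^ 2 * X 1 ^ 2)) ∪
        multiplet (transport k (X 0 ^ (2 * n) + X 1 ^ (2 * n))) : Set (SU2 → ℂ)) =
      quotientFunctions (conjugate k (binaryDihedralGroup n)) := by
  have hP := isInvariantForm_binaryDihedralGroup_mul n
  have hS := isInvariantForm_binaryDihedralGroup_add hn
  have hT : IsInvariant torus (X 0 ^ 2 * X 1 ^ 2) := by
    rw [← mul_pow]
    exact isInvariant_torus_mul.pow 2
  exact ⟨(isInvariantForm_transport_iff k _).2 hP, (isInvariantForm_transport_iff k _).2 hS,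
    fun h => (isLowestInvariant_binaryDihedralGroup h).transport k,
    adjoin_multiplet_transport_ne k _ hT hS.2.2.2 (exists_mem_torus_evalAt_ne (by omega)),
    adjoin_multiplet_transport_eq k _ hP hS (mem_of_isInvariant_binaryDihedralGroup hn)⟩

theorem exists_two_generators (Γ : Subgroup SU2) [Finite Γ] :
    ∃ P₁ P₂ d₁ d₂, IsInvariantForm Γ P₁ d₁ ∧ IsInvariantForm Γ P₂ d₂ ∧
      Algebra.adjoin ℂ (multiplet P₁ ∪ multiplet P₂ : Set (SU2 → ℂ)) = quotientFunctions Γ := by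
  by_cases hc : ∃ n k, 1 ≤ n ∧ Γ = conjugate k (cyclicGroup n)
  · obtain ⟨n, k, hn, rfl⟩ := hc
    obtain ⟨h1, h2, -, -, h3⟩ := cyclic_generators n k hn
    exact ⟨_, _, _, _, h1, h2, h3⟩
  by_cases hb : ∃ n k, 1 ≤ n ∧ Γ = conjugate k (binaryDihedralGroup n)
  · obtain ⟨n, k, hn, rfl⟩ := hb
    obtain ⟨h1, h2, -, -, h3⟩ := binaryDihedral_generators n k hn
    exact ⟨_, _, _, _, h1, h2, h3⟩
  obtain ⟨P, d, hP⟩ := exists_isLowestInvariant Γ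
  refine ⟨P, P, d, d, hP.1, hP.1, ?_⟩
  rw [Set.union_self]
  exact (adjoin_multiplet_eq_of_polyhedral Γ (fun n k hn e => hc ⟨n, k, hn, e⟩)
    (fun n k hn e => hb ⟨n, k, hn, e⟩) hP).2.2

end SphereQuotient

end

open MvPolynomial SphereQuotient in
theorem mainTheorem2 (Γ : Subgroup SU2) [Finite Γ] :
    -- there is an invariant of lowest degree
    (∃ P d, IsLowestInvariant Γ P d) ∧
    -- for an invariant `P` of degree `d = 2j ≥ 2`, with multiplet `M`, Hessian `Q` and cross
    -- product `R` of `P` and `Q`: the component of spin `2j - 2` of `M M` is the multiplet of `Q`,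
    -- the component of spin `3j - 3` of `M M M` is the multiplet of `R`
    (∀ P d, 2 ≤ d → P.IsHomogeneous d → IsInvariant Γ P →
      IsInvariant Γ (hessian P) ∧ IsInvariant Γ (cross P (hessian P)) ∧
      spinComponent (multiplet P * multiplet P) (2 * d - 4) = multiplet (hessian P) ∧
      spinComponent (multiplet P * multiplet P * multiplet P) (3 * d - 6) =
        multiplet (cross P (hessian P))) ∧
    -- groups that are neither cyclic nor binary dihedral
    ((∀ n k, 1 ≤ n → Γ ≠ conjugate k (cyclicGroup n)) →
      (∀ n k, 1 ≤ n → Γ ≠ conjugate k (binaryDihedralGroup n)) →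
      ∀ P d, IsLowestInvariant Γ P d →
        hessian P ≠ 0 ∧ cross P (hessian P) ≠ 0 ∧
        Algebra.adjoin ℂ (multiplet P : Set (SU2 → ℂ)) = quotientFunctions Γ) ∧
    -- cyclic groups: `P = s t`, and `s ^ n + t ^ n`
    (∀ n k, 1 ≤ n → Γ = conjugate k (cyclicGroup n) →
      ∀ P S, P = transport k (X 0 * X 1) → S = transport k (X 0 ^ n + X 1 ^ n) →
        IsInvariantForm Γ P 2 ∧ IsInvariantForm Γ S n ∧
        (2 ≤ n → IsLowestInvariant Γ P 2) ∧
        Algebra.adjoin ℂ (multiplet P : Set (SU2 → ℂ)) ≠ quotientFunctions Γ ∧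
        Algebra.adjoin ℂ (multiplet P ∪ multiplet S : Set (SU2 → ℂ)) = quotientFunctions Γ) ∧
    -- binary dihedral groups: `P = s² t²`, and `s ^ (2n) + t ^ (2n)`
    (∀ n k, 1 ≤ n → Γ = conjugate k (binaryDihedralGroup n) →
      ∀ P S, P = transport k (X 0 ^ 2 * X 1 ^ 2) →
        S = transport k (X 0 ^ (2 * n) + X 1 ^ (2 * n)) →
        IsInvariantForm Γ P 4 ∧ IsInvariantForm Γ S (2 * n) ∧
        (2 ≤ n → IsLowestInvariant Γ P 4) ∧
        Algebra.adjoin ℂ (multiplet P : Set (SU2 → ℂ)) ≠ quotientFunctions Γ ∧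
        Algebra.adjoin ℂ (multiplet P ∪ multiplet S : Set (SU2 → ℂ)) = quotientFunctions Γ) ∧
    -- in all cases at most two multiplets are needed
    (∃ P₁ P₂ d₁ d₂, IsInvariantForm Γ P₁ d₁ ∧ IsInvariantForm Γ P₂ d₂ ∧
      Algebra.adjoin ℂ (multiplet P₁ ∪ multiplet P₂ : Set (SU2 → ℂ)) = quotientFunctions Γ) := by
  refine ⟨exists_isLowestInvariant Γ, fun P d hd hP hinv => ⟨hinv.hessian,
    hinv.cross hinv.hessian, spinComponent_mul hd hP, spinComponent_mul_mul hd hP⟩,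
    fun hc hb P d hP => adjoin_multiplet_eq_of_polyhedral Γ hc hb hP, ?_, ?_,
    exists_two_generators Γ⟩
  · rintro n k hn rfl P S rfl rfl
    exact cyclic_generators n k hn
  · rintro n k hn rfl P S rfl rfl
    exact binaryDihedral_generators n k hn
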